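/- **Programs.** Fix $n\ge 0$ variables $X_1,\dots,X_n$ with values in $\mathbb N$. Loop-annotated regular expressions (LARE) are generated by $$E ::= \texttt{skip}\mid X_i:=X_j\mid X_i:=X_j+X_k\mid X_i:=X_j*X_k\mid \tau\mid E_1E_2\mid E_1|E_2\mid E^*\mid[_\ell E],$$ where $\tau$ is the iteration mark. We require that in each $F^*$ every string of $F$ contains a mark $\tau$ outside of the brackets of $F$. $E$ is *closed* if each star lies inside some bracket. A trace $\sigma$ is an initial state followed by a finite sequence of states and marks; $\#\sigma$ is its number of marks. The set of traces $[\![E]\!]$ is defined by: an instruction takes one step; $\tau$ adds a mark and keeps the state; concatenation glues traces whose final and initial states agree; $|$ is union; $E^*$ is the union of all powers of $E$ (the $0$-th consisting of the empty traces); $[\![[_\ell E]]\!]$ consists of the traces $\sigma\in[\![E]\!]$ with $\#\sigma\le$ (initial value of $X_\ell$), with their marks erased. **Dependencies.** Types are $1<1^+<2<3$; $\delta\simeq1$ means $\delta\in\{1,1^+\}$. Over the indices $1,\dots,n+1$ (where $n+1$ stands for the number of marks) there are unary dependencies $i\xrightarrow{\delta}j$ and binary ones $(i,j)\rightrightarrows(k,l)$.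 Products are - $(i\xrightarrow{\alpha}j)\cdot(j\xrightarrow{\beta}k)=i\xrightarrow{\max(\alpha,\beta)}k$; - $(i\xrightarrow{\alpha}j)\cdot((j,j)\rightrightarrows(k,k'))=(i,i)\rightrightarrows(k,k')$ and $((i,i')\rightrightarrows(j,j))\cdot(j\xrightarrow{\alpha}k)=(i,i')\rightrightarrows(k,k)$, for $\alpha\simeq1$; - $((i,i')\rightrightarrows(j,j'))\cdot((j,j')\rightrightarrows(k,k'))$ is $i\xrightarrow{2}k$ if $i=i'$ and $k=k'$, and $(i,i')\rightrightarrows(k,k')$ otherwise; other products are undefined. A matrix $A$ with entries in $\{0,1,1^+,2,3\}$ *expresses* $i\xrightarrow{\delta}j$ if $A_{ij}=\delta\neq0$, and $(i,j)\rightrightarrows(k,l)$ if $A_{ik},A_{jl}\simeq1$ and ($i\ne j$ or $k\neq l$). The finite set $D(E)$ is computed by recursion. For $\texttt{skip}$ and $\tau$ it is the set $\mathrm{Id}$ of dependencies expressed by the identity matrix $I_{n+1}$. For an assignment to $X_i$, column $i$ of $I_{n+1}$ is replaced by the column whose only non-zero entries are: $1$ in row $j$ for $X_i:=X_j$; $1^+$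 in rows $j,k$ for $X_i:=X_j+X_k$ with $j\ne k$, and $2$ in row $j$ if $j=k$; $2$ in rows $j,k$ for $X_i:=X_j*X_k$. Then $D(E_1E_2)=D(E_1)\cdot D(E_2)$ and $D(E_1|E_2)=D(E_1)\cup D(E_2)$. Moreover $D(E^*)=F\cup LC(F)\cdot F$, where $F$ is the least set that contains $\mathrm{Id}\cup D(E)$ and is closed under products, and $LC(F)$ consists of $n+1\xrightarrow{2}i$ for each $i\xrightarrow{1^+}i$ in $F$ and $n+1\xrightarrow{3}i$ for each $i\xrightarrow{2}i$ in $F$. Finally, $D([_\ell E])$ arises from $D(E)$ by replacing each $n+1\xrightarrow{\delta}j$ with $j\ne n+1$ by $\ell\xrightarrow{\delta}j$. **Matrices.** An $(n+1)\times(n+1)$ matrix $A$ over $\{0,1,1^+,2,3\}$ is *admissible* if $A_{n+1,n+1}=1$, and $A_{ij}=1$ implies $A_{kj}=0$ for all $k\ne i$. Let $\mathcal S(E)$ be the set of (component-wise) maximal elements among the admissible matrices all of whose expressed dependencies lie in $D(E)$. **Bounds.** For $v\in\{0,1,1^+,2\}^{n+1}$ let $\Gamma(v)$ be the set of polynomials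 $\sum_{v_i\simeq1}a_ix_i+P$ over $\mathbb N$ with $a_i\in\{0,1\}$, where $P$ has no constant term and depends only on variables $x_i$ with $v_i=2$. A matrix $A$ *describes variable $j$* in a set $\rho$ of traces if some $p\in\Gamma(A_{\bullet j})$ satisfies: for all $\sigma\in\rho$ from $(x_1,\dots,x_n)$ to $(y_1,\dots,y_n)$ and all $x_{n+1}\ge\#\sigma$, $y_j\le p(x_1,\dots,x_{n+1})$ (for $j=n+1$, the requirement is $p=x_{n+1}$). $A$ describes $\rho$ if it does so for every $j\in\{1,\dots,n+1\}$. A set $\mathcal A$ of matrices *describes* $\rho$, written $\rho\models\mathcal A$, if $\rho\subseteq\bigcup_{A\in\mathcal A}\rho_A$ for some sets $\rho_A$ such that each $A\in\mathcal A$ describes $\rho_A$. **Theorem (soundness: upper bounds).** Let $E$ be any LARE program. Call $j$ *good* if $D(E)$ contains no dependency $i\xrightarrow{3}j$. 1. If $D(E)$ contains no dependency of type $3$, then $[\![E]\!]\models\mathcal S(E)$. 2. In general, there are sets $\rho_A$, $A\in\mathcal S(E)$, with $[\![E]\!]\subseteq\bigcup_{A\in\mathcal S(E)}\rho_A$, such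 that each $A\in\mathcal S(E)$ describes every good variable $j$ in $\rho_A$. 3. (Together with the soundness of lower bounds, a sound and complete decision procedure.) For $1\le j\le n$: $j$ is good if and only if there is a polynomial $p$ over $\mathbb N$ with $y_j\le p(x_1,\dots,x_n,\#\sigma)$ for all $\sigma\in[\![E]\!]$ from $\vec x$ to $\vec y$. If $E$ is closed, then $j$ is good if and only if there is a polynomial $p$ over $\mathbb N$ with $y_j\le p(x_1,\dots,x_n)$ for all such $\sigma$. As $D(E)$ is computable, this decides polynomial growth. -/

import Mathlib

/-! ### Programs and their traces -/

/-- A state assigns a natural number to each of the program variables `X_1, …, X_n`. -/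
abbrev LState (n : ℕ) : Type := Fin n → ℕ

/-- The core instructions: `skip`, `X_i := X_j`, `X_i := X_j + X_k`, `X_i := X_j * X_k`. -/
inductive Instr (n : ℕ) : Type
  | skip : Instr n
  | copy (i j : Fin n) : Instr n
  | add (i j k : Fin n) : Instr n
  | mul (i j k : Fin n) : Instr n

/-- The effect of an instruction on the state. -/
def Instr.exec {n : ℕ} : Instr n → LState n → LState n
  | .skip, x => x
  | .copy i j, x => Function.update x i (x j)
  | .add i j k, x => Function.update x i (x j + x k)
  | .mul i j k, x => Function.update x i (x j * x k)

/-- Loop-annotated regular expressions: instructions, the iteration mark, concatenation,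
alternation, iteration, and the loop bracket `[_ℓ E]`. -/
inductive Lare (n : ℕ) : Type
  | instr (a : Instr n) : Lare n
  | mark : Lare n
  | seq (E₁ E₂ : Lare n) : Lare n
  | alt (E₁ E₂ : Lare n) : Lare n
  | star (E : Lare n) : Lare n
  | bracket (l : Fin n) (E : Lare n) : Lare n

/-- Every string of the expression has an iteration mark outside of its inner brackets. -/
def Lare.Guarded {n : ℕ} : Lare n → Prop
  | .instr _ => False
  | .mark => True
  | .seq E₁ E₂ => E₁.Guarded ∨ E₂.Guarded
  | .alt E₁ E₂ => E₁.Guarded ∧ E₂.Guarded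
  | .star _ => False
  | .bracket _ _ => False

/-- Well-formed expressions: each pass through the body of an iteration is marked. -/
def Lare.WellFormed {n : ℕ} : Lare n → Prop
  | .instr _ => True
  | .mark => True
  | .seq E₁ E₂ => E₁.WellFormed ∧ E₂.WellFormed
  | .alt E₁ E₂ => E₁.WellFormed ∧ E₂.WellFormed
  | .star E => E.WellFormed ∧ E.Guarded
  | .bracket _ E => E.WellFormed

/-- Closed expressions: each iteration lies inside some loop bracket. -/
def Lare.Closed {n : ℕ} : Lare n → Prop
  | .instr _ => True
  | .mark => True
  | .seq E₁ E₂ => E₁.Closed ∧ E₂.Closed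
  | .alt E₁ E₂ => E₁.Closed ∧ E₂.Closed
  | .star _ => False
  | .bracket _ _ => True

/-- A trace: an initial state followed by a sequence of items, each being an iteration mark
(`none`) or the next state (`some s`). -/
structure Trace (n : ℕ) : Type where
  head : LState n
  items : List (Option (LState n))

namespace Trace

variable {n : ℕ}

/-- The last state that occurs in a list of items, or `x` if there is none. -/
def lastState (x : LState n) : List (Option (LState n)) → LState n
  | [] => x
  | none :: L => lastState x L
  | some y :: L => lastState y L

/-- The final state of a trace. -/
def final (σ : Trace n) : LState n := lastState σ.head σ.items

/-- The number of iteration marks in a trace. -/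
def count (σ : Trace n) : ℕ := (σ.items.filter Option.isNone).length

/-- Erasing the iteration marks of a trace. -/
def erase (σ : Trace n) : Trace n := ⟨σ.head, σ.items.filter Option.isSome⟩

/-- Concatenation of sets of traces: the final state of the first trace and the initial state of
the second one have to agree, and are coalesced. -/
def concat (R₁ R₂ : Set (Trace n)) : Set (Trace n) :=
  {σ | ∃ σ₁ ∈ R₁, ∃ σ₂ ∈ R₂, σ₁.final = σ₂.head ∧ σ = ⟨σ₁.head, σ₁.items ++ σ₂.items⟩}

/-- Iterated concatenation. -/
def power (R : Set (Trace n)) : ℕ → Set (Trace n)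
  | 0 => {σ | σ.items = []}
  | m + 1 => concat (power R m) R

end Trace

/-- The trace semantics. -/
def Lare.traces {n : ℕ} : Lare n → Set (Trace n)
  | .instr a => {σ | σ.items = [some (a.exec σ.head)]}
  | .mark => {σ | σ.items = [none]}
  | .seq E₁ E₂ => Trace.concat E₁.traces E₂.traces
  | .alt E₁ E₂ => E₁.traces ∪ E₂.traces
  | .star E => ⋃ m : ℕ, Trace.power E.traces m
  | .bracket l E => {τ | ∃ σ ∈ E.traces, σ.count ≤ σ.head l ∧ τ = σ.erase}

/-! ### Dependencies -/

/-- The dependency types `1 < 1⁺ < 2 < 3`. -/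
inductive DepType : Type
  | one
  | onePlus
  | two
  | three
  deriving DecidableEq

instance : Fintype DepType where
  elems := {.one, .onePlus, .two, .three}
  complete := by intro x; cases x <;> decide

/-- The position of a dependency type in the order `1 < 1⁺ < 2 < 3`. -/
def DepType.rank : DepType → ℕ
  | .one => 0
  | .onePlus => 1
  | .two => 2
  | .three => 3

theorem DepType.rank_injective : Function.Injective DepType.rank := by
  intro a b h
  cases a <;> cases b <;> simp_all [DepType.rank]

instance : LinearOrder DepType := LinearOrder.lift' DepType.rank DepType.rank_injective

/-- `δ ≃ 1`, that is, `δ` is `1` or `1⁺`. -/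
def DepType.isOne : DepType → Bool
  | .one => true
  | .onePlus => true
  | .two => false
  | .three => false

/-- Dependencies over the indices `1, …, n + 1`, where the last index stands for the iteration
count: `unary i δ j` is `i →^δ j`, and `binary i j k l` is `(i, j) ⇉ (k, l)`. -/
inductive Dep (n : ℕ) : Type
  | unary (i : Fin (n + 1)) (δ : DepType) (j : Fin (n + 1)) : Dep n
  | binary (i j k l : Fin (n + 1)) : Dep n
  deriving DecidableEq, Fintype

/-- Dependency matrices; the bottom element `⊥` stands for the entry `0` (no dependence), and the
order is the component-wise one. -/
abbrev DepMatrix (n : ℕ) : Type := Fin (n + 1) → Fin (n + 1) → WithBot DepType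

/-- An entry that is `1` or `1⁺`. -/
def entryIsOne : WithBot DepType → Bool
  | ⊥ => false
  | (δ : DepType) => δ.isOne

/-- The identity matrix `I_{n+1}`. -/
def idMatrix (n : ℕ) : DepMatrix n :=
  fun r c => if r = c then (DepType.one : WithBot DepType) else ⊥

/-- The matrix of the dependencies that an instruction induces. -/
def Instr.matrix {n : ℕ} : Instr n → DepMatrix n
  | .skip => idMatrix n
  | .copy i j => fun r c =>
      if c = i.castSucc then
        (if r = j.castSucc then (DepType.one : WithBot DepType) else ⊥)
      else idMatrix n r c
  | .add i j k => fun r c =>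
      if c = i.castSucc then
        (if r = j.castSucc ∨ r = k.castSucc then
          (if j = k then (DepType.two : WithBot DepType) else (DepType.onePlus : WithBot DepType))
        else ⊥)
      else idMatrix n r c
  | .mul i j k => fun r c =>
      if c = i.castSucc then
        (if r = j.castSucc ∨ r = k.castSucc then (DepType.two : WithBot DepType) else ⊥)
      else idMatrix n r c

/-- A dependency is expressed by a matrix if it is one of its non-zero entries, or the
co-existence of two different entries that are `1` or `1⁺`. -/
def Dep.inMatrix {n : ℕ} (A : DepMatrix n) : Dep n → Bool
  | .unary i δ j => decide (A i j = (δ : WithBot DepType))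
  | .binary i j k l => entryIsOne (A i k) && entryIsOne (A j l) && decide (i ≠ j ∨ k ≠ l)

/-- The dependencies expressed by a single matrix. -/
def depsOfMatrix {n : ℕ} (A : DepMatrix n) : Finset (Dep n) :=
  Finset.univ.filter fun D => D.inMatrix A = true

/-- The product of two dependencies; the empty set means that it is undefined. -/
def Dep.prod {n : ℕ} : Dep n → Dep n → Finset (Dep n)
  | .unary i α j, .unary j' β k => if j = j' then {.unary i (max α β) k} else ∅
  | .unary i α j, .binary j₁ j₂ k k' =>
      if j = j₁ ∧ j = j₂ ∧ α.isOne then {.binary i i k k'} else ∅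
  | .binary i i' j₁ j₂, .unary j α k =>
      if j₁ = j ∧ j₂ = j ∧ α.isOne then {.binary i i' k k} else ∅
  | .binary i i' j₁ j₂, .binary j₁' j₂' k k' =>
      if j₁ = j₁' ∧ j₂ = j₂' then
        (if i = i' ∧ k = k' then {.unary i .two k} else {.binary i i' k k'})
      else ∅

/-- The product of two sets of dependencies. -/
def depMul {n : ℕ} (S T : Finset (Dep n)) : Finset (Dep n) :=
  S.biUnion fun D => T.biUnion fun D' => D.prod D'

/-- The dependencies of the identity. -/
def depId (n : ℕ) : Finset (Dep n) := depsOfMatrix (idMatrix n)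

/-- The least set of dependencies that contains the identity and `S` and is closed under products,
computed by iteration (see `depLfp_isLeast`). -/
def depLfp {n : ℕ} (S : Finset (Dep n)) : Finset (Dep n) :=
  (fun T => T ∪ depMul T T)^[Fintype.card (Dep n)] (depId n ∪ S)

theorem depMul_mono {n : ℕ} {S S' T T' : Finset (Dep n)} (h : S ⊆ S') (h' : T ⊆ T') :
    depMul S T ⊆ depMul S' T' := by
  intro D hD
  simp only [depMul, Finset.mem_biUnion] at hD ⊢
  obtain ⟨a, ha, b, hb, hab⟩ := hD
  exact ⟨a, h ha, b, h' hb, hab⟩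

theorem depLfp_isLeast {n : ℕ} (S : Finset (Dep n)) :
    IsLeast {T : Finset (Dep n) | depId n ∪ S ⊆ T ∧ depMul T T ⊆ T} (depLfp S) := by
  set f : Finset (Dep n) → Finset (Dep n) := fun T => T ∪ depMul T T with hf
  set I := depId n ∪ S with hI
  have hinfl : ∀ m, f^[m] I ⊆ f^[m + 1] I := by
    intro m
    rw [Function.iterate_succ_apply']
    exact Finset.subset_union_left
  have hbase : ∀ m, I ⊆ f^[m] I := by
    intro m
    induction m with
    | zero => exact Finset.Subset.refl _
    | succ m ih => exact ih.trans (hinfl m)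
  have hkey : ∀ m, f (f^[m] I) = f^[m] I ∨ m ≤ (f^[m] I).card := by
    intro m
    induction m with
    | zero => exact Or.inr (Nat.zero_le _)
    | succ m ih =>
      by_cases hfix : f (f^[m] I) = f^[m] I
      · left
        rw [Function.iterate_succ_apply', hfix, hfix]
      · right
        have hm := ih.resolve_left hfix
        have hss : f^[m] I ⊂ f^[m + 1] I := by
          refine (hinfl m).ssubset_of_ne ?_
          intro h
          rw [Function.iterate_succ_apply'] at h
          exact hfix h.symm
        have := Finset.card_lt_card hss
        omega
  refine ⟨⟨hbase _, ?_⟩, ?_⟩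
  · have hfix : f (depLfp S) = depLfp S := by
      rcases hkey (Fintype.card (Dep n)) with h | h
      · exact h
      · have huniv : depLfp S = Finset.univ :=
          Finset.eq_univ_of_card _ (le_antisymm (Finset.card_le_univ _) h)
        rw [huniv]
        simp [hf]
    calc depMul (depLfp S) (depLfp S) ⊆ f (depLfp S) := Finset.subset_union_right
      _ = depLfp S := hfix
  · rintro T ⟨hT, hTT⟩
    have : ∀ m, f^[m] I ⊆ T := by
      intro m
      induction m with
      | zero => exact hT
      | succ m ih =>
        rw [Function.iterate_succ_apply']
        exact Finset.union_subset ih ((depMul_mono ih ih).trans hTT)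
    exact this _

/-- Loop correction: `i →^{1⁺} i` yields `n+1 →^2 i`, and `i →^2 i` yields `n+1 →^3 i`. -/
def Dep.loopCorrect {n : ℕ} : Dep n → Finset (Dep n)
  | .unary i .onePlus j => if i = j then {.unary (Fin.last n) .two j} else ∅
  | .unary i .two j => if i = j then {.unary (Fin.last n) .three j} else ∅
  | _ => ∅

/-- Replacing the iteration count by the variable `X_l` as the source of the dependencies
`n+1 →^δ j`, `j ≠ n+1`. -/
def Dep.substSource {n : ℕ} (l : Fin n) : Dep n → Dep n
  | .unary i δ j =>
      if i = Fin.last n ∧ j ≠ Fin.last n then .unary l.castSucc δ j else .unary i δ j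
  | .binary i j k k' => .binary i j k k'

/-- The dependency set that the analysis computes for an expression. -/
def Lare.deps {n : ℕ} : Lare n → Finset (Dep n)
  | .instr a => depsOfMatrix a.matrix
  | .mark => depId n
  | .seq E₁ E₂ => depMul E₁.deps E₂.deps
  | .alt E₁ E₂ => E₁.deps ∪ E₂.deps
  | .star E => depLfp E.deps ∪ depMul ((depLfp E.deps).biUnion Dep.loopCorrect) (depLfp E.deps)
  | .bracket l E => E.deps.image (Dep.substSource l)

/-- The outcome of the decision procedure for the variable `X_j`: the analysis derives no
dependency of type 3 with target `j`. -/
def Lare.noThree {n : ℕ} (E : Lare n) (j : Fin (n + 1)) : Bool :=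
  decide (∀ i, Dep.unary i .three j ∉ E.deps)

/-! ### The matrix abstraction -/

/-- Admissible matrices. -/
def Admissible {n : ℕ} (A : DepMatrix n) : Prop :=
  A (Fin.last n) (Fin.last n) = DepType.one ∧
    ∀ i j, A i j = DepType.one → ∀ k, k ≠ i → A k j = ⊥

/-- The admissible matrices that are compatible with a set of dependencies. -/
def somHat {n : ℕ} (S : Set (Dep n)) : Set (DepMatrix n) :=
  {A | Admissible A ∧
    (∀ (i j : Fin (n + 1)) (δ : DepType), A i j = δ → Dep.unary i δ j ∈ S) ∧
    (∀ i j k l : Fin (n + 1), entryIsOne (A i k) → entryIsOne (A j l) → (i ≠ j ∨ k ≠ l) →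
      Dep.binary i j k l ∈ S)}

/-- The set of maxima of `somHat S`. -/
def som {n : ℕ} (S : Set (Dep n)) : Set (DepMatrix n) := {A | Maximal (· ∈ somHat S) A}

/-! ### Polynomial upper bounds -/

/-- The polynomials `(∑_{v_i ≃ 1} a_i x_i) + P[x_i | v_i = 2]` with `a_i ∈ {0, 1}`, for a vector
`v` without entries `3`.  As no constants occur in programs, `P` has no constant term, so that
only the polynomial `0` belongs to the zero vector. -/
def Gam {n : ℕ} (v : Fin (n + 1) → WithBot DepType) : Set (MvPolynomial (Fin (n + 1)) ℕ) :=
  {p | (∀ i, v i ≠ DepType.three) ∧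
    ∃ (a : Fin (n + 1) → ℕ) (P : MvPolynomial (Fin (n + 1)) ℕ),
      (∀ i, a i = 0 ∨ a i = 1) ∧ (∀ i ∈ P.vars, v i = DepType.two) ∧
      MvPolynomial.constantCoeff P = 0 ∧
      p = (∑ i ∈ Finset.univ.filter (fun i => entryIsOne (v i)),
            MvPolynomial.C (a i) * MvPolynomial.X i) + P}

/-- The point `(x_1, …, x_n, m)`. -/
def extend {n : ℕ} (x : LState n) (m : ℕ) : Fin (n + 1) → ℕ := Fin.snoc (α := fun _ => ℕ) x m

/-- The polynomial `p` in `x_1, …, x_{n+1}` bounds variable `j` in `R`, where `x_{n+1}` is any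
bound on the number of iteration marks; for `j = n + 1` it has to be `x_{n+1}` itself. -/
def Bounds {n : ℕ} (R : Set (Trace n)) (p : MvPolynomial (Fin (n + 1)) ℕ) (j : Fin (n + 1)) :
    Prop :=
  (∀ k : Fin n, j = k.castSucc → ∀ σ ∈ R, ∀ m : ℕ, σ.count ≤ m →
    σ.final k ≤ MvPolynomial.eval (extend σ.head m) p) ∧
  (j = Fin.last n → p = MvPolynomial.X (Fin.last n))

/-- The matrix `A` describes variable `j` in `R`. -/
def DescribesVar {n : ℕ} (R : Set (Trace n)) (A : DepMatrix n) (j : Fin (n + 1)) : Prop :=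
  ∃ p ∈ Gam (fun i => A i j), Bounds R p j

/-- `R ⊨ A : p`, the matrix `A` describes `R` via the multi-polynomial `p`. -/
def DescribesVia {n : ℕ} (R : Set (Trace n)) (A : DepMatrix n)
    (p : Fin (n + 1) → MvPolynomial (Fin (n + 1)) ℕ) : Prop :=
  Admissible A ∧ ∀ j, p j ∈ Gam (fun i => A i j) ∧ Bounds R (p j) j

/-- `R ⊨ 𝒜`, the set of matrices `𝒜` describes `R`. -/
def SetDescribes {n : ℕ} (R : Set (Trace n)) (𝒜 : Set (DepMatrix n)) : Prop :=
  ∃ ρ : DepMatrix n → Set (Trace n), R ⊆ ⋃ A ∈ 𝒜, ρ A ∧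
    ∀ A ∈ 𝒜, ∃ p, DescribesVia (ρ A) A p

/-!
The theorem has an upper-bound half and a lower-bound half, which meet in the dependencies of
type `3`.

**Upper bounds** (`Lare.exists_covered`). Every trace of `E` is described, for all variables that
are not the target of a dependency of type `3`, by a matrix compatible with `E.deps`; the bounds
can be taken in the normal form `∑_{v_i ≃ 1} x_i + K (∑_{v_i = 2} x_i) ^ K` with one `K` for all
traces (`colBound`).  Concatenation corresponds to a product of matrices (`DepMatrix.mul`), in
which two parallel linear paths give an entry `2`; hence linear parts compose without creating
coefficients (`sum_linPart_le`).  Loop brackets merge the row of the iteration count into that of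
the loop bound (`bracketMatrix`).

The hard case is `E*`, where a bound uniform in the number `m` of passes is needed
(`exists_loop_bound`).  Let `F` be the closure of the dependencies of `E` under products.  If `k` is
not the target of a type-`3` dependency of `E*`, then neither is any variable on which `k` depends,
and `k →^2 k` is not in `F`, as otherwise the loop correction would yield `n+1 →^3 k`.  So
dependencies of type `2` are a strict order on the relevant variables, and one argues by induction
along it.  For fixed `k`, all non-linear contributions are then bounded by one and the same
polynomial, multiplied by the number of linear paths along which they reach `k` (`loopWeight`).
Between two visits to the same variable there is only one linear path, because two of them would
give `k →^2 k`; classifying paths by their first visit to a variable, one finds that their number is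
polynomial in `m` (`pathWeight_le_pow`).  If moreover `n+1 →^2 k` is not derived, then no `i` on
which `k` depends has `i →^{1⁺} i`, so that each path passes through boundedly many additions, and
the number of paths is bounded independently of `m` (`loopWeight_le_const`).  The product matrix of
the passes, with type `2` added in the row of the count (`loopMatrix`), therefore describes the
trace.

**Lower bounds** (`Lare.realized`). From all states in which every variable is large, each derived
dependency is witnessed by traces: for `1⁺` the target exceeds the source by the minimum `μ` of the
state, for `2` it is at least twice the source (`μ` times, if the source is the iteration count),
and for `3` it is exponential in the source.  Iterating a witness of `i →^{1⁺} i` or `i →^2 i` gives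
the loop-corrected dependencies.  A dependency of type `3` thus excludes a polynomial bound
(`Lare.noThree_of_bound`).

In closed programs the number of marks is bounded by a constant, which gives the last claim.
-/

/-! ### Products of dependency matrices -/

theorem mem_depMul {n : ℕ} {S T : Finset (Dep n)} {D : Dep n} :
    D ∈ depMul S T ↔ ∃ D₁ ∈ S, ∃ D₂ ∈ T, D ∈ D₁.prod D₂ := by
  simp [depMul]

theorem unary_mem_depMul {n : ℕ} {S T : Finset (Dep n)} {i j k : Fin (n + 1)} {α β : DepType}
    (h₁ : Dep.unary i α j ∈ S) (h₂ : Dep.unary j β k ∈ T) :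
    Dep.unary i (max α β) k ∈ depMul S T :=
  mem_depMul.2 ⟨_, h₁, _, h₂, by simp [Dep.prod]⟩

/-- The type of a two-step path with steps of types `a` and `b`. -/
def entryMul : WithBot DepType → WithBot DepType → WithBot DepType
  | (a : DepType), (b : DepType) => ((max a b : DepType) : WithBot DepType)
  | _, _ => ⊥

theorem entryIsOne_iff {a : WithBot DepType} :
    entryIsOne a = true ↔ a = DepType.one ∨ a = DepType.onePlus := by
  revert a
  simp only [WithBot.forall]
  decide

theorem two_le_iff {a : WithBot DepType} :
    (DepType.two : WithBot DepType) ≤ a ↔ a ≠ ⊥ ∧ ¬ entryIsOne a = true := by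
  revert a
  simp only [WithBot.forall]
  decide

theorem eq_two_of_two_le {a : WithBot DepType} (h : (DepType.two : WithBot DepType) ≤ a)
    (h' : a ≠ DepType.three) : a = DepType.two := by
  revert a
  simp only [WithBot.forall]
  decide

theorem le_entryMul_left {a b : WithBot DepType} (h : b ≠ ⊥) : a ≤ entryMul a b := by
  revert a b
  simp only [WithBot.forall]
  decide

theorem le_entryMul_right {a b : WithBot DepType} (h : a ≠ ⊥) : b ≤ entryMul a b := by
  revert a b
  simp only [WithBot.forall]
  decide

theorem entryMul_eq_coe {a b : WithBot DepType} {δ : DepType} (h : entryMul a b = δ) :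
    ∃ α β : DepType, a = α ∧ b = β ∧ δ = max α β := by
  rcases a with _ | a <;> rcases b with _ | b
  · cases h
  · cases h
  · cases h
  · exact ⟨a, b, rfl, rfl, (WithBot.coe_injective h).symm⟩

theorem entry_eq_coe_of_ne_bot {a : WithBot DepType} (h : a ≠ ⊥) : ∃ δ : DepType, a = δ := by
  rcases a with _ | δ
  · exact absurd rfl h
  · exact ⟨δ, rfl⟩

theorem entryIsOne_max {α β : DepType} : entryIsOne (max α β : DepType) = true ↔
    entryIsOne (α : WithBot DepType) = true ∧ entryIsOne (β : WithBot DepType) = true := by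
  cases α <;> cases β <;> decide

/-- The product of two dependency matrices: an entry is the greatest type of a two-step path, and
at least `2` if there are two different paths both of whose steps are `1` or `1⁺`. -/
def DepMatrix.mul {n : ℕ} (A B : DepMatrix n) : DepMatrix n := fun i k =>
  (Finset.univ.sup fun j => entryMul (A i j) (B j k)) ⊔
    if ∃ j j', j ≠ j' ∧ entryIsOne (A i j) ∧ entryIsOne (B j k) ∧ entryIsOne (A i j') ∧
      entryIsOne (B j' k) then (DepType.two : WithBot DepType) else ⊥

namespace DepMatrix

variable {n : ℕ} {A B : DepMatrix n} {i j j' k : Fin (n + 1)}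

theorem entryMul_le_mul (A B : DepMatrix n) (i j k : Fin (n + 1)) :
    entryMul (A i j) (B j k) ≤ A.mul B i k :=
  (Finset.le_sup (f := fun j => entryMul (A i j) (B j k)) (Finset.mem_univ j)).trans le_sup_left

theorem le_mul_left (h : B j k ≠ ⊥) : A i j ≤ A.mul B i k :=
  (le_entryMul_left h).trans (entryMul_le_mul A B i j k)

theorem le_mul_right (h : A i j ≠ ⊥) : B j k ≤ A.mul B i k :=
  (le_entryMul_right h).trans (entryMul_le_mul A B i j k)

theorem two_le_mul (hj : j ≠ j') (h₁ : entryIsOne (A i j)) (h₂ : entryIsOne (B j k))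
    (h₃ : entryIsOne (A i j')) (h₄ : entryIsOne (B j' k)) :
    (DepType.two : WithBot DepType) ≤ A.mul B i k := by
  unfold mul
  rw [if_pos ⟨j, j', hj, h₁, h₂, h₃, h₄⟩]
  exact le_sup_right

theorem mul_eq_coe {δ : DepType} (h : A.mul B i k = δ) :
    (∃ (j : Fin (n + 1)) (α β : DepType), A i j = α ∧ B j k = β ∧ δ = max α β) ∨
    (δ = DepType.two ∧ ∃ j j', j ≠ j' ∧ entryIsOne (A i j) ∧ entryIsOne (B j k) ∧
      entryIsOne (A i j') ∧ entryIsOne (B j' k)) := by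
  unfold mul at h
  obtain ⟨j, -, hj⟩ := Finset.exists_mem_eq_sup Finset.univ ⟨i, Finset.mem_univ i⟩
    fun j => entryMul (A i j) (B j k)
  rw [hj] at h
  rcases max_choice (entryMul (A i j) (B j k)) (if ∃ j j', j ≠ j' ∧ entryIsOne (A i j) ∧
      entryIsOne (B j k) ∧ entryIsOne (A i j') ∧
      entryIsOne (B j' k) then (DepType.two : WithBot DepType) else ⊥) with h' | h'
  · rw [h'] at h
    obtain ⟨α, β, h₁, h₂, h₃⟩ := entryMul_eq_coe h
    exact Or.inl ⟨j, α, β, h₁, h₂, h₃⟩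
  · rw [h'] at h
    split_ifs at h with hex
    · exact Or.inr ⟨(WithBot.coe_injective h).symm, hex⟩
    · cases h

theorem exists_of_isOne_mul (h : entryIsOne (A.mul B i k)) :
    ∃ j, entryIsOne (A i j) ∧ entryIsOne (B j k) := by
  have h0 : A.mul B i k ≠ ⊥ := by
    intro h0
    rw [h0] at h
    cases h
  obtain ⟨δ, hδ⟩ := entry_eq_coe_of_ne_bot h0
  rcases mul_eq_coe hδ with ⟨j, α, β, h₁, h₂, h₃⟩ | ⟨h₁, -⟩
  · rw [hδ, h₃, entryIsOne_max] at h
    exact ⟨j, by rw [h₁]; exact h.1, by rw [h₂]; exact h.2⟩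
  · rw [hδ, h₁] at h
    cases h

theorem exists_of_mul_eq_one (h : A.mul B i k = DepType.one) :
    ∃ j, A i j = DepType.one ∧ B j k = DepType.one := by
  rcases mul_eq_coe h with ⟨j, α, β, h₁, h₂, h₃⟩ | ⟨h₁, -⟩
  · refine ⟨j, ?_⟩
    rw [h₁, h₂]
    revert h₃
    cases α <;> cases β <;> decide
  · cases h₁

theorem exists_of_mul_ne_bot (h : A.mul B i k ≠ ⊥) : ∃ j, A i j ≠ ⊥ ∧ B j k ≠ ⊥ := by
  obtain ⟨δ, hδ⟩ := entry_eq_coe_of_ne_bot h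
  rcases mul_eq_coe hδ with ⟨j, α, β, h₁, h₂, -⟩ | ⟨-, j, -, -, h₁, h₂, -⟩
  · exact ⟨j, by simp [h₁], by simp [h₂]⟩
  · refine ⟨j, ?_, ?_⟩ <;> (intro h0; simp [h0, entryIsOne] at h₁ h₂)

theorem admissible_mul (hA : Admissible A) (hB : Admissible B) : Admissible (A.mul B) := by
  have key : ∀ i k, A.mul B i k = DepType.one → ∀ i', i' ≠ i → A.mul B i' k = ⊥ := by
    intro i k h i' hi
    obtain ⟨j, h₁, h₂⟩ := exists_of_mul_eq_one h
    by_contra h0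
    obtain ⟨j', h₃, h₄⟩ := exists_of_mul_ne_bot h0
    by_cases hj : j' = j
    · subst hj
      exact h₃ (hA.2 _ _ h₁ _ hi)
    · exact h₄ (hB.2 _ _ h₂ _ hj)
  refine ⟨?_, key⟩
  have hle : (DepType.one : WithBot DepType) ≤ A.mul B (Fin.last n) (Fin.last n) := by
    have := entryMul_le_mul A B (Fin.last n) (Fin.last n) (Fin.last n)
    rw [hA.1, hB.1] at this
    exact this
  obtain ⟨δ, hδ⟩ := entry_eq_coe_of_ne_bot (a := A.mul B (Fin.last n) (Fin.last n)) (by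
    intro h0
    rw [h0] at hle
    exact absurd hle (by decide))
  have hlast : ∀ j, B j (Fin.last n) ≠ ⊥ → j = Fin.last n := fun j hj => by
    by_contra hne
    exact hj (hB.2 _ _ hB.1 _ hne)
  rcases mul_eq_coe hδ with ⟨j, α, β, h₁, h₂, h₃⟩ | ⟨-, j, j', hj, -, h₁, -, h₂⟩
  · obtain rfl := hlast j (by simp [h₂])
    rw [hδ, h₃, WithBot.coe_max, ← h₁, ← h₂, hA.1, hB.1, max_self]
  · refine absurd ((hlast j ?_).trans (hlast j' ?_).symm) hj <;>
      (intro h0; simp [h0, entryIsOne] at h₁ h₂)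

theorem mul_mem_somHat {S T : Finset (Dep n)} (hA : A ∈ somHat (S : Set (Dep n)))
    (hB : B ∈ somHat (T : Set (Dep n))) : A.mul B ∈ somHat (depMul S T : Set (Dep n)) := by
  obtain ⟨hA₀, hA₁, hA₂⟩ := hA
  obtain ⟨hB₀, hB₁, hB₂⟩ := hB
  refine ⟨admissible_mul hA₀ hB₀, ?_, ?_⟩
  · intro i k δ h
    rcases mul_eq_coe h with ⟨j, α, β, h₁, h₂, rfl⟩ | ⟨rfl, j, j', hj, h₁, h₂, h₃, h₄⟩
    · exact unary_mem_depMul (hA₁ _ _ _ h₁) (hB₁ _ _ _ h₂)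
    · exact mem_depMul.2 ⟨_, hA₂ i i j j' h₁ h₃ (Or.inr hj), _,
        hB₂ j j' k k h₂ h₄ (Or.inl hj), by simp [Dep.prod]⟩
  · intro i i' k k' h h' hne
    obtain ⟨j, h₁, h₂⟩ := exists_of_isOne_mul h
    obtain ⟨j', h₃, h₄⟩ := exists_of_isOne_mul h'
    have hone : ∀ {a : WithBot DepType}, entryIsOne a = true → ∃ δ : DepType, a = δ ∧ δ.isOne := by
      intro a ha
      rcases a with _ | δ
      · cases ha
      · exact ⟨δ, rfl, ha⟩
    by_cases hj : j = j'
    · subst hj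
      by_cases hi : i = i'
      · subst hi
        obtain ⟨δ, hδ, hδ'⟩ := hone h₁
        exact mem_depMul.2 ⟨_, hA₁ i j δ hδ, _, hB₂ j j k k' h₂ h₄ (Or.inr (by tauto)),
          by simp [Dep.prod, hδ']⟩
      · by_cases hk : k = k'
        · subst hk
          obtain ⟨δ, hδ, hδ'⟩ := hone h₂
          exact mem_depMul.2 ⟨_, hA₂ i i' j j h₁ h₃ (Or.inl hi), _, hB₁ j k δ hδ,
            by simp [Dep.prod, hδ']⟩
        · exact mem_depMul.2 ⟨_, hA₂ i i' j j h₁ h₃ (Or.inl hi), _,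
            hB₂ j j k k' h₂ h₄ (Or.inr hk), by simp [Dep.prod, hi]⟩
    · refine mem_depMul.2 ⟨_, hA₂ i i' j j' h₁ h₃ (Or.inr hj), _,
        hB₂ j j' k k' h₂ h₄ (Or.inl hj), ?_⟩
      have : ¬ (i = i' ∧ k = k') := by tauto
      simp [Dep.prod, this]

end DepMatrix

theorem somHat_mono {n : ℕ} {S T : Set (Dep n)} (h : S ⊆ T) : somHat S ⊆ somHat T :=
  fun _ hA => ⟨hA.1, fun i j δ hδ => h (hA.2.1 i j δ hδ),
    fun i j k l h₁ h₂ h₃ => h (hA.2.2 i j k l h₁ h₂ h₃)⟩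

theorem mem_somHat_depsOfMatrix {n : ℕ} {A : DepMatrix n} (hA : Admissible A) :
    A ∈ somHat (depsOfMatrix A : Set (Dep n)) := by
  refine ⟨hA, ?_, ?_⟩
  · intro i j δ h
    simp [depsOfMatrix, Dep.inMatrix, h]
  · intro i j k l h₁ h₂ h₃
    simp [depsOfMatrix, Dep.inMatrix, h₁, h₂, h₃]

theorem admissible_idMatrix (n : ℕ) : Admissible (idMatrix n) := by
  refine ⟨by simp [idMatrix], fun i j h k hk => ?_⟩
  by_cases hij : i = j
  · simp [idMatrix, ← hij, hk]
  · simp [idMatrix, hij] at h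

theorem idMatrix_mem_somHat (n : ℕ) : idMatrix n ∈ somHat (depId n : Set (Dep n)) :=
  mem_somHat_depsOfMatrix (admissible_idMatrix n)

/-! ### Counting paths in a sequence of relations -/

section Counting

variable {ι : Type*} [Fintype ι] [DecidableEq ι]

/-- The number of paths from `i` at time `s` to `k` at time `t`, where `L r` is the adjacency
matrix of the steps from time `r` to time `r + 1`. -/
def pathCount (L : ℕ → ι → ι → ℕ) (s : ℕ) : ℕ → ι → ι → ℕ
  | 0, i, k => if i = k then 1 else 0
  | t + 1, i, k =>
      if s ≤ t then ∑ j, pathCount L s t i j * L t j k else if i = k then 1 else 0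

theorem pathCount_self (L : ℕ → ι → ι → ℕ) (s : ℕ) (i k : ι) :
    pathCount L s s i k = if i = k then 1 else 0 := by
  cases s with
  | zero => rfl
  | succ s => simp [pathCount]

theorem pathCount_succ (L : ℕ → ι → ι → ℕ) {s t : ℕ} (h : s ≤ t) (i k : ι) :
    pathCount L s (t + 1) i k = ∑ j, pathCount L s t i j * L t j k := by
  simp [pathCount, h]

/-- The number of paths that stay in `U` and end in `k` at time `t`; they may start anywhere at
time `0`, or at `j` at time `s + 1` with weight `b s j`. -/
def pathWeight (L : ℕ → ι → ι → ℕ) (b : ℕ → ι → ℕ) (U : Finset ι) : ℕ → ι → ℕ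
  | 0, k => if k ∈ U then 1 else 0
  | t + 1, k => if k ∈ U then ∑ j, pathWeight L b U t j * L t j k + b t k else 0

/-- The weight of the paths that stay in `U` and visit `k` for the first time at time `t`. -/
def entryWeight (L : ℕ → ι → ι → ℕ) (b : ℕ → ι → ℕ) (U : Finset ι) (k : ι) : ℕ → ℕ
  | 0 => 1
  | t + 1 => ∑ j, pathWeight L b (U.erase k) t j * L t j k + b t k

/-- Paths are classified by the time of their first visit to `k`. -/
theorem pathWeight_le_sum (L : ℕ → ι → ι → ℕ) (b : ℕ → ι → ℕ) (U : Finset ι) (k : ι) (t : ℕ)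
    (j : ι) : pathWeight L b U t j ≤ pathWeight L b (U.erase k) t j +
      ∑ r ∈ Finset.range (t + 1), entryWeight L b U k r * pathCount L r t k j := by
  induction t generalizing j with
  | zero =>
    by_cases hj : j = k
    · subst hj
      simp only [pathWeight, entryWeight, pathCount]
      split_ifs <;> simp
    · simp [pathWeight, Finset.mem_erase, hj]
  | succ t ih =>
    have hrest : ∑ i, (∑ r ∈ Finset.range (t + 1), entryWeight L b U k r * pathCount L r t k i) *
        L t i j = ∑ r ∈ Finset.range (t + 1), entryWeight L b U k r * pathCount L r (t + 1) k j := by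
      simp_rw [Finset.sum_mul]
      rw [Finset.sum_comm]
      refine Finset.sum_congr rfl fun r hr => ?_
      rw [pathCount_succ L (Nat.lt_succ_iff.1 (Finset.mem_range.1 hr)), Finset.mul_sum]
      exact Finset.sum_congr rfl fun i _ => by ring
    by_cases hU : j ∈ U
    · have h₁ : pathWeight L b U (t + 1) j ≤
          (∑ i, pathWeight L b (U.erase k) t i * L t i j + b t j) +
          ∑ r ∈ Finset.range (t + 1), entryWeight L b U k r * pathCount L r (t + 1) k j := by
        rw [← hrest]
        simp only [pathWeight, if_pos hU]
        have : ∑ i, pathWeight L b U t i * L t i j ≤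
            ∑ i, pathWeight L b (U.erase k) t i * L t i j + ∑ i, (∑ r ∈ Finset.range (t + 1),
              entryWeight L b U k r * pathCount L r t k i) * L t i j := by
          rw [← Finset.sum_add_distrib]
          refine Finset.sum_le_sum fun i _ => ?_
          rw [← add_mul]
          exact Nat.mul_le_mul_right _ (ih i)
        omega
      refine h₁.trans ?_
      rw [Finset.sum_range_succ _ (t + 1), pathCount_self]
      by_cases hj : j = k
      · subst hj
        simp only [entryWeight, if_true, mul_one]
        omega
      · have : pathWeight L b (U.erase k) (t + 1) j =
            ∑ i, pathWeight L b (U.erase k) t i * L t i j + b t j := by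
          simp only [pathWeight]
          rw [if_pos (Finset.mem_erase.2 ⟨hj, hU⟩)]
        rw [this]
        omega
    · simp [pathWeight, hU]

/-- If there is at most one path from each point to itself in each time interval, then the number
of paths grows polynomially in the length. -/
theorem pathWeight_le_pow {L : ℕ → ι → ι → ℕ} {b : ℕ → ι → ℕ} (hL : ∀ t i j, L t i j ≤ 1)
    (hb : ∀ t j, b t j ≤ 1) (hN : ∀ s t, s ≤ t → ∀ k, pathCount L s t k k ≤ 1) (U : Finset ι)
    {t T : ℕ} (hT : t ≤ T) (k : ι) :
    pathWeight L b U t k ≤ ((T + 1) * (Fintype.card ι + 1)) ^ U.card := by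
  induction hu : U.card generalizing U t k with
  | zero =>
    have := Finset.card_eq_zero.1 hu
    subst this
    cases t <;> simp [pathWeight]
  | succ u ih =>
    by_cases hk : k ∈ U
    · have hcard : (U.erase k).card = u := by rw [Finset.card_erase_of_mem hk, hu]; rfl
      set B := ((T + 1) * (Fintype.card ι + 1)) ^ u with hB
      have hB1 : 1 ≤ B := Nat.one_le_pow _ _ (by positivity)
      have he : ∀ r ≤ T, entryWeight L b U k r ≤ (Fintype.card ι + 1) * B := by
        intro r hr
        cases r with
        | zero =>
          simp only [entryWeight]
          nlinarith
        | succ r =>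
          have : ∑ j, pathWeight L b (U.erase k) r j * L r j k ≤ ∑ _j : ι, B := by
            refine Finset.sum_le_sum fun j _ => ?_
            calc pathWeight L b (U.erase k) r j * L r j k ≤ B * 1 :=
                  Nat.mul_le_mul (ih (U.erase k) (by omega) j hcard) (hL r j k)
              _ = B := mul_one B
          rw [Finset.sum_const, Finset.card_univ, smul_eq_mul] at this
          have := hb r k
          simp only [entryWeight]
          nlinarith
      have hzero : pathWeight L b (U.erase k) t k = 0 := by
        cases t <;> simp [pathWeight]
      calc pathWeight L b U t k ≤ _ := pathWeight_le_sum L b U k t k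
        _ = ∑ r ∈ Finset.range (t + 1), entryWeight L b U k r * pathCount L r t k k := by
          rw [hzero, zero_add]
        _ ≤ ∑ _r ∈ Finset.range (t + 1), (Fintype.card ι + 1) * B := by
          refine Finset.sum_le_sum fun r hr => ?_
          have hr' : r ≤ t := Nat.lt_succ_iff.1 (Finset.mem_range.1 hr)
          calc _ ≤ (Fintype.card ι + 1) * B * 1 :=
                Nat.mul_le_mul (he r (hr'.trans hT)) (hN r t hr' k)
            _ = _ := mul_one _
        _ = (t + 1) * ((Fintype.card ι + 1) * B) := by simp
        _ ≤ (T + 1) * ((Fintype.card ι + 1) * B) := Nat.mul_le_mul_right _ (by omega)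
        _ = ((T + 1) * (Fintype.card ι + 1)) ^ (u + 1) := by rw [hB]; ring
    · have : pathWeight L b U t k = 0 := by cases t <;> simp [pathWeight, hk]
      rw [this]
      exact Nat.zero_le _

end Counting

/-! ### Polynomial bounds without constant term -/

/-- Functions bounded by some `K * s ^ K` with `K ≥ 1`: those that are dominated by a polynomial
without constant term. -/
def PolySmall (f : ℕ → ℕ) : Prop := ∃ K, 1 ≤ K ∧ ∀ s, f s ≤ K * s ^ K

theorem mul_pow_self_mono {K K' : ℕ} (h : K ≤ K') (s : ℕ) : K * s ^ K ≤ K' * s ^ K' := by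
  rcases Nat.eq_zero_or_pos s with rfl | hs
  · rcases Nat.eq_zero_or_pos K with rfl | hK
    · simp
    · simp [hK.ne']
  · exact Nat.mul_le_mul h (Nat.pow_le_pow_right hs h)

theorem mul_pow_le_mul_pow_self {c d K : ℕ} (hd : 1 ≤ d) (hc : c ≤ K) (hdK : d ≤ K) (s : ℕ) :
    c * s ^ d ≤ K * s ^ K := by
  rcases Nat.eq_zero_or_pos s with rfl | hs
  · rw [zero_pow (by omega)]
    simp
  · exact Nat.mul_le_mul hc (Nat.pow_le_pow_right hs hdK)

namespace PolySmall

variable {f g : ℕ → ℕ}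

theorem mono (hg : PolySmall g) (h : ∀ s, f s ≤ g s) : PolySmall f :=
  let ⟨K, hK, hb⟩ := hg
  ⟨K, hK, fun s => (h s).trans (hb s)⟩

theorem monomial (c : ℕ) {d : ℕ} (hd : 1 ≤ d) : PolySmall fun s => c * s ^ d :=
  ⟨c + d, by omega, fun s => mul_pow_le_mul_pow_self hd (by omega) (by omega) s⟩

theorem linear (c : ℕ) : PolySmall fun s => c * s := by
  simpa using monomial c le_rfl

theorem add (hf : PolySmall f) (hg : PolySmall g) : PolySmall fun s => f s + g s := by
  obtain ⟨K, hK, hb⟩ := hf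
  obtain ⟨K', hK', hb'⟩ := hg
  refine ⟨K + K', by omega, fun s => ?_⟩
  calc f s + g s ≤ K * s ^ K + K' * s ^ K' := Nat.add_le_add (hb s) (hb' s)
    _ ≤ K * s ^ (K + K') + K' * s ^ (K + K') := by
      rcases Nat.eq_zero_or_pos s with rfl | hs
      · simp [show K ≠ 0 by omega, show K' ≠ 0 by omega]
      · exact Nat.add_le_add (Nat.mul_le_mul_left _ (Nat.pow_le_pow_right hs (by omega)))
          (Nat.mul_le_mul_left _ (Nat.pow_le_pow_right hs (by omega)))
    _ = (K + K') * s ^ (K + K') := by ring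

theorem const_mul_pow (hf : PolySmall f) (c : ℕ) {d : ℕ} (hd : 1 ≤ d) :
    PolySmall fun s => c * f s ^ d := by
  obtain ⟨K, hK, hb⟩ := hf
  refine (monomial (c * K ^ d) (d := K * d) (by nlinarith)).mono fun s => ?_
  calc c * f s ^ d ≤ c * (K * s ^ K) ^ d := Nat.mul_le_mul_left _ (Nat.pow_le_pow_left (hb s) d)
    _ = c * K ^ d * s ^ (K * d) := by rw [mul_pow, pow_mul]; ring

theorem const_mul (hf : PolySmall f) (c : ℕ) : PolySmall fun s => c * f s := by
  simpa using hf.const_mul_pow c le_rfl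

theorem mul (hf : PolySmall f) (hg : PolySmall g) : PolySmall fun s => f s * g s :=
  ((hf.add hg).const_mul_pow 1 (d := 2) (by omega)).mono fun s => by nlinarith

end PolySmall

/-! ### The bounds that a column of a matrix stands for -/

section Column

variable {ι : Type*} [Fintype ι]

/-- The linear part of the bound given by the column `v`: the sum of the variables of type `1` or
`1⁺`. -/
def linPart (v : ι → WithBot DepType) (x : ι → ℕ) : ℕ :=
  ∑ i, if entryIsOne (v i) then x i else 0

/-- The sum of the variables of type `2`, on which the non-linear part depends. -/
def polyArg (v : ι → WithBot DepType) (x : ι → ℕ) : ℕ :=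
  ∑ i, if v i = DepType.two then x i else 0

/-- The normal form `∑_{v_i ≃ 1} x_i + K (∑_{v_i = 2} x_i) ^ K` of the polynomial bounds that the
column `v` stands for. -/
def colBound (K : ℕ) (v : ι → WithBot DepType) (x : ι → ℕ) : ℕ :=
  linPart v x + K * polyArg v x ^ K

theorem colBound_mono {K K' : ℕ} (h : K ≤ K') (v : ι → WithBot DepType) (x : ι → ℕ) :
    colBound K v x ≤ colBound K' v x :=
  Nat.add_le_add_left (mul_pow_self_mono h _) _

theorem le_polyArg {v : ι → WithBot DepType} {x : ι → ℕ} {i : ι} (h : v i = DepType.two) :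
    x i ≤ polyArg v x := by
  have := Finset.single_le_sum (f := fun i => if v i = DepType.two then x i else 0)
    (fun _ _ => Nat.zero_le _) (Finset.mem_univ i)
  simpa [polyArg, h] using this

theorem linPart_le_polyArg {v w : ι → WithBot DepType} {x : ι → ℕ}
    (h : ∀ i, entryIsOne (v i) → w i = DepType.two) : linPart v x ≤ polyArg w x := by
  refine Finset.sum_le_sum fun i _ => ?_
  by_cases hi : entryIsOne (v i)
  · simp [hi, h i hi]
  · simp [hi]

theorem polyArg_mono {v w : ι → WithBot DepType} {x : ι → ℕ}
    (h : ∀ i, v i = DepType.two → w i = DepType.two) : polyArg v x ≤ polyArg w x := by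
  refine Finset.sum_le_sum fun i _ => ?_
  by_cases hi : v i = DepType.two
  · simp [hi, h i hi]
  · simp [hi]

theorem linPart_le_add {v w : ι → WithBot DepType} {x : ι → ℕ}
    (h : ∀ i, entryIsOne (v i) → entryIsOne (w i) ∨ w i = DepType.two) :
    linPart v x ≤ linPart w x + polyArg w x := by
  rw [linPart, linPart, polyArg, ← Finset.sum_add_distrib]
  refine Finset.sum_le_sum fun i _ => ?_
  by_cases hi : entryIsOne (v i)
  · rcases h i hi with h | h <;> simp [hi, h]
  · simp [hi]

/-- Passing to a greater column without entries `3`. -/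
theorem colBound_le_of_le {v w : ι → WithBot DepType} (h : v ≤ w)
    (hw : ∀ i, w i ≠ DepType.three) (K : ℕ) (x : ι → ℕ) :
    colBound K v x ≤ colBound (K + 1) w x := by
  have h₁ : linPart v x ≤ linPart w x + polyArg w x := by
    refine linPart_le_add fun i hi => ?_
    by_cases h' : entryIsOne (w i)
    · exact Or.inl h'
    · refine Or.inr (eq_two_of_two_le (two_le_iff.2 ⟨?_, h'⟩) (hw i))
      intro h0
      have := h i
      rw [h0, le_bot_iff] at this
      rw [this] at hi
      cases hi
  have h₂ : polyArg v x ≤ polyArg w x := by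
    refine polyArg_mono fun i hi => eq_two_of_two_le ?_ (hw i)
    rw [← hi]
    exact h i
  have h₃ := Nat.mul_le_mul_left K (Nat.pow_le_pow_left h₂ K)
  have h₄ : ∀ s, s + K * s ^ K ≤ (K + 1) * s ^ (K + 1) := by
    intro s
    rcases Nat.eq_zero_or_pos s with hs | hs
    · rcases Nat.eq_zero_or_pos K with hK | hK
      · simp [hs, hK]
      · simp [hs, hK.ne']
    · have : s ≤ s ^ (K + 1) := Nat.le_self_pow (by omega) s
      have : s ^ K ≤ s ^ (K + 1) := Nat.pow_le_pow_right hs (by omega)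
      nlinarith
  have h₅ := h₄ (polyArg w x)
  unfold colBound
  omega

end Column

/-! ### Composition of bounds -/

section Compose

variable {n : ℕ} {A B : DepMatrix n} {k : Fin (n + 1)}

/-- In the product of two matrices, a variable whose entry is `1` or `1⁺` is reached by a single
linear path, so that substituting linear parts creates no coefficient greater than `1` for it. -/
theorem sum_linPart_le (h3 : ∀ i, A.mul B i k ≠ DepType.three) (x : Fin (n + 1) → ℕ) :
    ∑ j, (if entryIsOne (B j k) then linPart (fun i => A i j) x else 0) ≤
      linPart (fun i => A.mul B i k) x + (n + 1) * polyArg (fun i => A.mul B i k) x := by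
  have hswap : ∑ j, (if entryIsOne (B j k) then linPart (fun i => A i j) x else 0) =
      ∑ i, ∑ j, (if entryIsOne (B j k) ∧ entryIsOne (A i j) then x i else 0) := by
    rw [Finset.sum_comm]
    refine Finset.sum_congr rfl fun j _ => ?_
    by_cases hj : entryIsOne (B j k)
    · simp [hj, linPart]
    · simp [hj]
  rw [hswap, linPart, polyArg, Finset.mul_sum, ← Finset.sum_add_distrib]
  refine Finset.sum_le_sum fun i _ => ?_
  by_cases hex : ∃ j, entryIsOne (B j k) ∧ entryIsOne (A i j)
  · obtain ⟨j, hj, hj'⟩ := hex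
    by_cases hone : entryIsOne (A.mul B i k)
    · have huniq : ∀ j', j' ≠ j → ¬ (entryIsOne (B j' k) ∧ entryIsOne (A i j')) := by
        rintro j' hne ⟨h₁, h₂⟩
        exact (two_le_iff.1 (DepMatrix.two_le_mul hne h₂ h₁ hj' hj)).2 hone
      rw [Finset.sum_eq_single j (fun j' _ hne => if_neg (huniq j' hne)) (by simp)]
      simp [hj, hj', hone]
    · have hne : A.mul B i k ≠ ⊥ := by
        intro h0
        have hA : A i j ≤ A.mul B i k := DepMatrix.le_mul_left (by
          intro h0; rw [h0] at hj; cases hj)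
        rw [h0, le_bot_iff] at hA
        rw [hA] at hj'
        cases hj'
      have h2 := eq_two_of_two_le (two_le_iff.2 ⟨hne, hone⟩) (h3 i)
      calc ∑ j, (if entryIsOne (B j k) ∧ entryIsOne (A i j) then x i else 0)
          ≤ ∑ _j : Fin (n + 1), x i := Finset.sum_le_sum fun j _ => by split_ifs <;> simp
        _ = (n + 1) * x i := by simp
        _ ≤ _ := by simp [h2]
  · rw [Finset.sum_eq_zero fun j _ => if_neg fun h => hex ⟨j, h⟩]
    exact Nat.zero_le _

theorem polyArg_le_polyArg_mul (h3 : ∀ i, A.mul B i k ≠ DepType.three) {j : Fin (n + 1)}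
    (hj : B j k ≠ ⊥) (x : Fin (n + 1) → ℕ) :
    polyArg (fun i => A i j) x ≤ polyArg (fun i => A.mul B i k) x := by
  refine polyArg_mono fun i hi => eq_two_of_two_le ?_ (h3 i)
  rw [← hi]
  exact DepMatrix.le_mul_left hj

theorem linPart_le_polyArg_mul (h3 : ∀ i, A.mul B i k ≠ DepType.three) {j : Fin (n + 1)}
    (hj : B j k = DepType.two) (x : Fin (n + 1) → ℕ) :
    linPart (fun i => A i j) x ≤ polyArg (fun i => A.mul B i k) x := by
  refine linPart_le_polyArg fun i hi => eq_two_of_two_le ?_ (h3 i)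
  rw [← hj]
  refine DepMatrix.le_mul_right fun h0 => ?_
  rw [h0] at hi
  cases hi

/-- Substituting bounds `linPart + c j` and `linPart + d` for the variables in the linear and in
the non-linear part of a bound. -/
theorem colBound_comp_le (h3 : ∀ i, A.mul B i k ≠ DepType.three) {x z : Fin (n + 1) → ℕ}
    {c : Fin (n + 1) → ℕ} {d S : ℕ} (K : ℕ) (hS : polyArg (fun i => A.mul B i k) x ≤ S)
    (h₁ : ∀ j, entryIsOne (B j k) → z j ≤ linPart (fun i => A i j) x + c j)
    (h₂ : ∀ j, B j k = DepType.two → z j ≤ linPart (fun i => A i j) x + d) :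
    colBound K (fun j => B j k) z ≤ linPart (fun i => A.mul B i k) x +
      ∑ j, (if entryIsOne (B j k) then c j else 0) +
      ((n + 1) * S + K * ((n + 1) * (S + d)) ^ K) := by
  have hlin : linPart (fun j => B j k) z ≤ linPart (fun i => A.mul B i k) x + (n + 1) * S +
      ∑ j, (if entryIsOne (B j k) then c j else 0) := by
    calc linPart (fun j => B j k) z
        ≤ ∑ j, ((if entryIsOne (B j k) then linPart (fun i => A i j) x else 0) +
          (if entryIsOne (B j k) then c j else 0)) := by
          refine Finset.sum_le_sum fun j _ => ?_
          by_cases hj : entryIsOne (B j k)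
          · simpa [hj] using h₁ j hj
          · simp [hj]
      _ ≤ _ := by
          rw [Finset.sum_add_distrib]
          have := sum_linPart_le h3 x
          have := Nat.mul_le_mul_left (n + 1) hS
          omega
  have hpoly : polyArg (fun j => B j k) z ≤ (n + 1) * (S + d) := by
    calc polyArg (fun j => B j k) z ≤ ∑ _j : Fin (n + 1), (S + d) := by
          refine Finset.sum_le_sum fun j _ => ?_
          by_cases hj : B j k = DepType.two
          · have := linPart_le_polyArg_mul h3 hj x
            have := h₂ j hj
            simp only [hj, if_true]
            omega
          · simp [hj]
      _ = (n + 1) * (S + d) := by simp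
  have := Nat.mul_le_mul_left K (Nat.pow_le_pow_left hpoly K)
  unfold colBound
  omega

end Compose

/-! ### The closure under products and the loop correction -/

/-- The variable `j` is not the target of a dependency of type `3`. -/
def NoThree {n : ℕ} (S : Finset (Dep n)) (j : Fin (n + 1)) : Prop :=
  ∀ i, Dep.unary i .three j ∉ S

/-- The dependencies of an iteration, where `F` is the closure of those of the body. -/
def loopClosure {n : ℕ} (F : Finset (Dep n)) : Finset (Dep n) :=
  F ∪ depMul (F.biUnion Dep.loopCorrect) F

section LoopClosure

variable {n : ℕ} {F : Finset (Dep n)} {i j k : Fin (n + 1)} {α β δ : DepType}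

theorem unary_self_mem_depId (i : Fin (n + 1)) : Dep.unary i .one i ∈ depId n := by
  simp [depId, depsOfMatrix, Dep.inMatrix, idMatrix]

theorem unary_mem_of_closed (hF : depMul F F ⊆ F) (h₁ : Dep.unary i α j ∈ F)
    (h₂ : Dep.unary j β k ∈ F) : Dep.unary i (max α β) k ∈ F :=
  hF (unary_mem_depMul h₁ h₂)

theorem subset_loopClosure (F : Finset (Dep n)) : F ⊆ loopClosure F := Finset.subset_union_left

theorem last_two_mem_loopClosure (h : Dep.unary i .onePlus i ∈ F) (h' : Dep.unary i δ k ∈ F) :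
    Dep.unary (Fin.last n) (max .two δ) k ∈ loopClosure F :=
  Finset.mem_union_right _ (unary_mem_depMul
    (Finset.mem_biUnion.2 ⟨_, h, by simp [Dep.loopCorrect]⟩) h')

theorem last_three_mem_loopClosure (h : Dep.unary i .two i ∈ F) (h' : Dep.unary i δ k ∈ F) :
    Dep.unary (Fin.last n) .three k ∈ loopClosure F := by
  have : max DepType.three δ = .three := by cases δ <;> decide
  rw [← this]
  exact Finset.mem_union_right _ (unary_mem_depMul
    (Finset.mem_biUnion.2 ⟨_, h, by simp [Dep.loopCorrect]⟩) h')

theorem exists_of_mem_loopCorrect {D : Dep n} (h : D ∈ F.biUnion Dep.loopCorrect) :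
    ∃ i, (Dep.unary i .onePlus i ∈ F ∧ D = .unary (Fin.last n) .two i) ∨
      (Dep.unary i .two i ∈ F ∧ D = .unary (Fin.last n) .three i) := by
  obtain ⟨D', hD', h⟩ := Finset.mem_biUnion.1 h
  rcases D' with ⟨i, δ, j⟩ | _
  · cases δ <;> simp only [Dep.loopCorrect] at h
    · simp at h
    · split_ifs at h with hij
      · subst hij
        exact ⟨i, Or.inl ⟨hD', by simpa using h⟩⟩
      · simp at h
    · split_ifs at h with hij
      · subst hij
        exact ⟨i, Or.inr ⟨hD', by simpa using h⟩⟩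
      · simp at h
    · simp at h
  · simp [Dep.loopCorrect] at h

/-- The loop-corrected dependencies are closed under products with dependencies of the loop. -/
theorem loopClosure_mul_mem (hF : depMul F F ⊆ F) (h₁ : Dep.unary i α j ∈ loopClosure F)
    (h₂ : Dep.unary j β k ∈ F) : Dep.unary i (max α β) k ∈ loopClosure F := by
  rcases Finset.mem_union.1 h₁ with h₁ | h₁
  · exact subset_loopClosure F (unary_mem_of_closed hF h₁ h₂)
  · obtain ⟨D, hD, D', hD', h⟩ := mem_depMul.1 h₁
    have key : ∀ (c : DepType) (i₀ : Fin (n + 1)), c.isOne = false → D = .unary (Fin.last n) c i₀ →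
        Dep.unary i (max α β) k ∈ loopClosure F := by
      rintro c i₀ hc rfl
      rcases D' with ⟨i₁, δ, j₁⟩ | ⟨i₁, i₂, j₁, j₂⟩
      · simp only [Dep.prod] at h
        split_ifs at h with h0
        · simp only [Finset.mem_singleton, Dep.unary.injEq] at h
          obtain ⟨rfl, rfl, rfl⟩ := h
          subst h0
          rw [max_assoc]
          exact Finset.mem_union_right _ (unary_mem_depMul hD (unary_mem_of_closed hF hD' h₂))
        · simp at h
      · simp [Dep.prod, hc] at h
    obtain ⟨i₀, ⟨-, h0⟩ | ⟨-, h0⟩⟩ := exists_of_mem_loopCorrect hD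
    · exact key _ _ rfl h0
    · exact key _ _ rfl h0

theorem NoThree.pred (hF : depMul F F ⊆ F) (hk : NoThree (loopClosure F) k)
    (h : Dep.unary j δ k ∈ F) : NoThree (loopClosure F) j := by
  intro i hi
  have := loopClosure_mul_mem hF hi h
  rw [show max DepType.three δ = .three by cases δ <;> decide] at this
  exact hk i this

theorem NoThree.two_notMem (hk : NoThree (loopClosure F) k) : Dep.unary k .two k ∉ F :=
  fun h => hk _ (last_three_mem_loopClosure h h)

theorem onePlus_self_notMem (h' : Dep.unary (Fin.last n) .two k ∉ loopClosure F) :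
    Dep.unary k .onePlus k ∉ F := fun h => h' (last_two_mem_loopClosure h h)

theorem NoThree.entry_ne (hk : NoThree F k) {A : DepMatrix n}
    (hA : A ∈ somHat (F : Set (Dep n))) (i : Fin (n + 1)) : A i k ≠ DepType.three :=
  fun h => hk i (hA.2.1 _ _ _ h)

theorem NoThree.mono {S T : Finset (Dep n)} (h : S ⊆ T) (hk : NoThree T k) : NoThree S k :=
  fun i hi => hk i (h hi)

end LoopClosure

/-- The product of the matrices at the times `s, …, t - 1`. -/
def pathMatrix {n : ℕ} (A : ℕ → DepMatrix n) (s : ℕ) : ℕ → DepMatrix n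
  | 0 => idMatrix n
  | t + 1 => if s ≤ t then (pathMatrix A s t).mul (A t) else idMatrix n

section Loop

variable {n : ℕ} {F : Finset (Dep n)} {A : ℕ → DepMatrix n} {s t : ℕ} {i j k : Fin (n + 1)}

theorem pathMatrix_succ (h : s ≤ t) : pathMatrix A s (t + 1) = (pathMatrix A s t).mul (A t) := by
  simp [pathMatrix, h]

theorem pathMatrix_self (A : ℕ → DepMatrix n) (s : ℕ) : pathMatrix A s s = idMatrix n := by
  cases s <;> simp [pathMatrix]

theorem pathMatrix_mem_somHat (hid : depId n ⊆ F) (hF : depMul F F ⊆ F)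
    (hA : ∀ t, A t ∈ somHat (F : Set (Dep n))) (s t : ℕ) :
    pathMatrix A s t ∈ somHat (F : Set (Dep n)) := by
  have h0 : idMatrix n ∈ somHat (F : Set (Dep n)) :=
    somHat_mono (Finset.coe_subset.2 hid) (idMatrix_mem_somHat n)
  induction t with
  | zero => exact h0
  | succ t ih =>
    unfold pathMatrix
    split_ifs
    · exact somHat_mono (Finset.coe_subset.2 hF) (DepMatrix.mul_mem_somHat ih (hA t))
    · exact h0

open Classical in
/-- The adjacency matrices of the linear steps into variables that grow polynomially. -/
noncomputable def loopStep (F : Finset (Dep n)) (A : ℕ → DepMatrix n) (t : ℕ) (j k : Fin (n + 1)) : ℕ :=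
  if NoThree (loopClosure F) k ∧ entryIsOne (A t j k) then 1 else 0

open Classical in
/-- A weight `1` at each column that does not merely copy a variable. -/
noncomputable def loopSource (A : ℕ → DepMatrix n) (t : ℕ) (k : Fin (n + 1)) : ℕ :=
  if ∃ j, A t j k = DepType.one then 0 else 1

/-- The weighted number of linear paths that lead to `k` within the first `t` passes. -/
noncomputable def loopWeight (F : Finset (Dep n)) (A : ℕ → DepMatrix n) : ℕ → Fin (n + 1) → ℕ :=
  pathWeight (loopStep F A) (loopSource A) Finset.univ

theorem loopWeight_succ (hk : NoThree (loopClosure F) k) :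
    loopWeight F A (t + 1) k =
      ∑ j, (if entryIsOne (A t j k) then loopWeight F A t j else 0) + loopSource A t k := by
  simp only [loopWeight, pathWeight, Finset.mem_univ, if_true, loopStep, hk, true_and, mul_ite,
    mul_one, mul_zero]

theorem pathCount_loopStep (hst : s ≤ t) :
    (1 ≤ pathCount (loopStep F A) s t i k → pathMatrix A s t i k ≠ ⊥) ∧
    (2 ≤ pathCount (loopStep F A) s t i k →
      (DepType.two : WithBot DepType) ≤ pathMatrix A s t i k) := by
  induction t, hst using Nat.le_induction generalizing k with
  | base =>
    rw [pathCount_self, pathMatrix_self]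
    by_cases h : i = k <;> simp [h, idMatrix]
  | succ t hst ih =>
    rw [pathCount_succ _ hst, pathMatrix_succ hst]
    set N := pathCount (loopStep F A) s t with hN
    have hstep : ∀ j, loopStep F A t j k ≤ 1 ∧ (loopStep F A t j k ≠ 0 → entryIsOne (A t j k)) := by
      intro j
      unfold loopStep
      split_ifs with h
      · exact ⟨le_rfl, fun _ => h.2⟩
      · simp
    have hbot : ∀ {a : WithBot DepType}, entryIsOne a = true → a ≠ ⊥ := by
      rintro a ha rfl
      cases ha
    have hone : ∀ j, N i j * loopStep F A t j k ≠ 0 → 1 ≤ N i j ∧ entryIsOne (A t j k) := by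
      intro j hj
      have := Nat.mul_ne_zero_iff.1 hj
      exact ⟨by omega, (hstep j).2 this.2⟩
    have hle : ∀ j, N i j * loopStep F A t j k ≤ N i j := fun j => by
      simpa using Nat.mul_le_mul_left (N i j) (hstep j).1
    constructor
    · intro h
      obtain ⟨j, -, hj⟩ := Finset.exists_ne_zero_of_sum_ne_zero (Nat.one_le_iff_ne_zero.1 h)
      obtain ⟨h₁, h₂⟩ := hone j hj
      intro h0
      have := DepMatrix.le_mul_left (A := pathMatrix A s t) (i := i) (hbot h₂)
      rw [h0, le_bot_iff] at this
      exact (ih (k := j)).1 h₁ this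
    · intro h
      by_cases hex : ∃ j, 2 ≤ N i j ∧ entryIsOne (A t j k)
      · obtain ⟨j, h₁, h₂⟩ := hex
        exact ((ih (k := j)).2 h₁).trans (DepMatrix.le_mul_left (hbot h₂))
      · have hterm : ∀ j, N i j * loopStep F A t j k ≤ 1 := by
          intro j
          by_contra hlt
          exact hex ⟨j, by have := hle j; omega, (hone j (by omega)).2⟩
        obtain ⟨j, -, hj⟩ := Finset.exists_ne_zero_of_sum_ne_zero
          (show ∑ j, N i j * loopStep F A t j k ≠ 0 by omega)
        rw [← Finset.add_sum_erase _ _ (Finset.mem_univ j)] at h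
        obtain ⟨j', hj', hj''⟩ := Finset.exists_ne_zero_of_sum_ne_zero
          (show ∑ j ∈ Finset.univ.erase j, N i j * loopStep F A t j k ≠ 0 by
            have := hterm j
            omega)
        obtain ⟨h₁, h₂⟩ := hone j hj
        obtain ⟨h₃, h₄⟩ := hone j' hj''
        have h₅ := (ih (k := j)).1 h₁
        have h₆ := (ih (k := j')).1 h₃
        by_cases h₇ : entryIsOne (pathMatrix A s t i j)
        · by_cases h₈ : entryIsOne (pathMatrix A s t i j')
          · exact DepMatrix.two_le_mul (Finset.ne_of_mem_erase hj').symm h₇ h₂ h₈ h₄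
          · exact (two_le_iff.2 ⟨h₆, h₈⟩).trans (DepMatrix.le_mul_left (hbot h₄))
        · exact (two_le_iff.2 ⟨h₅, h₇⟩).trans (DepMatrix.le_mul_left (hbot h₂))

theorem loopSource_le_one (A : ℕ → DepMatrix n) (t : ℕ) (k : Fin (n + 1)) :
    loopSource A t k ≤ 1 := by
  unfold loopSource
  split_ifs <;> simp

/-- A variable `k` without `k →^2 k` has at most one linear path to itself, so that the number of
linear paths grows polynomially. -/
theorem loopWeight_le_pow (hid : depId n ⊆ F) (hF : depMul F F ⊆ F)
    (hA : ∀ t, A t ∈ somHat (F : Set (Dep n))) (t : ℕ) (k : Fin (n + 1)) :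
    loopWeight F A t k ≤ ((t + 1) * (n + 2)) ^ (n + 1) := by
  have := pathWeight_le_pow (L := loopStep F A) (b := loopSource A)
    (fun t i j => by unfold loopStep; split_ifs <;> simp) (loopSource_le_one A) (fun s t hst k => by
      by_contra hlt
      by_cases hk : NoThree (loopClosure F) k
      · have h₁ := (pathCount_loopStep (F := F) (A := A) hst).2 (Nat.lt_of_not_le hlt)
        have hP := pathMatrix_mem_somHat hid hF hA s t
        have h₂ := eq_two_of_two_le h₁ ((hk.mono (subset_loopClosure F)).entry_ne hP k)
        exact hk.two_notMem (hP.2.1 _ _ _ h₂)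
      · have : pathCount (loopStep F A) s t k k ≤ 1 := by
          rcases hst.eq_or_lt with rfl | hlt'
          · simp [pathCount_self]
          · obtain ⟨t, rfl⟩ : ∃ t', t = t' + 1 := ⟨t - 1, by omega⟩
            rw [pathCount_succ _ (by omega)]
            simp [loopStep, hk]
        exact hlt this) Finset.univ (le_refl t) k
  simpa [loopWeight] using this

open Classical in
/-- The number of variables on which `k` depends with type `1⁺` or `2`. -/
noncomputable def addRank (F : Finset (Dep n)) (k : Fin (n + 1)) : ℕ :=
  (Finset.univ.filter fun i => Dep.unary i .onePlus k ∈ F ∨ Dep.unary i .two k ∈ F).card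

open Classical in
/-- The number of variables on which `k` depends with type `2`. -/
noncomputable def mulRank (F : Finset (Dep n)) (k : Fin (n + 1)) : ℕ :=
  (Finset.univ.filter fun i => Dep.unary i .two k ∈ F).card

theorem addRank_le_of_one (hF : depMul F F ⊆ F) (h : Dep.unary j .one k ∈ F) :
    addRank F j ≤ addRank F k := by
  refine Finset.card_le_card fun i hi => ?_
  simp only [Finset.mem_filter, Finset.mem_univ, true_and] at hi ⊢
  exact hi.imp (fun hi => unary_mem_of_closed hF hi h) fun hi => unary_mem_of_closed hF hi h

theorem addRank_lt_of_onePlus (hF : depMul F F ⊆ F) (h : Dep.unary j .onePlus k ∈ F)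
    (h₁ : Dep.unary j .onePlus j ∉ F) (h₂ : Dep.unary j .two j ∉ F) :
    addRank F j < addRank F k := by
  refine Finset.card_lt_card ((Finset.ssubset_iff_of_subset fun i hi => ?_).2 ⟨j, ?_, ?_⟩)
  · simp only [Finset.mem_filter, Finset.mem_univ, true_and] at hi ⊢
    exact hi.imp (fun hi => unary_mem_of_closed hF hi h) fun hi => unary_mem_of_closed hF hi h
  · simp [h]
  · simp [h₁, h₂]

theorem mulRank_le_of_le_two (hF : depMul F F ⊆ F) {δ : DepType} (hδ : δ ≤ .two)
    (h : Dep.unary j δ k ∈ F) : mulRank F j ≤ mulRank F k := by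
  refine Finset.card_le_card fun i hi => ?_
  simp only [Finset.mem_filter, Finset.mem_univ, true_and] at hi ⊢
  have := unary_mem_of_closed hF hi h
  rwa [max_eq_left hδ] at this

theorem mulRank_lt_of_two (hF : depMul F F ⊆ F) (h : Dep.unary j .two k ∈ F)
    (h₂ : Dep.unary j .two j ∉ F) : mulRank F j < mulRank F k := by
  refine Finset.card_lt_card ((Finset.ssubset_iff_of_subset fun i hi => ?_).2 ⟨j, ?_, ?_⟩)
  · simp only [Finset.mem_filter, Finset.mem_univ, true_and] at hi ⊢
    exact unary_mem_of_closed hF hi h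
  · simp [h]
  · simp [h₂]

/-- A variable that depends on no `i` with `i →^{1⁺} i` can be reached through boundedly many
additions only. -/
theorem loopWeight_le_const (hF : depMul F F ⊆ F)
    (hA : ∀ t, A t ∈ somHat (F : Set (Dep n))) (t : ℕ) (k : Fin (n + 1))
    (hk : NoThree (loopClosure F) k) (hk' : Dep.unary (Fin.last n) .two k ∉ loopClosure F) :
    loopWeight F A t k ≤ (n + 2) ^ addRank F k := by
  induction t generalizing k with
  | zero =>
    simp only [loopWeight, pathWeight, Finset.mem_univ, if_true]
    exact Nat.one_le_pow _ _ (by omega)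
  | succ t ih =>
    have hpred : ∀ {j δ}, Dep.unary j δ k ∈ F →
        Dep.unary (Fin.last n) .two j ∉ loopClosure F := by
      intro j δ hj h
      have h₁ := loopClosure_mul_mem hF h hj
      cases δ
      · exact hk' h₁
      · exact hk' h₁
      · exact hk' h₁
      · exact hk _ h₁
    rw [loopWeight_succ hk]
    by_cases hex : ∃ j, A t j k = DepType.one
    · obtain ⟨j, hj⟩ := hex
      have hjF := (hA t).2.1 _ _ _ hj
      rw [loopSource, if_pos ⟨j, hj⟩, Finset.sum_eq_single j (fun j' _ hne => by
        rw [(hA t).1.2 j k hj j' hne]; rfl) (by simp), hj]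
      calc _ = loopWeight F A t j := by simp [entryIsOne, DepType.isOne]
        _ ≤ (n + 2) ^ addRank F j := ih j (hk.pred hF hjF) (hpred hjF)
        _ ≤ _ := Nat.pow_le_pow_right (by omega) (addRank_le_of_one hF hjF)
    · have hterm : ∀ j, entryIsOne (A t j k) →
          loopWeight F A t j * (n + 2) ≤ (n + 2) ^ addRank F k := by
        intro j hj
        have hj' : A t j k = DepType.onePlus :=
          (entryIsOne_iff.1 hj).resolve_left fun h => hex ⟨j, h⟩
        have hjF := (hA t).2.1 _ _ _ hj'
        have hjk := hk.pred hF hjF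
        have hlt := addRank_lt_of_onePlus hF hjF (onePlus_self_notMem (hpred hjF))
          hjk.two_notMem
        calc loopWeight F A t j * (n + 2) ≤ (n + 2) ^ addRank F j * (n + 2) :=
              Nat.mul_le_mul_right _ (ih j hjk (hpred hjF))
          _ = (n + 2) ^ (addRank F j + 1) := (pow_succ _ _).symm
          _ ≤ _ := Nat.pow_le_pow_right (by omega) hlt
      have hsum : (∑ j, (if entryIsOne (A t j k) then loopWeight F A t j else 0)) * (n + 2) ≤
          (n + 1) * (n + 2) ^ addRank F k := by
        rw [Finset.sum_mul]
        calc _ ≤ ∑ _j : Fin (n + 1), (n + 2) ^ addRank F k := by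
              refine Finset.sum_le_sum fun j _ => ?_
              split_ifs with hj
              · exact hterm j hj
              · simp
          _ = _ := by simp
      have hsource := loopSource_le_one A t k
      by_cases hzero : ∃ j, entryIsOne (A t j k)
      · obtain ⟨j, hj⟩ := hzero
        have hpos : n + 2 ≤ (n + 2) ^ addRank F k := by
          have hj' : A t j k = DepType.onePlus :=
            (entryIsOne_iff.1 hj).resolve_left fun h => hex ⟨j, h⟩
          refine Nat.le_self_pow ?_ _
          have : 0 < addRank F k := Finset.card_pos.2
            ⟨j, by simpa using Or.inl ((hA t).2.1 _ _ _ hj')⟩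
          omega
        refine Nat.le_of_mul_le_mul_right (c := n + 2) ?_ (by omega)
        rw [add_mul]
        have := Nat.mul_le_mul_right (n + 2) hsource
        nlinarith
      · rw [Finset.sum_eq_zero fun j _ => if_neg fun h => hzero ⟨j, h⟩, zero_add]
        exact hsource.trans (Nat.one_le_pow _ _ (by omega))

end Loop

/-! ### Polynomial bounds for iterations -/

section LoopBound

variable {n : ℕ} {F : Finset (Dep n)} {A : ℕ → DepMatrix n} {t m : ℕ} {i j k : Fin (n + 1)}

theorem linPart_idMatrix (k : Fin (n + 1)) (x : Fin (n + 1) → ℕ) :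
    linPart (fun i => idMatrix n i k) x = x k := by
  rw [linPart, Finset.sum_eq_single k (fun i _ hne => by simp [idMatrix, hne, entryIsOne])
    (by simp)]
  simp [idMatrix, entryIsOne, DepType.isOne]

/-- A column with an entry `1` stands for a copy. -/
theorem colBound_of_one {B : DepMatrix n} (hB : Admissible B) (h : B j k = DepType.one) {K : ℕ}
    (hK : 1 ≤ K) (x : Fin (n + 1) → ℕ) : colBound K (fun i => B i k) x = x j := by
  have h0 := hB.2 j k h
  rw [colBound, linPart, polyArg, Finset.sum_eq_single j (fun i _ hne => by
    simp [h0 i hne, entryIsOne]) (by simp), Finset.sum_eq_zero fun i _ => ?_]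
  · simp [h, entryIsOne, DepType.isOne, show K ≠ 0 by omega]
  · by_cases hi : i = j
    · simp [hi, h]
    · simp [h0 i hi]

theorem entryMul_one_le (a : WithBot DepType) : entryMul a DepType.one ≤ a := by
  revert a
  simp only [WithBot.forall]
  decide

theorem mul_apply_of_one {B C : DepMatrix n} (hC : Admissible C) (h : C j k = DepType.one)
    (i : Fin (n + 1)) : B.mul C i k = B i j := by
  have h0 := hC.2 j k h
  refine le_antisymm ?_ (DepMatrix.le_mul_left (by simp [h]))
  refine sup_le (Finset.sup_le fun j' _ => ?_) ?_
  · by_cases hj : j' = j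
    · subst hj
      rw [h]
      exact entryMul_one_le _
    · rw [h0 j' hj]
      rcases B i j' with _ | b <;> exact bot_le
  · split_ifs with hex
    · obtain ⟨j₁, j₂, hne, -, h₁, -, h₂⟩ := hex
      exfalso
      have : ∀ j', entryIsOne (C j' k) = true → j' = j := by
        intro j' hj'
        by_contra hne
        rw [h0 j' hne] at hj'
        cases hj'
      exact hne ((this _ h₁).trans (this _ h₂).symm)
    · exact bot_le

open Classical in
/-- The argument of the non-linear part of the bound for `k` after `t` passes: the variables on
which `k` depends with type `2`, and the number of passes if `n+1 →^2 k`. -/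
noncomputable def loopArg (F : Finset (Dep n)) (A : ℕ → DepMatrix n) (x : Fin (n + 1) → ℕ) (t : ℕ)
    (k : Fin (n + 1)) : ℕ :=
  polyArg (fun i => pathMatrix A 0 t i k) x +
    if Dep.unary (Fin.last n) .two k ∈ loopClosure F then x (Fin.last n) else 0

theorem loopArg_le_succ (hid : depId n ⊆ F) (hF : depMul F F ⊆ F)
    (hA : ∀ t, A t ∈ somHat (F : Set (Dep n))) (hk : NoThree (loopClosure F) k)
    (hj : A t j k ≠ ⊥) (x : Fin (n + 1) → ℕ) : loopArg F A x t j ≤ loopArg F A x (t + 1) k := by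
  obtain ⟨δ, hδ⟩ := entry_eq_coe_of_ne_bot hj
  have hjF := (hA t).2.1 _ _ _ hδ
  have hP := pathMatrix_mem_somHat hid hF hA 0 (t + 1)
  have h3 := (hk.mono (subset_loopClosure F)).entry_ne hP
  rw [pathMatrix_succ (Nat.zero_le t)] at h3
  unfold loopArg
  rw [pathMatrix_succ (Nat.zero_le t)]
  refine Nat.add_le_add (polyArg_le_polyArg_mul h3 hj x) ?_
  by_cases h : Dep.unary (Fin.last n) .two j ∈ loopClosure F
  · have h' := loopClosure_mul_mem hF h hjF
    have : Dep.unary (Fin.last n) .two k ∈ loopClosure F := by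
      cases δ
      · exact h'
      · exact h'
      · exact h'
      · exact absurd h' (hk _)
    simp [h, this]
  · simp [h]

/-- If the non-linear part at each pass is dominated by `Q`, then all passes together contribute
at most `Q` times the weighted number of paths. -/
theorem le_linPart_add_mul_loopWeight (hid : depId n ⊆ F) (hF : depMul F F ⊆ F)
    {K K' r : ℕ} (hK : 1 ≤ K) (hA : ∀ t, A t ∈ somHat (F : Set (Dep n)))
    {y : ℕ → Fin (n + 1) → ℕ}
    (hy : ∀ t < m, ∀ k, NoThree (loopClosure F) k →
      y (t + 1) k ≤ colBound K (fun i => A t i k) (y t))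
    (ih : ∀ t ≤ m, ∀ k, NoThree (loopClosure F) k → mulRank F k < r →
      y t k ≤ linPart (fun i => pathMatrix A 0 t i k) (y 0) +
        K' * loopArg F A (y 0) t k ^ K') (t : ℕ) (ht : t ≤ m) (k : Fin (n + 1))
    (hk : NoThree (loopClosure F) k) (hr : mulRank F k ≤ r) {Q : ℕ → ℕ} (hQm : Monotone Q)
    (hQ : ∀ S, (n + 1) * S + K * ((n + 1) * (S + K' * S ^ K')) ^ K ≤ Q S) :
    y t k ≤ linPart (fun i => pathMatrix A 0 t i k) (y 0) +
      Q (loopArg F A (y 0) t k) * loopWeight F A t k := by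
  induction t generalizing k with
  | zero =>
    rw [pathMatrix_self, linPart_idMatrix]
    exact Nat.le_add_right _ _
  | succ t iht =>
    have hstep := hy t ht k hk
    have hP := pathMatrix_mem_somHat hid hF hA 0 (t + 1)
    have h3 := (hk.mono (subset_loopClosure F)).entry_ne hP
    rw [pathMatrix_succ (Nat.zero_le t)] at h3
    have hdep : ∀ {j}, entryIsOne (A t j k) = true → A t j k ≠ ⊥ ∧
        NoThree (loopClosure F) j ∧ mulRank F j ≤ mulRank F k := by
      intro j hj
      rcases entryIsOne_iff.1 hj with h | h <;>
      · have hjF := (hA t).2.1 _ _ _ h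
        exact ⟨by simp [h], hk.pred hF hjF, mulRank_le_of_le_two hF (by decide) hjF⟩
    set S := loopArg F A (y 0) (t + 1) k with hS
    by_cases hex : ∃ j, A t j k = DepType.one
    · obtain ⟨j, hj⟩ := hex
      rw [colBound_of_one (hA t).1 hj hK] at hstep
      have hj1 : entryIsOne (A t j k) = true := by rw [hj]; rfl
      obtain ⟨h₁, h₂, h₃⟩ := hdep hj1
      refine (hstep.trans (iht (by omega) j h₂ (h₃.trans hr))).trans ?_
      rw [pathMatrix_succ (Nat.zero_le t)]
      simp_rw [mul_apply_of_one (hA t).1 hj]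
      refine Nat.add_le_add_left (Nat.mul_le_mul (hQm (loopArg_le_succ hid hF hA hk h₁ _)) ?_) _
      rw [loopWeight_succ hk]
      refine le_trans ?_ (Nat.le_add_right _ _)
      have := Finset.single_le_sum
        (f := fun j => if entryIsOne (A t j k) then loopWeight F A t j else 0)
        (fun _ _ => Nat.zero_le _) (Finset.mem_univ j)
      simpa [hj1] using this
    · refine hstep.trans ((colBound_comp_le (A := pathMatrix A 0 t) (x := y 0) (S := S)
        (c := fun j => Q S * loopWeight F A t j) (d := K' * S ^ K') h3 K ?_ ?_ ?_).trans ?_)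
      · rw [hS, loopArg, pathMatrix_succ (Nat.zero_le t)]
        exact Nat.le_add_right _ _
      · intro j hj
        obtain ⟨h₁, h₂, h₃⟩ := hdep hj
        exact (iht (by omega) j h₂ (h₃.trans hr)).trans
          (Nat.add_le_add_left (Nat.mul_le_mul_right _
            (hQm (loopArg_le_succ hid hF hA hk h₁ _))) _)
      · intro j hj
        have hjF := (hA t).2.1 _ _ _ hj
        have hjk := hk.pred hF hjF
        have := mulRank_lt_of_two hF hjF hjk.two_notMem
        exact (ih t (by omega) j hjk (by omega)).trans (Nat.add_le_add_left
          (Nat.mul_le_mul_left _ (Nat.pow_le_pow_left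
            (loopArg_le_succ hid hF hA hk (by simp [hj]) _) _)) _)
      · rw [loopWeight_succ hk, loopSource, if_neg hex, pathMatrix_succ (Nat.zero_le t),
          mul_add (Q S), Finset.mul_sum, mul_one]
        have := hQ S
        simp only [mul_ite, mul_zero]
        omega

/-- The variables that are not the target of a dependency of type `3` are polynomially bounded
along all sequences of passes, uniformly in their length. -/
theorem exists_loop_bound (hid : depId n ⊆ F) (hF : depMul F F ⊆ F) {K : ℕ} (hK : 1 ≤ K) :
    ∃ K', 1 ≤ K' ∧ ∀ (A : ℕ → DepMatrix n) (y : ℕ → Fin (n + 1) → ℕ) (m : ℕ),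
      (∀ t, A t ∈ somHat (F : Set (Dep n))) → m ≤ y 0 (Fin.last n) →
      (∀ t < m, ∀ k, NoThree (loopClosure F) k →
        y (t + 1) k ≤ colBound K (fun i => A t i k) (y t)) →
      ∀ t ≤ m, ∀ k, NoThree (loopClosure F) k →
        y t k ≤ linPart (fun i => pathMatrix A 0 t i k) (y 0) +
          K' * loopArg F A (y 0) t k ^ K' := by
  -- induction on the rank with respect to the dependencies of type `2`
  suffices h : ∀ r, ∃ K', 1 ≤ K' ∧ ∀ (A : ℕ → DepMatrix n) (y : ℕ → Fin (n + 1) → ℕ) (m : ℕ),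
      (∀ t, A t ∈ somHat (F : Set (Dep n))) → m ≤ y 0 (Fin.last n) →
      (∀ t < m, ∀ k, NoThree (loopClosure F) k →
        y (t + 1) k ≤ colBound K (fun i => A t i k) (y t)) →
      ∀ t ≤ m, ∀ k, NoThree (loopClosure F) k → mulRank F k < r →
        y t k ≤ linPart (fun i => pathMatrix A 0 t i k) (y 0) +
          K' * loopArg F A (y 0) t k ^ K' by
    obtain ⟨K', hK', h⟩ := h (n + 2)
    refine ⟨K', hK', fun A y m hA hm hy t ht k hk => h A y m hA hm hy t ht k hk ?_⟩
    have : mulRank F k ≤ n + 1 := (Finset.card_le_univ _).trans (by simp)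
    omega
  intro r
  induction r with
  | zero => exact ⟨1, le_rfl, fun _ _ _ _ _ _ _ _ _ _ h => absurd h (Nat.not_lt_zero _)⟩
  | succ r ihr =>
    obtain ⟨K', hK', ih⟩ := ihr
    set Q : ℕ → ℕ := fun S => (n + 1) * S + K * ((n + 1) * (S + K' * S ^ K')) ^ K with hQ
    have hQm : Monotone Q := by
      intro a b hab
      simp only [hQ]
      gcongr
    have hQs : PolySmall Q := (PolySmall.linear _).add
      ((((PolySmall.linear 1).mono (fun s => by simp)).add (PolySmall.monomial K' hK')).const_mul
        (n + 1) |>.const_mul_pow K hK)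
    -- `Q` times the number of paths: the first summand serves if that number is bounded by a
    -- constant, the second one if the number of passes is part of `loopArg`
    obtain ⟨K'', hK'', hb⟩ := (hQs.const_mul ((n + 2) ^ (n + 1))).add
      (hQs.mul ((PolySmall.linear (2 * (n + 2))).const_mul_pow 1 (d := n + 1) (by omega)))
    refine ⟨K'', hK'', fun A y m hA hm hy t ht k hk hr => ?_⟩
    have h₁ := le_linPart_add_mul_loopWeight hid hF hK hA hy (ih A y m hA hm hy) t ht k hk
      (by omega) hQm (fun S => le_rfl)
    refine h₁.trans (Nat.add_le_add_left ?_ _)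
    set S := loopArg F A (y 0) t k with hS
    refine le_trans ?_ (hb S)
    by_cases hlast : Dep.unary (Fin.last n) .two k ∈ loopClosure F
    · rcases Nat.eq_zero_or_pos S with h0 | hpos
      · have : Q S = 0 := by
          obtain ⟨c, hc, hc'⟩ := hQs
          have := hc' S
          rw [h0, zero_pow (by omega)] at this
          rw [h0]
          omega
        simp [this]
      · have hMS : y 0 (Fin.last n) ≤ S := by
          rw [hS, loopArg, if_pos hlast]
          exact Nat.le_add_left _ _
        refine le_trans (Nat.mul_le_mul_left _ ?_) (Nat.le_add_left _ _)
        calc loopWeight F A t k ≤ ((t + 1) * (n + 2)) ^ (n + 1) := loopWeight_le_pow hid hF hA t k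
          _ ≤ (2 * (n + 2) * S) ^ (n + 1) := by
            refine Nat.pow_le_pow_left ?_ _
            calc (t + 1) * (n + 2) ≤ (2 * S) * (n + 2) := Nat.mul_le_mul_right _ (by omega)
              _ = _ := by ring
          _ = _ := (one_mul _).symm
    · refine le_trans ?_ (Nat.le_add_right _ _)
      rw [mul_comm (Q S)]
      refine Nat.mul_le_mul_right _ ((loopWeight_le_const hF hA t k hk hlast).trans
        (Nat.pow_le_pow_right (by omega) ?_))
      exact (Finset.card_le_univ _).trans (by simp)

open Classical in
/-- The matrix of an iteration: the product matrix of the passes, where the row of the number of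
passes is raised according to the loop-corrected dependencies, except in the columns of copies. -/
noncomputable def loopMatrix (F : Finset (Dep n)) (P : DepMatrix n) : DepMatrix n := fun i k =>
  if i = Fin.last n ∧ (¬ ∃ j, P j k = DepType.one) ∧
    Dep.unary (Fin.last n) .two k ∈ loopClosure F then P i k ⊔ (DepType.two : WithBot DepType)
  else P i k

theorem loopMatrix_of_one {P : DepMatrix n} (h : P j k = DepType.one) (i : Fin (n + 1)) :
    loopMatrix F P i k = P i k := if_neg fun h' => h'.2.1 ⟨j, h⟩

theorem loopMatrix_cases (F : Finset (Dep n)) (P : DepMatrix n) (i k : Fin (n + 1)) :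
    loopMatrix F P i k = P i k ∨ (loopMatrix F P i k = DepType.two ∧ i = Fin.last n ∧
      Dep.unary (Fin.last n) .two k ∈ loopClosure F) := by
  unfold loopMatrix
  split_ifs with h
  · rcases max_choice (P i k) (DepType.two : WithBot DepType) with h' | h'
    · exact Or.inl h'
    · exact Or.inr ⟨h', h.1, h.2.2⟩
  · exact Or.inl rfl

theorem loopMatrix_mem_somHat {P : DepMatrix n} (hP : P ∈ somHat (F : Set (Dep n))) :
    loopMatrix F P ∈ somHat (loopClosure F : Set (Dep n)) := by
  have hone : ∀ {i k}, entryIsOne (loopMatrix F P i k) = true → entryIsOne (P i k) = true := by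
    intro i k h
    rcases loopMatrix_cases F P i k with h' | ⟨h', -⟩
    · rwa [h'] at h
    · rw [h'] at h
      cases h
  refine ⟨⟨?_, ?_⟩, ?_, ?_⟩
  · rw [loopMatrix_of_one hP.1.1, hP.1.1]
  · intro i k h i' hi'
    rcases loopMatrix_cases F P i k with h' | ⟨h', -⟩
    · rw [h'] at h
      rw [loopMatrix_of_one h]
      exact hP.1.2 i k h i' hi'
    · rw [h'] at h
      cases h
  · intro i k δ h
    rcases loopMatrix_cases F P i k with h' | ⟨h', rfl, h''⟩
    · exact subset_loopClosure F (hP.2.1 _ _ _ (h'.symm.trans h))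
    · rw [h'] at h
      cases h
      exact h''
  · intro i j k l h₁ h₂ h₃
    exact subset_loopClosure F (hP.2.2 i j k l (hone h₁) (hone h₂) h₃)

theorem exists_loopMatrix_bound (hid : depId n ⊆ F) (hF : depMul F F ⊆ F) {K : ℕ} (hK : 1 ≤ K) :
    ∃ K', 1 ≤ K' ∧ ∀ (A : ℕ → DepMatrix n) (y : ℕ → Fin (n + 1) → ℕ) (m : ℕ),
      (∀ t, A t ∈ somHat (F : Set (Dep n))) → m ≤ y 0 (Fin.last n) →
      (∀ t < m, ∀ k, NoThree (loopClosure F) k →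
        y (t + 1) k ≤ colBound K (fun i => A t i k) (y t)) →
      ∀ k, NoThree (loopClosure F) k →
        y m k ≤ colBound K' (fun i => loopMatrix F (pathMatrix A 0 m) i k) (y 0) := by
  obtain ⟨K', hK', h⟩ := exists_loop_bound hid hF hK
  obtain ⟨K'', hK'', hb⟩ := (PolySmall.linear 1).add
    ((PolySmall.linear 2).const_mul_pow K' hK')
  refine ⟨K'', hK'', fun A y m hA hm hy k hk => ?_⟩
  set P := pathMatrix A 0 m with hP
  have hPF := pathMatrix_mem_somHat hid hF hA 0 m
  by_cases hex : ∃ i, P i k = DepType.one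
  · obtain ⟨i, hi⟩ := hex
    rw [colBound_of_one (loopMatrix_mem_somHat hPF).1 (by rw [loopMatrix_of_one hi, hi]) hK'']
    have key : ∀ t ≤ m, ∀ k, NoThree (loopClosure F) k → pathMatrix A 0 t i k = DepType.one →
        y t k ≤ y 0 i := by
      intro t
      induction t with
      | zero =>
        intro _ k _ h
        rw [pathMatrix_self, idMatrix] at h
        split_ifs at h with hik
        · rw [hik]
        · cases h
      | succ t iht =>
        intro ht k hk h
        rw [pathMatrix_succ (Nat.zero_le t)] at h
        obtain ⟨j, h₁, h₂⟩ := DepMatrix.exists_of_mul_eq_one h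
        have := hy t ht k hk
        rw [colBound_of_one (hA t).1 h₂ hK] at this
        exact this.trans (iht (by omega) j (hk.pred hF ((hA t).2.1 _ _ _ h₂)) h₁)
    exact key m le_rfl k hk hi
  · have h₁ := h A y m hA hm hy m le_rfl k hk
    set v : Fin (n + 1) → WithBot DepType := fun i => loopMatrix F P i k with hv
    have h3 : ∀ i, P i k ≠ DepType.three := (hk.mono (subset_loopClosure F)).entry_ne hPF
    have h₂ : linPart (fun i => P i k) (y 0) ≤ linPart v (y 0) + polyArg v (y 0) := by
      refine linPart_le_add fun i hi => ?_
      rcases loopMatrix_cases F P i k with h' | ⟨h', -⟩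
      · exact Or.inl (by rw [hv]; simpa only [h'] using hi)
      · exact Or.inr h'
    have h₃ : polyArg (fun i => P i k) (y 0) ≤ polyArg v (y 0) := by
      refine polyArg_mono fun i hi => ?_
      rcases loopMatrix_cases F P i k with h' | ⟨h', -⟩
      · exact h'.trans hi
      · exact h'
    have h₄ : loopArg F A (y 0) m k ≤ 2 * polyArg v (y 0) := by
      unfold loopArg
      split_ifs with hlast
      · have : v (Fin.last n) = DepType.two := by
          rcases loopMatrix_cases F P (Fin.last n) k with h' | ⟨h', -⟩
          · have h2 : (DepType.two : WithBot DepType) ≤ loopMatrix F P (Fin.last n) k := by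
              unfold loopMatrix
              rw [if_pos ⟨rfl, hex, hlast⟩]
              exact le_sup_right
            exact eq_two_of_two_le h2 (fun h3' => h3 _ (h'.symm.trans h3'))
          · exact h'
        have := le_polyArg (x := y 0) this
        rw [← hP]
        omega
      · rw [← hP]
        omega
    have h₅ := Nat.mul_le_mul_left K' (Nat.pow_le_pow_left h₄ K')
    have h₆ := hb (polyArg v (y 0))
    simp only [one_mul] at h₆
    rw [← hP] at h₁
    unfold colBound
    omega

end LoopBound

/-! ### Structural properties of derived dependencies -/

/-- The dependencies that occur in the analysis treat the iteration count specially: it depends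
only on itself, other variables depend on it with type `2` or `3` only, and a binary dependency
joins two different pairs. -/
def Dep.Proper {n : ℕ} : Dep n → Prop
  | .unary i δ j => (j = Fin.last n → i = Fin.last n ∧ δ = .one) ∧
      (i = Fin.last n → j ≠ Fin.last n → δ = .two ∨ δ = .three)
  | .binary i i' k k' => (i = Fin.last n ↔ k = Fin.last n) ∧ (i' = Fin.last n ↔ k' = Fin.last n) ∧
      (i ≠ i' ∨ k ≠ k')

section Proper

variable {n : ℕ}

/-- The defined products of dependencies, as a relation. -/
inductive Dep.IsProd : Dep n → Dep n → Dep n → Prop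
  | trans (i j k : Fin (n + 1)) (α β : DepType) :
      IsProd (.unary i α j) (.unary j β k) (.unary i (max α β) k)
  | fork (i j k k' : Fin (n + 1)) (α : DepType) (hα : α.isOne) :
      IsProd (.unary i α j) (.binary j j k k') (.binary i i k k')
  | join (i i' j k : Fin (n + 1)) (α : DepType) (hα : α.isOne) :
      IsProd (.binary i i' j j) (.unary j α k) (.binary i i' k k)
  | diamond (i j j' k : Fin (n + 1)) :
      IsProd (.binary i i j j') (.binary j j' k k) (.unary i .two k)
  | pair (i i' j j' k k' : Fin (n + 1)) (h : ¬ (i = i' ∧ k = k')) :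
      IsProd (.binary i i' j j') (.binary j j' k k') (.binary i i' k k')

theorem Dep.isProd_of_mem {D D' D'' : Dep n} (hD : D'' ∈ D.prod D') : Dep.IsProd D D' D'' := by
  rcases D with ⟨i, α, j⟩ | ⟨i, i', j, j'⟩ <;> rcases D' with ⟨j₁, β, k⟩ | ⟨j₁, j₁', k, k'⟩ <;>
    simp only [Dep.prod] at hD
  · split_ifs at hD with h0
    · subst h0
      rw [Finset.mem_singleton.1 hD]
      exact .trans ..
    · simp at hD
  · split_ifs at hD with h0
    · obtain ⟨rfl, rfl, hα⟩ := h0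
      rw [Finset.mem_singleton.1 hD]
      exact .fork _ _ _ _ _ hα
    · simp at hD
  · split_ifs at hD with h0
    · obtain ⟨rfl, rfl, hα⟩ := h0
      rw [Finset.mem_singleton.1 hD]
      exact .join _ _ _ _ _ hα
    · simp at hD
  · split_ifs at hD with h0 h1
    · obtain ⟨rfl, rfl⟩ := h0
      obtain ⟨rfl, rfl⟩ := h1
      rw [Finset.mem_singleton.1 hD]
      exact .diamond ..
    · obtain ⟨rfl, rfl⟩ := h0
      rw [Finset.mem_singleton.1 hD]
      exact .pair _ _ _ _ _ _ h1
    · simp at hD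

/-- A dependency of type `1` or `1⁺` relates the iteration count only to itself. -/
theorem Dep.Proper.last_iff {i j : Fin (n + 1)} {α : DepType} (h : (Dep.unary i α j).Proper)
    (hα : α.isOne) : i = Fin.last n ↔ j = Fin.last n := by
  refine ⟨fun hi => ?_, fun hj => (h.1 hj).1⟩
  by_contra hj
  rcases h.2 hi hj with rfl | rfl <;> cases hα

theorem Dep.Proper.prod {D D' D'' : Dep n} (h : D.Proper) (h' : D'.Proper)
    (hD : Dep.IsProd D D' D'') : D''.Proper := by
  cases hD with
  | trans i j k α β =>
    refine ⟨fun hk => ?_, fun hi hk => ?_⟩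
    · obtain ⟨hj, rfl⟩ := h'.1 hk
      obtain ⟨hi, rfl⟩ := h.1 hj
      exact ⟨hi, max_self _⟩
    · by_cases hj : j = Fin.last n
      · obtain ⟨-, rfl⟩ := h.1 hj
        rcases h'.2 hj hk with rfl | rfl <;> decide
      · rcases h.2 hi hj with rfl | rfl <;> cases β <;> decide
  | fork i j k k' α hα =>
    have hij := h.last_iff hα
    obtain ⟨h₁, h₂, h₃⟩ := h'
    exact ⟨hij.trans h₁, hij.trans h₂, Or.inr (h₃.resolve_left fun h => h rfl)⟩
  | join i i' j k α hα =>
    have hjk := h'.last_iff hα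
    obtain ⟨h₁, h₂, h₃⟩ := h
    exact ⟨h₁.trans hjk, h₂.trans hjk, Or.inl (h₃.resolve_right fun h => h rfl)⟩
  | diamond i j j' k =>
    refine ⟨fun hk => ?_, fun _ _ => Or.inl rfl⟩
    have h₁ := h'.1.2 hk
    have h₂ := h'.2.1.2 hk
    rcases h.2.2 with h₃ | h₃
    · exact absurd rfl h₃
    · exact absurd (h₁.trans h₂.symm) h₃
  | pair i i' j j' k k' hne =>
    refine ⟨h.1.trans h'.1, h.2.1.trans h'.2.1, ?_⟩
    by_contra hcon
    push Not at hcon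
    exact hne hcon

theorem unary_mem_depsOfMatrix {A : DepMatrix n} {i j : Fin (n + 1)} {δ : DepType} :
    Dep.unary i δ j ∈ depsOfMatrix A ↔ A i j = δ := by
  simp [depsOfMatrix, Dep.inMatrix]

theorem binary_mem_depsOfMatrix {A : DepMatrix n} {i j k l : Fin (n + 1)} :
    Dep.binary i j k l ∈ depsOfMatrix A ↔
      entryIsOne (A i k) ∧ entryIsOne (A j l) ∧ (i ≠ j ∨ k ≠ l) := by
  simp [depsOfMatrix, Dep.inMatrix, and_assoc]

theorem depMul_proper {S T : Finset (Dep n)} (hS : ∀ D ∈ S, D.Proper) (hT : ∀ D ∈ T, D.Proper) :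
    ∀ D ∈ depMul S T, D.Proper := by
  intro D hD
  obtain ⟨D₁, h₁, D₂, h₂, h⟩ := mem_depMul.1 hD
  exact (hS _ h₁).prod (hT _ h₂) (Dep.isProd_of_mem h)

/-- A matrix in which the iteration count only influences itself. -/
theorem depsOfMatrix_proper {A : DepMatrix n}
    (h₁ : ∀ i, A i (Fin.last n) = if i = Fin.last n then (DepType.one : WithBot DepType) else ⊥)
    (h₂ : ∀ j, j ≠ Fin.last n → A (Fin.last n) j = ⊥) : ∀ D ∈ depsOfMatrix A, D.Proper := by
  have key : ∀ {i j : Fin (n + 1)}, A i j ≠ ⊥ → (i = Fin.last n ↔ j = Fin.last n) := by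
    intro i j h
    refine ⟨fun hi => ?_, fun hj => ?_⟩
    · by_contra hj
      subst hi
      exact h (h₂ j hj)
    · by_contra hi
      subst hj
      exact h (by rw [h₁, if_neg hi])
  have hbot : ∀ {a : WithBot DepType}, entryIsOne a = true → a ≠ ⊥ := by
    rintro a ha rfl
    cases ha
  rintro (⟨i, δ, j⟩ | ⟨i, i', j, j'⟩) hD
  · rw [unary_mem_depsOfMatrix] at hD
    have hk := key (i := i) (j := j) (by simp [hD])
    refine ⟨fun hj => ⟨hk.2 hj, ?_⟩, fun hi hj => absurd (hk.1 hi) hj⟩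
    rw [hj, hk.2 hj, h₁, if_pos rfl] at hD
    exact (WithBot.coe_injective hD).symm
  · obtain ⟨h₃, h₄, h₅⟩ := binary_mem_depsOfMatrix.1 hD
    exact ⟨key (hbot h₃), key (hbot h₄), h₅⟩

theorem Instr.matrix_last_right (a : Instr n) (i : Fin (n + 1)) :
    a.matrix i (Fin.last n) = if i = Fin.last n then (DepType.one : WithBot DepType) else ⊥ := by
  cases a <;> simp [Instr.matrix, idMatrix, (Fin.castSucc_lt_last _).ne']

theorem Instr.matrix_last_left (a : Instr n) {j : Fin (n + 1)} (hj : j ≠ Fin.last n) :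
    a.matrix (Fin.last n) j = ⊥ := by
  cases a <;> simp [Instr.matrix, idMatrix, (Fin.castSucc_lt_last _).ne', hj.symm]

theorem depId_proper : ∀ D ∈ depId n, D.Proper :=
  depsOfMatrix_proper (Instr.matrix_last_right .skip) fun _ hj => Instr.matrix_last_left .skip hj

theorem depLfp_induction {S : Finset (Dep n)} {p : Dep n → Prop} (hid : ∀ D ∈ depId n, p D)
    (hS : ∀ D ∈ S, p D)
    (hmul : ∀ D D' D'', D ∈ depLfp S → D' ∈ depLfp S → p D → p D' → Dep.IsProd D D' D'' → p D'') :
    ∀ D ∈ depLfp S, p D := by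
  classical
  have hle := (depLfp_isLeast S).1
  have : (depLfp S).filter p ∈ {T : Finset (Dep n) | depId n ∪ S ⊆ T ∧ depMul T T ⊆ T} := by
    refine ⟨fun D hD => Finset.mem_filter.2 ⟨hle.1 hD, ?_⟩, fun D hD => ?_⟩
    · rcases Finset.mem_union.1 hD with h | h
      · exact hid D h
      · exact hS D h
    · obtain ⟨D₁, h₁, D₂, h₂, h⟩ := mem_depMul.1 hD
      rw [Finset.mem_filter] at h₁ h₂
      exact Finset.mem_filter.2 ⟨hle.2 (mem_depMul.2 ⟨_, h₁.1, _, h₂.1, h⟩),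
        hmul _ _ _ h₁.1 h₂.1 h₁.2 h₂.2 (Dep.isProd_of_mem h)⟩
  exact fun D hD => (Finset.mem_filter.1 ((depLfp_isLeast S).2 this hD)).2

theorem depId_subset_depLfp (S : Finset (Dep n)) : depId n ⊆ depLfp S :=
  Finset.subset_union_left.trans (depLfp_isLeast S).1.1

theorem subset_depLfp (S : Finset (Dep n)) : S ⊆ depLfp S :=
  Finset.subset_union_right.trans (depLfp_isLeast S).1.1

theorem depMul_depLfp_subset (S : Finset (Dep n)) : depMul (depLfp S) (depLfp S) ⊆ depLfp S :=
  (depLfp_isLeast S).1.2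

theorem loopCorrect_proper {F : Finset (Dep n)} (hF : ∀ D ∈ F, D.Proper) :
    ∀ D ∈ F.biUnion Dep.loopCorrect, D.Proper := by
  intro D hD
  obtain ⟨i, ⟨h, rfl⟩ | ⟨h, rfl⟩⟩ := exists_of_mem_loopCorrect hD <;>
  · have := (hF _ h).1
    exact ⟨fun hi => absurd (this hi).2 (by decide), fun _ _ => by simp⟩

theorem Lare.deps_proper (E : Lare n) : ∀ D ∈ E.deps, D.Proper := by
  induction E with
  | instr a => exact depsOfMatrix_proper a.matrix_last_right fun _ hj => a.matrix_last_left hj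
  | mark => exact depId_proper
  | seq E₁ E₂ ih₁ ih₂ => exact depMul_proper ih₁ ih₂
  | alt E₁ E₂ ih₁ ih₂ => exact fun D hD => (Finset.mem_union.1 hD).elim (ih₁ D) (ih₂ D)
  | star E ih =>
    have hF : ∀ D ∈ depLfp E.deps, D.Proper :=
      depLfp_induction depId_proper ih fun _ _ _ _ _ h h' => h.prod h'
    exact fun D hD => (Finset.mem_union.1 hD).elim (hF D)
      (depMul_proper (loopCorrect_proper hF) hF D)
  | bracket l E ih =>
    intro D hD
    obtain ⟨D', hD', rfl⟩ := Finset.mem_image.1 hD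
    have := ih D' hD'
    rcases D' with ⟨i, δ, j⟩ | _
    · simp only [Dep.substSource]
      split_ifs with h
      · exact ⟨fun hj => absurd hj h.2, fun hl => absurd hl (Fin.castSucc_lt_last l).ne⟩
      · exact this
    · exact this

/-- Every variable is the target of some dependency. -/
theorem Lare.exists_unary_mem_deps (E : Lare n) (k : Fin (n + 1)) :
    ∃ i δ, Dep.unary i δ k ∈ E.deps := by
  induction E generalizing k with
  | instr a =>
    have h : ∃ i δ, a.matrix i k = ((δ : DepType) : WithBot DepType) := by
      have hid : ∃ i δ, idMatrix n i k = ((δ : DepType) : WithBot DepType) :=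
        ⟨k, .one, by simp [idMatrix]⟩
      cases a with
      | skip => exact hid
      | copy i j =>
        by_cases hk : k = i.castSucc
        · exact ⟨j.castSucc, .one, by simp [Instr.matrix, hk]⟩
        · simpa [Instr.matrix, hk] using hid
      | add i j j' =>
        by_cases hk : k = i.castSucc
        · by_cases hj : j = j'
          · exact ⟨j.castSucc, .two, by simp [Instr.matrix, hk, hj]⟩
          · exact ⟨j.castSucc, .onePlus, by simp [Instr.matrix, hk, hj]⟩
        · simpa [Instr.matrix, hk] using hid
      | mul i j j' =>
        by_cases hk : k = i.castSucc
        · exact ⟨j.castSucc, .two, by simp [Instr.matrix, hk]⟩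
        · simpa [Instr.matrix, hk] using hid
    obtain ⟨i, δ, h⟩ := h
    exact ⟨i, δ, by simp [Lare.deps, depsOfMatrix, Dep.inMatrix, h]⟩
  | mark => exact ⟨k, .one, unary_self_mem_depId k⟩
  | seq E₁ E₂ ih₁ ih₂ =>
    obtain ⟨j, β, h₂⟩ := ih₂ k
    obtain ⟨i, α, h₁⟩ := ih₁ j
    exact ⟨i, _, unary_mem_depMul h₁ h₂⟩
  | alt E₁ E₂ ih₁ ih₂ =>
    obtain ⟨i, δ, h⟩ := ih₁ k
    exact ⟨i, δ, Finset.mem_union_left _ h⟩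
  | star E ih =>
    exact ⟨k, .one, Finset.mem_union_left _ (depId_subset_depLfp _ (unary_self_mem_depId k))⟩
  | bracket l E ih =>
    obtain ⟨i, δ, h⟩ := ih k
    by_cases hi : i = Fin.last n ∧ k ≠ Fin.last n
    · exact ⟨l.castSucc, δ, Finset.mem_image.2 ⟨_, h, by simp only [Dep.substSource, if_pos hi]⟩⟩
    · exact ⟨i, δ, Finset.mem_image.2 ⟨_, h, by simp only [Dep.substSource, if_neg hi]⟩⟩

end Proper

/-! ### Traces -/

namespace Trace

variable {n : ℕ}

theorem lastState_append (x : LState n) (L L' : List (Option (LState n))) :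
    lastState x (L ++ L') = lastState (lastState x L) L' := by
  induction L generalizing x with
  | nil => rfl
  | cons a L ih => cases a <;> exact ih _

theorem lastState_filter (x : LState n) (L : List (Option (LState n))) :
    lastState x (L.filter Option.isSome) = lastState x L := by
  induction L generalizing x with
  | nil => rfl
  | cons a L ih => cases a <;> simpa [lastState] using ih _

theorem final_erase (σ : Trace n) : σ.erase.final = σ.final := lastState_filter _ _

theorem count_erase (σ : Trace n) : σ.erase.count = 0 := by
  simp [count, erase, List.filter_filter]

theorem final_append {σ₁ σ₂ : Trace n} (h : σ₁.final = σ₂.head) :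
    (⟨σ₁.head, σ₁.items ++ σ₂.items⟩ : Trace n).final = σ₂.final := by
  rw [final, lastState_append]
  exact congrArg (fun x => lastState x σ₂.items) h

theorem count_append (σ₁ σ₂ : Trace n) :
    (⟨σ₁.head, σ₁.items ++ σ₂.items⟩ : Trace n).count = σ₁.count + σ₂.count := by
  simp [count]

end Trace

section

variable {n : ℕ}

@[simp] theorem extend_castSucc (x : LState n) (m : ℕ) (k : Fin n) :
    extend x m k.castSucc = x k := by
  simp [extend]

@[simp] theorem extend_last (x : LState n) (m : ℕ) : extend x m (Fin.last n) = m := by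
  simp [extend]

theorem Lare.Guarded.one_le_count {E : Lare n} (hE : E.Guarded) {σ : Trace n}
    (hσ : σ ∈ E.traces) : 1 ≤ σ.count := by
  induction E generalizing σ with
  | instr a => exact hE.elim
  | mark =>
    have h : σ.items = [none] := hσ
    simp [Trace.count, h]
  | seq E₁ E₂ ih₁ ih₂ =>
    obtain ⟨σ₁, h₁, σ₂, h₂, -, rfl⟩ := hσ
    rw [Trace.count_append]
    rcases hE with h | h
    · have := ih₁ h h₁
      omega
    · have := ih₂ h h₂
      omega
  | alt E₁ E₂ ih₁ ih₂ => exact hσ.elim (ih₁ hE.1) (ih₂ hE.2)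
  | star E ih => exact hE.elim
  | bracket l E ih => exact hE.elim

end

/-! ### Upper bounds for programs -/

section Upper

variable {n : ℕ}

/-- Each trace in `R` is described, for the variables that are not the target of a dependency of
type `3` in `S`, by some matrix that is compatible with `S`; the polynomials are in normal form
with parameter `K`. -/
def Covered (R : Set (Trace n)) (S : Finset (Dep n)) (K : ℕ) : Prop :=
  ∀ σ ∈ R, ∃ A ∈ somHat (S : Set (Dep n)), ∀ M, σ.count ≤ M → ∀ j, NoThree S j →
    extend σ.final M j ≤ colBound K (fun i => A i j) (extend σ.head M)

theorem Covered.mono {R : Set (Trace n)} {S : Finset (Dep n)} {K K' : ℕ} (h : Covered R S K)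
    (hK : K ≤ K') : Covered R S K' := by
  intro σ hσ
  obtain ⟨A, hA, hb⟩ := h σ hσ
  exact ⟨A, hA, fun M hM j hj => (hb M hM j hj).trans (colBound_mono hK _ _)⟩

theorem Covered.mono_deps {R : Set (Trace n)} {S T : Finset (Dep n)} {K : ℕ} (h : Covered R S K)
    (hST : S ⊆ T) : Covered R T K := by
  intro σ hσ
  obtain ⟨A, hA, hb⟩ := h σ hσ
  exact ⟨A, somHat_mono (Finset.coe_subset.2 hST) hA,
    fun M hM j hj => hb M hM j (hj.mono hST)⟩

theorem colBound_idMatrix {K : ℕ} (hK : 1 ≤ K) (k : Fin (n + 1)) (x : Fin (n + 1) → ℕ) :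
    colBound K (fun i => idMatrix n i k) x = x k :=
  colBound_of_one (admissible_idMatrix n) (by simp [idMatrix]) hK x

theorem Instr.admissible_matrix (a : Instr n) : Admissible a.matrix := by
  refine ⟨by simp [a.matrix_last_right], ?_⟩
  have hid := (admissible_idMatrix n).2
  intro r c h r' hr
  cases a with
  | skip => exact hid r c h r' hr
  | copy i j =>
    simp only [Instr.matrix] at h ⊢
    by_cases hc : c = i.castSucc
    · simp only [hc, if_true] at h ⊢
      split_ifs at h with h'
      · rw [if_neg (h' ▸ hr)]
      · cases h
    · simp only [hc, if_false] at h ⊢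
      exact hid r c h r' hr
  | add i j k =>
    simp only [Instr.matrix] at h ⊢
    by_cases hc : c = i.castSucc
    · simp only [hc, if_true] at h ⊢
      split_ifs at h <;> cases h
    · simp only [hc, if_false] at h ⊢
      exact hid r c h r' hr
  | mul i j k =>
    simp only [Instr.matrix] at h ⊢
    by_cases hc : c = i.castSucc
    · simp only [hc, if_true] at h ⊢
      split_ifs at h <;> cases h
    · simp only [hc, if_false] at h ⊢
      exact hid r c h r' hr

theorem add_le_linPart {ι : Type*} [Fintype ι] [DecidableEq ι] {v : ι → WithBot DepType}
    {x : ι → ℕ} {i j : ι} (hij : i ≠ j) (hi : entryIsOne (v i)) (hj : entryIsOne (v j)) :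
    x i + x j ≤ linPart v x := by
  have := Finset.sum_le_sum_of_subset (f := fun i => if entryIsOne (v i) then x i else 0)
    (Finset.subset_univ {i, j})
  rw [Finset.sum_pair hij] at this
  simpa [linPart, hi, hj] using this

theorem Instr.exec_le_colBound (a : Instr n) (x : LState n) (M : ℕ) (j : Fin (n + 1)) :
    extend (a.exec x) M j ≤ colBound 2 (fun i => a.matrix i j) (extend x M) := by
  have hid : ∀ j, extend x M j ≤ colBound 2 (fun i => idMatrix n i j) (extend x M) :=
    fun j => (colBound_idMatrix (by omega) j _).ge
  induction j using Fin.lastCases with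
  | last =>
    rw [colBound_of_one a.admissible_matrix a.admissible_matrix.1 (by omega)]
    simp
  | cast c =>
    rw [extend_castSucc]
    have hc := hid c.castSucc
    rw [extend_castSucc] at hc
    cases a with
    | skip => exact hc
    | copy i j =>
      by_cases h : c = i
      · subst h
        rw [colBound_of_one (Instr.admissible_matrix _) (j := j.castSucc)
          (by simp [Instr.matrix]) (by omega)]
        simp [Instr.exec]
      · simpa [Instr.exec, Instr.matrix, h] using hc
    | add i j k =>
      by_cases h : c = i
      · subst h
        by_cases hjk : j = k
        · subst hjk
          have h₁ := le_polyArg (v := fun r => (Instr.add c j j).matrix r c.castSucc)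
            (x := extend x M) (i := j.castSucc) (by simp [Instr.matrix])
          rw [extend_castSucc] at h₁
          have h₂ := h₁.trans (Nat.le_self_pow (n := 2) (by omega) _)
          have h₃ : (Instr.add c j j).exec x c = x j + x j := by simp [Instr.exec]
          rw [h₃, colBound]
          omega
        · have h₁ := add_le_linPart (v := fun r => (Instr.add c j k).matrix r c.castSucc)
            (x := extend x M) (i := j.castSucc) (j := k.castSucc)
            (fun h => hjk (Fin.castSucc_injective n h)) (by simp [Instr.matrix, hjk, entryIsOne,
              DepType.isOne]) (by simp [Instr.matrix, hjk, entryIsOne, DepType.isOne])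
          simp only [extend_castSucc] at h₁
          have h₃ : (Instr.add c j k).exec x c = x j + x k := by simp [Instr.exec]
          rw [h₃, colBound]
          omega
      · simpa [Instr.exec, Instr.matrix, h] using hc
    | mul i j k =>
      by_cases h : c = i
      · subst h
        have h₁ := le_polyArg (v := fun r => (Instr.mul c j k).matrix r c.castSucc)
          (x := extend x M) (i := j.castSucc) (by simp [Instr.matrix])
        have h₂ := le_polyArg (v := fun r => (Instr.mul c j k).matrix r c.castSucc)
          (x := extend x M) (i := k.castSucc) (by simp [Instr.matrix])
        rw [extend_castSucc] at h₁ h₂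
        have h₃ : (Instr.mul c j k).exec x c = x j * x k := by simp [Instr.exec]
        rw [h₃, colBound]
        have := Nat.mul_le_mul h₁ h₂
        nlinarith
      · simpa [Instr.exec, Instr.matrix, h] using hc

theorem covered_instr (a : Instr n) :
    Covered (Lare.instr a).traces (Lare.instr a).deps 2 := by
  intro σ hσ
  refine ⟨a.matrix, mem_somHat_depsOfMatrix a.admissible_matrix, fun M _ j _ => ?_⟩
  have h : σ.items = [some (a.exec σ.head)] := hσ
  have hf : σ.final = a.exec σ.head := by simp [Trace.final, h, Trace.lastState]
  rw [hf]
  exact a.exec_le_colBound σ.head M j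

theorem covered_mark : Covered (Lare.mark : Lare n).traces (Lare.mark : Lare n).deps 1 := by
  intro σ hσ
  refine ⟨idMatrix n, idMatrix_mem_somHat n, fun M _ j _ => ?_⟩
  have h : σ.items = [none] := hσ
  have hf : σ.final = σ.head := by simp [Trace.final, h, Trace.lastState]
  rw [hf, colBound_idMatrix le_rfl]

theorem Covered.concat {R₁ R₂ : Set (Trace n)} {S₁ S₂ : Finset (Dep n)} {K : ℕ} (hK : 1 ≤ K)
    (h₁ : Covered R₁ S₁ K) (h₂ : Covered R₂ S₂ K) (hS : ∀ k, ∃ i δ, Dep.unary i δ k ∈ S₁) :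
    ∃ K', 1 ≤ K' ∧ Covered (Trace.concat R₁ R₂) (depMul S₁ S₂) K' := by
  obtain ⟨K', hK', hb⟩ := ((PolySmall.monomial K hK).const_mul (n + 1)).add
    ((PolySmall.linear (n + 1)).add ((((PolySmall.linear 1).add
      (PolySmall.monomial K hK)).const_mul (n + 1)).const_mul_pow K hK))
  refine ⟨K', hK', ?_⟩
  rintro _ ⟨σ₁, hσ₁, σ₂, hσ₂, hσ, rfl⟩
  obtain ⟨A, hA, hbA⟩ := h₁ σ₁ hσ₁
  obtain ⟨B, hB, hbB⟩ := h₂ σ₂ hσ₂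
  have hAB := DepMatrix.mul_mem_somHat hA hB
  refine ⟨A.mul B, hAB, fun M hM k hk => ?_⟩
  rw [Trace.count_append] at hM
  rw [Trace.final_append hσ]
  have h3 : ∀ i, A.mul B i k ≠ DepType.three := hk.entry_ne hAB
  have hkB : NoThree S₂ k := by
    intro j hj
    obtain ⟨i, δ, hi⟩ := hS j
    have := unary_mem_depMul hi hj
    rw [show max δ DepType.three = .three by cases δ <;> decide] at this
    exact hk i this
  have hjA : ∀ j, B j k ≠ ⊥ → NoThree S₁ j := by
    intro j hj i hi
    obtain ⟨δ, hδ⟩ := entry_eq_coe_of_ne_bot hj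
    have := unary_mem_depMul hi (hB.2.1 _ _ _ hδ)
    rw [show max DepType.three δ = .three by cases δ <;> decide] at this
    exact hk i this
  have hB2 := hbB M (by omega) k hkB
  rw [← hσ] at hB2
  set x := extend σ₁.head M
  set S := polyArg (fun i => A.mul B i k) x with hSdef
  have hz : ∀ j, B j k ≠ ⊥ →
      extend σ₁.final M j ≤ linPart (fun i => A i j) x + K * S ^ K := by
    intro j hj
    refine (hbA M (by omega) j (hjA j hj)).trans (Nat.add_le_add_left ?_ _)
    exact Nat.mul_le_mul_left _ (Nat.pow_le_pow_left (polyArg_le_polyArg_mul h3 hj x) _)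
  have hbot : ∀ {a : WithBot DepType}, entryIsOne a = true → a ≠ ⊥ := by
    rintro a ha rfl
    cases ha
  have hcomp := colBound_comp_le (A := A) (B := B) h3 (x := x) (z := extend σ₁.final M)
    (c := fun _ => K * S ^ K) (d := K * S ^ K) (S := S) K le_rfl (fun j hj => hz j (hbot hj))
    (fun j hj => hz j (by simp [hj]))
  refine (hB2.trans hcomp).trans ?_
  have hsum : ∑ j, (if entryIsOne (B j k) then K * S ^ K else 0) ≤ (n + 1) * (K * S ^ K) := by
    calc _ ≤ ∑ _j : Fin (n + 1), K * S ^ K :=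
          Finset.sum_le_sum fun j _ => by split_ifs <;> simp
      _ = _ := by simp
  have := hb S
  simp only [one_mul] at this
  change _ ≤ linPart (fun i => A.mul B i k) x + K' * S ^ K'
  omega

/-- A trace of an iterated concatenation is cut into passes, each of which has its own matrix. -/
theorem Covered.exists_passes {R : Set (Trace n)} {S : Finset (Dep n)} {K : ℕ}
    (h : Covered R S K) (hmark : ∀ σ ∈ R, 1 ≤ σ.count) {A₀ : DepMatrix n}
    (hA₀ : A₀ ∈ somHat (S : Set (Dep n))) (m : ℕ) {σ : Trace n} (hσ : σ ∈ Trace.power R m) :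
    m ≤ σ.count ∧ ∃ (x : ℕ → LState n) (A : ℕ → DepMatrix n), x 0 = σ.head ∧ x m = σ.final ∧
      (∀ t, A t ∈ somHat (S : Set (Dep n))) ∧ ∀ M, σ.count ≤ M → ∀ t < m, ∀ k, NoThree S k →
        extend (x (t + 1)) M k ≤ colBound K (fun i => A t i k) (extend (x t) M) := by
  induction m generalizing σ with
  | zero =>
    have h : σ.items = [] := hσ
    exact ⟨Nat.zero_le _, fun _ => σ.head, fun _ => A₀, rfl,
      by simp [Trace.final, h, Trace.lastState], fun _ => hA₀,
      fun _ _ _ ht => absurd ht (Nat.not_lt_zero _)⟩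
  | succ m ih =>
    obtain ⟨σ₁, hσ₁, σ₂, hσ₂, hσ, rfl⟩ := hσ
    obtain ⟨hm, x, A, hx0, hxm, hA, hb⟩ := ih hσ₁
    obtain ⟨B, hB, hbB⟩ := h σ₂ hσ₂
    have h₂ := hmark σ₂ hσ₂
    rw [Trace.final_append hσ, Trace.count_append]
    refine ⟨by omega, fun t => if t ≤ m then x t else σ₂.final, fun t => if t < m then A t else B,
      by simp [hx0], by simp, fun t => ?_, fun M hM t ht k hk => ?_⟩
    · dsimp only
      split_ifs
      · exact hA t
      · exact hB
    · rcases Nat.lt_succ_iff_lt_or_eq.1 ht with ht | rfl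
      · simp only [show t + 1 ≤ m by omega, show t ≤ m by omega, ht, if_true]
        exact hb M (by omega) t ht k hk
      · simp only [le_refl, if_true, lt_irrefl, if_false, show ¬ (t + 1 ≤ t) by omega]
        rw [hxm, hσ]
        exact hbB M (by omega) k hk

theorem Covered.star {R : Set (Trace n)} {S : Finset (Dep n)} {K : ℕ} (hK : 1 ≤ K)
    (h : Covered R S K) (hmark : ∀ σ ∈ R, 1 ≤ σ.count) :
    ∃ K', 1 ≤ K' ∧ Covered (⋃ m, Trace.power R m) (loopClosure (depLfp S)) K' := by
  set F := depLfp S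
  have hid := depId_subset_depLfp S
  obtain ⟨K', hK', hb⟩ := exists_loopMatrix_bound hid (depMul_depLfp_subset S) hK
  refine ⟨K', hK', fun σ hσ => ?_⟩
  obtain ⟨m, hm⟩ := Set.mem_iUnion.1 hσ
  obtain ⟨hmc, x, A, hx0, hxm, hA, hbA⟩ := (h.mono_deps (subset_depLfp S)).exists_passes hmark
    (somHat_mono (Finset.coe_subset.2 hid) (idMatrix_mem_somHat n)) m hm
  refine ⟨loopMatrix F (pathMatrix A 0 m), loopMatrix_mem_somHat
    (pathMatrix_mem_somHat hid (depMul_depLfp_subset S) hA 0 m), fun M hM k hk => ?_⟩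
  have := hb A (fun t => extend (x t) M) m hA (by simpa using hmc.trans hM)
    (fun t ht k hk => hbA M hM t ht k (hk.mono (subset_loopClosure F))) k hk
  simpa only [hx0, hxm] using this

/-- The matrix of a loop bracket: the row of the iteration count is merged into that of the
loop bound `X_l`. -/
def bracketMatrix (l : Fin n) (A : DepMatrix n) : DepMatrix n := fun i j =>
  if j = Fin.last n then A i j
  else if i = Fin.last n then ⊥
  else if i = l.castSucc then A i j ⊔ A (Fin.last n) j
  else A i j

theorem unary_mem_image_substSource {S : Finset (Dep n)} {l : Fin n} {i j : Fin (n + 1)}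
    {δ : DepType} (h : Dep.unary i δ j ∈ S) (hij : i ≠ Fin.last n ∨ j = Fin.last n) :
    Dep.unary i δ j ∈ S.image (Dep.substSource l) :=
  Finset.mem_image.2 ⟨_, h, by
    simp only [Dep.substSource, if_neg (show ¬ (i = Fin.last n ∧ j ≠ Fin.last n) by tauto)]⟩

theorem unary_castSucc_mem_image_substSource {S : Finset (Dep n)} {l : Fin n} {j : Fin (n + 1)}
    {δ : DepType} (h : Dep.unary (Fin.last n) δ j ∈ S) (hj : j ≠ Fin.last n) :
    Dep.unary l.castSucc δ j ∈ S.image (Dep.substSource l) :=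
  Finset.mem_image.2 ⟨_, h, by simp [Dep.substSource, hj]⟩

theorem NoThree.of_substSource {S : Finset (Dep n)} {l : Fin n} {j : Fin (n + 1)}
    (hj : NoThree (S.image (Dep.substSource l)) j) : NoThree S j := by
  intro i hi
  by_cases h : i ≠ Fin.last n ∨ j = Fin.last n
  · exact hj i (unary_mem_image_substSource hi h)
  · push Not at h
    obtain ⟨rfl, h⟩ := h
    exact hj _ (unary_castSucc_mem_image_substSource hi h)

section Bracket

variable {S : Finset (Dep n)} {l : Fin n} {A : DepMatrix n} {i j : Fin (n + 1)}

theorem last_not_isOne (hS : ∀ D ∈ S, D.Proper) (hA : A ∈ somHat (S : Set (Dep n)))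
    (hj : j ≠ Fin.last n) : ¬ entryIsOne (A (Fin.last n) j) = true := by
  intro h
  rcases entryIsOne_iff.1 h with h | h
  all_goals
    rcases (hS _ (hA.2.1 _ _ _ h)).2 rfl hj with h' | h' <;> cases h'

theorem isOne_of_isOne_bracketMatrix (hS : ∀ D ∈ S, D.Proper)
    (hA : A ∈ somHat (S : Set (Dep n))) (h : entryIsOne (bracketMatrix l A i j)) :
    entryIsOne (A i j) := by
  unfold bracketMatrix at h
  split_ifs at h with h₁ h₂ h₃
  · exact h
  · cases h
  · rcases max_choice (A i j) (A (Fin.last n) j) with h' | h'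
    · rwa [h'] at h
    · rw [h'] at h
      exact absurd h (last_not_isOne hS hA h₁)
  · exact h

theorem bracketMatrix_mem_somHat (hS : ∀ D ∈ S, D.Proper) (hA : A ∈ somHat (S : Set (Dep n))) :
    bracketMatrix l A ∈ somHat (S.image (Dep.substSource l) : Finset (Dep n)) := by
  refine ⟨⟨by simpa [bracketMatrix] using hA.1.1, ?_⟩, ?_, ?_⟩
  · intro i j h k hk
    have h1 := isOne_of_isOne_bracketMatrix hS hA (l := l) (i := i) (j := j) (by rw [h]; rfl)
    have hle : j ≠ Fin.last n → i ≠ Fin.last n → A i j ≤ bracketMatrix l A i j := by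
      intro hj hi
      unfold bracketMatrix
      rw [if_neg hj, if_neg hi]
      split_ifs
      · exact le_sup_left
      · exact le_rfl
    have hA1 : A i j = DepType.one := by
      by_cases hj : j = Fin.last n
      · simpa [bracketMatrix, hj] using h
      · have hi : i ≠ Fin.last n := by
          rintro rfl
          simp [bracketMatrix, hj] at h
        have := hle hj hi
        rw [h] at this
        rcases entryIsOne_iff.1 h1 with h2 | h2
        · exact h2
        · rw [h2] at this
          exact absurd this (by decide)
    have h0 := hA.1.2 i j hA1
    unfold bracketMatrix
    split_ifs with h₁ h₂ h₃
    · exact h0 k hk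
    · rfl
    · have hi : i ≠ Fin.last n := by
        rintro rfl
        simp [bracketMatrix, h₁] at h
      rw [h0 k hk, h0 (Fin.last n) hi.symm, sup_bot_eq]
    · exact h0 k hk
  · intro i j δ h
    unfold bracketMatrix at h
    split_ifs at h with h₁ h₂ h₃
    · exact unary_mem_image_substSource (hA.2.1 _ _ _ h) (Or.inr h₁)
    · cases h
    · rcases max_choice (A i j) (A (Fin.last n) j) with h' | h'
      · exact unary_mem_image_substSource (hA.2.1 _ _ _ (h'.symm.trans h)) (Or.inl h₂)
      · rw [h₃]
        exact unary_castSucc_mem_image_substSource (hA.2.1 _ _ _ (h'.symm.trans h)) h₁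
    · exact unary_mem_image_substSource (hA.2.1 _ _ _ h) (Or.inl h₂)
  · intro i j k k' h₁ h₂ h₃
    exact Finset.mem_image.2 ⟨_, hA.2.2 i j k k' (isOne_of_isOne_bracketMatrix hS hA h₁)
      (isOne_of_isOne_bracketMatrix hS hA h₂) h₃, rfl⟩

/-- Evaluating the bound at the loop bound `X_l` in place of the iteration count. -/
theorem colBound_le_bracketMatrix (hS : ∀ D ∈ S, D.Proper) (hA : A ∈ somHat (S : Set (Dep n)))
    (hj : j ≠ Fin.last n) (h3 : ∀ i, A i j ≠ DepType.three) (K : ℕ) (x : LState n) (M : ℕ) :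
    colBound K (fun i => A i j) (extend x (x l)) ≤
      linPart (fun i => bracketMatrix l A i j) (extend x M) +
        (polyArg (fun i => bracketMatrix l A i j) (extend x M) +
          K * (2 * polyArg (fun i => bracketMatrix l A i j) (extend x M)) ^ K) := by
  have hne : ∀ i : Fin n, i.castSucc ≠ Fin.last n := fun i => (Fin.castSucc_lt_last i).ne
  have hle : ∀ i : Fin n, A i.castSucc j ≤ bracketMatrix l A i.castSucc j := by
    intro i
    unfold bracketMatrix
    rw [if_neg hj, if_neg (hne i)]
    split_ifs
    · exact le_sup_left
    · exact le_rfl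
  have hB3 : ∀ i, bracketMatrix l A i j ≠ DepType.three := by
    intro i
    unfold bracketMatrix
    rw [if_neg hj]
    split_ifs
    · simp
    · rcases max_choice (A i j) (A (Fin.last n) j) with h' | h' <;> rw [h'] <;> exact h3 _
    · exact h3 i
  have hlin : linPart (fun i => A i j) (extend x (x l)) ≤
      linPart (fun i => bracketMatrix l A i j) (extend x M) +
        polyArg (fun i => bracketMatrix l A i j) (extend x M) := by
    simp only [linPart, polyArg, ← Finset.sum_add_distrib]
    rw [Fin.sum_univ_castSucc, Fin.sum_univ_castSucc, if_neg (last_not_isOne hS hA hj), add_zero]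
    refine le_trans (Finset.sum_le_sum fun i _ => ?_) (Nat.le_add_right _ _)
    simp only [extend_castSucc]
    by_cases h1 : entryIsOne (A i.castSucc j)
    · by_cases h2 : entryIsOne (bracketMatrix l A i.castSucc j)
      · simp [h1, h2]
      · have : bracketMatrix l A i.castSucc j ≠ ⊥ := by
          intro h0
          have := hle i
          rw [h0, le_bot_iff] at this
          rw [this] at h1
          cases h1
        simp [h1, eq_two_of_two_le (two_le_iff.2 ⟨this, h2⟩) (hB3 _)]
    · simp [h1]
  have hpoly : polyArg (fun i => A i j) (extend x (x l)) ≤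
      2 * polyArg (fun i => bracketMatrix l A i j) (extend x M) := by
    have h₁ : ∑ i : Fin n, (if A i.castSucc j = DepType.two then x i else 0) ≤
        polyArg (fun i => bracketMatrix l A i j) (extend x M) := by
      rw [polyArg, Fin.sum_univ_castSucc]
      refine le_trans (Finset.sum_le_sum fun i _ => ?_) (Nat.le_add_right _ _)
      by_cases h2 : A i.castSucc j = DepType.two
      · have := hle i
        rw [h2] at this
        simp [h2, eq_two_of_two_le this (hB3 _)]
      · simp [h2]
    have h₂ : (if A (Fin.last n) j = DepType.two then x l else 0) ≤
        polyArg (fun i => bracketMatrix l A i j) (extend x M) := by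
      split_ifs with h2
      · have h2' : (DepType.two : WithBot DepType) ≤ bracketMatrix l A l.castSucc j := by
          unfold bracketMatrix
          rw [if_neg hj, if_neg (hne l), if_pos rfl, h2]
          exact le_sup_right
        simpa using le_polyArg (x := extend x M) (v := fun i => bracketMatrix l A i j)
          (eq_two_of_two_le h2' (hB3 _))
      · exact Nat.zero_le _
    rw [polyArg, Fin.sum_univ_castSucc]
    simp only [extend_castSucc, extend_last]
    omega
  have := Nat.mul_le_mul_left K (Nat.pow_le_pow_left hpoly K)
  unfold colBound
  omega

end Bracket

theorem Covered.bracket {E : Lare n} {K : ℕ} (hK : 1 ≤ K) (h : Covered E.traces E.deps K)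
    (l : Fin n) : ∃ K', 1 ≤ K' ∧
      Covered (Lare.bracket l E).traces (Lare.bracket l E).deps K' := by
  obtain ⟨K', hK', hb⟩ := (PolySmall.linear 1).add
    ((PolySmall.linear 2).const_mul_pow K hK)
  refine ⟨K', hK', ?_⟩
  rintro _ ⟨σ, hσ, hc, rfl⟩
  obtain ⟨A, hA, hbA⟩ := h σ hσ
  have hB := bracketMatrix_mem_somHat (l := l) E.deps_proper hA
  refine ⟨bracketMatrix l A, hB, fun M _ j hj => ?_⟩
  rw [Trace.final_erase]
  by_cases hjl : j = Fin.last n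
  · subst hjl
    rw [colBound_of_one hB.1 hB.1.1 hK']
    simp
  · have hjE : NoThree E.deps j := NoThree.of_substSource hj
    have h₁ := hbA (σ.head l) hc j hjE
    have h₂ := colBound_le_bracketMatrix (l := l) E.deps_proper hA hjl (hjE.entry_ne hA) K σ.head M
    have h₃ : extend σ.final M j = extend σ.final (σ.head l) j := by
      obtain ⟨c, rfl⟩ := Fin.exists_castSucc_eq.2 hjl
      simp
    have h₄ := hb (polyArg (fun i => bracketMatrix l A i j) (extend σ.head M))
    simp only [one_mul] at h₄
    rw [h₃]
    change _ ≤ colBound K' _ (extend σ.head M)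
    unfold colBound at h₂ ⊢
    unfold colBound at h₁
    omega

theorem Lare.exists_covered (E : Lare n) (hE : E.WellFormed) :
    ∃ K, 1 ≤ K ∧ Covered E.traces E.deps K := by
  induction E with
  | instr a => exact ⟨2, by omega, covered_instr a⟩
  | mark => exact ⟨1, le_rfl, covered_mark⟩
  | seq E₁ E₂ ih₁ ih₂ =>
    obtain ⟨K₁, hK₁, h₁⟩ := ih₁ hE.1
    obtain ⟨K₂, hK₂, h₂⟩ := ih₂ hE.2
    exact (h₁.mono (le_max_left K₁ K₂)).concat (by omega) (h₂.mono (le_max_right K₁ K₂))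
      E₁.exists_unary_mem_deps
  | alt E₁ E₂ ih₁ ih₂ =>
    obtain ⟨K₁, hK₁, h₁⟩ := ih₁ hE.1
    obtain ⟨K₂, hK₂, h₂⟩ := ih₂ hE.2
    refine ⟨max K₁ K₂, by omega, fun σ hσ => ?_⟩
    rcases hσ with hσ | hσ
    · exact (h₁.mono (le_max_left K₁ K₂)).mono_deps Finset.subset_union_left σ hσ
    · exact (h₂.mono (le_max_right K₁ K₂)).mono_deps Finset.subset_union_right σ hσ
  | star E ih =>
    obtain ⟨K, hK, h⟩ := ih hE.1
    exact h.star hK fun σ hσ => hE.2.one_le_count hσ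
  | bracket l E ih =>
    obtain ⟨K, hK, h⟩ := ih hE
    exact h.bracket hK l

end Upper

/-! ### Lower bounds -/

section Lower

variable {n : ℕ}

/-- The lower bound on the final value `v` of the target in terms of the initial value `u` of the
source `i` that a dependency of type `δ` guarantees, when all variables have values at least `μ`.
For the iteration count as a source of type `2`, the increment `μ` is collected `u` times. -/
def LowerRel : DepType → Fin (n + 1) → ℕ → ℕ → ℕ → ℕ → Prop
  | .one, _, _, _, u, v => u ≤ v
  | .onePlus, _, _, μ, u, v => u + μ ≤ v
  | .two, i, _, μ, u, v => (if i = Fin.last n then μ else 2) * u ≤ v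
  | .three, _, c, _, u, v => 2 ^ (u / c) ≤ v

/-- The dependency is witnessed by traces in `R`: from all sufficiently large states there is a
trace with the lower bound of that dependency.  It has boundedly many marks, except that the
dependencies on the iteration count need a number of marks proportional to its value `m`. -/
def Realized (R : Set (Trace n)) : Dep n → Prop
  | .unary i δ j => ∃ c, 2 ≤ c ∧ ∀ μ, c ≤ μ → ∀ (x : LState n) (m : ℕ), (∀ v, μ ≤ x v) → μ ≤ m →
      ∃ σ ∈ R, σ.head = x ∧
        σ.count ≤ (if i = Fin.last n ∧ j ≠ Fin.last n then c * m else c) ∧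
        LowerRel δ i c μ (extend x m i) (extend σ.final m j)
  | .binary i i' k k' => ∃ c, 2 ≤ c ∧ ∀ μ, c ≤ μ → ∀ (x : LState n) (m : ℕ), (∀ v, μ ≤ x v) →
      μ ≤ m → ∃ σ ∈ R, σ.head = x ∧ σ.count ≤ c ∧
        extend x m i ≤ extend σ.final m k ∧ extend x m i' ≤ extend σ.final m k' ∧
        (k = k' → extend x m i + extend x m i' ≤ extend σ.final m k)

/-- Positive lower bounds on all variables are preserved. -/
def KeepsLarge (R : Set (Trace n)) : Prop :=
  ∀ σ ∈ R, ∀ μ, 1 ≤ μ → (∀ v, μ ≤ σ.head v) → ∀ v, μ ≤ σ.final v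

theorem Realized.mono {R R' : Set (Trace n)} {D : Dep n} (h : Realized R D) (hR : R ⊆ R') :
    Realized R' D := by
  cases D with
  | unary i δ j =>
    obtain ⟨c, hc, h⟩ := h
    refine ⟨c, hc, fun μ hμ x m hx hm => ?_⟩
    obtain ⟨σ, hσ, h⟩ := h μ hμ x m hx hm
    exact ⟨σ, hR hσ, h⟩
  | binary i i' k k' =>
    obtain ⟨c, hc, h⟩ := h
    refine ⟨c, hc, fun μ hμ x m hx hm => ?_⟩
    obtain ⟨σ, hσ, h⟩ := h μ hμ x m hx hm
    exact ⟨σ, hR hσ, h⟩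

namespace LowerRel

variable {i j : Fin (n + 1)} {α β : DepType} {c c' μ u v w : ℕ}

theorem mono_const (h : LowerRel α i c μ u v) (hc : 1 ≤ c) (hcc : c ≤ c') :
    LowerRel α i c' μ u v := by
  cases α with
  | three => exact (Nat.pow_le_pow_right (by omega) (Nat.div_le_div_left hcc hc)).trans h
  | _ => exact h

theorem le (h : LowerRel α i c μ u v) (hα : α ≠ .three) (hμ : 2 ≤ μ) : u ≤ v := by
  cases α with
  | one => exact h
  | onePlus => exact (Nat.le_add_right _ _).trans h
  | two =>
    refine le_trans ?_ h
    exact Nat.le_mul_of_pos_left _ (by split_ifs <;> omega)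
  | three => exact absurd rfl hα

theorem mono_right (h : LowerRel α i c μ u v) (hvw : v ≤ w) : LowerRel α i c μ u w := by
  cases α <;> exact le_trans h hvw

theorem comp (hc : 1 ≤ c) (hc' : 1 ≤ c') (hμ : 2 ≤ μ)
    (hij : i = Fin.last n → j ≠ Fin.last n → α = .two ∨ α = .three)
    (h : LowerRel α i c μ u v) (h' : LowerRel β j c' μ v w) :
    LowerRel (max α β) i (2 * c * c') μ u w := by
  by_cases hβ : β = .three
  · subst hβ
    rw [show max α .three = .three by cases α <;> decide]
    refine le_trans (Nat.pow_le_pow_right (by omega) ?_) h'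
    by_cases hα : α = .three
    · subst hα
      have h₁ : u / c ≤ v := (Nat.lt_two_pow_self).le.trans h
      calc u / (2 * c * c') ≤ u / (c * c') := Nat.div_le_div_left (by nlinarith) (by positivity)
        _ = u / c / c' := (Nat.div_div_eq_div_mul u c c').symm
        _ ≤ v / c' := Nat.div_le_div_right h₁
    · calc u / (2 * c * c') ≤ u / c' := Nat.div_le_div_left (by nlinarith) hc'
        _ ≤ v / c' := Nat.div_le_div_right (h.le hα hμ)
  · have hvw := h'.le hβ hμ
    by_cases hle : β ≤ α
    · rw [max_eq_left hle]
      exact (h.mono_right hvw).mono_const hc (by nlinarith)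
    · have hα : α ≠ .three := by
        rintro rfl
        exact hle (by cases β <;> decide)
      have huv := h.le hα hμ
      rw [max_eq_right (not_le.1 hle).le]
      cases β with
      | one => exact le_trans huv h'
      | onePlus => exact le_trans (Nat.add_le_add_right huv _) h'
      | two =>
        refine le_trans ?_ h'
        refine Nat.mul_le_mul ?_ huv
        by_cases hi : i = Fin.last n
        · by_cases hj : j = Fin.last n
          · simp [hi, hj]
          · rcases hij hi hj with rfl | rfl
            · exact absurd le_rfl hle
            · exact absurd rfl hα
        · rw [if_neg hi]
          split_ifs <;> omega
      | three => exact absurd rfl hβ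

end LowerRel

theorem Realized.prod {R₁ R₂ : Set (Trace n)} {D₁ D₂ D : Dep n} (hR : KeepsLarge R₁)
    (h₁ : Realized R₁ D₁) (h₂ : Realized R₂ D₂) (hD₁ : D₁.Proper) (hD₂ : D₂.Proper)
    (hD : Dep.IsProd D₁ D₂ D) : Realized (Trace.concat R₁ R₂) D := by
  have glue : ∀ {σ₁ σ₂ : Trace n}, σ₁ ∈ R₁ → σ₂ ∈ R₂ → σ₂.head = σ₁.final →
      ∃ σ ∈ Trace.concat R₁ R₂, σ.head = σ₁.head ∧ σ.count = σ₁.count + σ₂.count ∧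
        σ.final = σ₂.final := fun hσ₁ hσ₂ h =>
    ⟨_, ⟨_, hσ₁, _, hσ₂, h.symm, rfl⟩, rfl, Trace.count_append _ _, Trace.final_append h.symm⟩
  have hcc : ∀ {c c' : ℕ}, 2 ≤ c → 2 ≤ c' → c ≤ 2 * c * c' ∧ c' ≤ 2 * c * c' ∧
      c + c' ≤ 2 * c * c' := by
    intro c c' hc hc'
    refine ⟨?_, ?_, ?_⟩ <;> nlinarith
  cases hD with
  | trans i j k α β =>
    obtain ⟨c, hc, h₁⟩ := h₁
    obtain ⟨c', hc', h₂⟩ := h₂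
    obtain ⟨hle, hle', hadd⟩ := hcc hc hc'
    refine ⟨2 * c * c', by omega, fun μ hμ x m hx hm => ?_⟩
    obtain ⟨σ₁, hσ₁, rfl, hn₁, hl₁⟩ := h₁ μ (by omega) x m hx hm
    obtain ⟨σ₂, hσ₂, hσ, hn₂, hl₂⟩ := h₂ μ (by omega) σ₁.final m
      (hR σ₁ hσ₁ μ (by omega) hx) hm
    obtain ⟨σ, hσR, h₃, h₄, h₅⟩ := glue hσ₁ hσ₂ hσ
    refine ⟨σ, hσR, h₃, ?_, ?_⟩
    · rw [h₄]
      by_cases hik : i = Fin.last n ∧ k ≠ Fin.last n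
      · rw [if_pos hik]
        have h₆ : σ₁.count ≤ c * m := hn₁.trans (by
          split_ifs
          · exact le_rfl
          · exact Nat.le_mul_of_pos_right _ (by omega))
        have h₇ : σ₂.count ≤ c' * m := hn₂.trans (by
          split_ifs
          · exact le_rfl
          · exact Nat.le_mul_of_pos_right _ (by omega))
        have := Nat.mul_le_mul_right m hadd
        nlinarith
      · rw [if_neg hik]
        have hij : ¬ (i = Fin.last n ∧ j ≠ Fin.last n) := by
          rintro ⟨hi, hj⟩
          exact hj (hD₂.1 (not_not.1 fun hk => hik ⟨hi, hk⟩)).1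
        have hjk : ¬ (j = Fin.last n ∧ k ≠ Fin.last n) := by
          rintro ⟨hj, hk⟩
          exact hik ⟨(hD₁.1 hj).1, hk⟩
        rw [if_neg hij] at hn₁
        rw [if_neg hjk] at hn₂
        omega
    · rw [h₅]
      exact LowerRel.comp (by omega) (by omega) (by omega) hD₁.2 hl₁ hl₂
  | fork i j k k' α hα =>
    obtain ⟨c, hc, h₁⟩ := h₁
    obtain ⟨c', hc', h₂⟩ := h₂
    obtain ⟨hle, hle', hadd⟩ := hcc hc hc'
    refine ⟨2 * c * c', by omega, fun μ hμ x m hx hm => ?_⟩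
    obtain ⟨σ₁, hσ₁, rfl, hn₁, hl₁⟩ := h₁ μ (by omega) x m hx hm
    obtain ⟨σ₂, hσ₂, hσ, hn₂, hl₂, hl₂', hl₂''⟩ := h₂ μ (by omega) σ₁.final m
      (hR σ₁ hσ₁ μ (by omega) hx) hm
    obtain ⟨σ, hσR, h₃, h₄, h₅⟩ := glue hσ₁ hσ₂ hσ
    have hij := hD₁.last_iff hα
    rw [if_neg (by tauto)] at hn₁
    have hu := hl₁.le (by rintro rfl; cases hα) (by omega)
    refine ⟨σ, hσR, h₃, by omega, ?_⟩
    rw [h₅]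
    refine ⟨by omega, by omega, fun hk => ?_⟩
    have := hl₂'' hk
    omega
  | join i i' j k α hα =>
    obtain ⟨c, hc, h₁⟩ := h₁
    obtain ⟨c', hc', h₂⟩ := h₂
    obtain ⟨hle, hle', hadd⟩ := hcc hc hc'
    refine ⟨2 * c * c', by omega, fun μ hμ x m hx hm => ?_⟩
    obtain ⟨σ₁, hσ₁, rfl, hn₁, hl₁, hl₁', hl₁''⟩ := h₁ μ (by omega) x m hx hm
    obtain ⟨σ₂, hσ₂, hσ, hn₂, hl₂⟩ := h₂ μ (by omega) σ₁.final m
      (hR σ₁ hσ₁ μ (by omega) hx) hm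
    obtain ⟨σ, hσR, h₃, h₄, h₅⟩ := glue hσ₁ hσ₂ hσ
    have hjk := hD₂.last_iff hα
    rw [if_neg (by tauto)] at hn₂
    have hu := hl₂.le (by rintro rfl; cases hα) (by omega)
    have := hl₁'' rfl
    refine ⟨σ, hσR, h₃, by omega, ?_⟩
    rw [h₅]
    exact ⟨by omega, by omega, fun _ => by omega⟩
  | diamond i j j' k =>
    obtain ⟨c, hc, h₁⟩ := h₁
    obtain ⟨c', hc', h₂⟩ := h₂
    obtain ⟨hle, hle', hadd⟩ := hcc hc hc'
    refine ⟨2 * c * c', by omega, fun μ hμ x m hx hm => ?_⟩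
    obtain ⟨σ₁, hσ₁, rfl, hn₁, hl₁, hl₁', hl₁''⟩ := h₁ μ (by omega) x m hx hm
    obtain ⟨σ₂, hσ₂, hσ, hn₂, hl₂, hl₂', hl₂''⟩ := h₂ μ (by omega) σ₁.final m
      (hR σ₁ hσ₁ μ (by omega) hx) hm
    obtain ⟨σ, hσR, h₃, h₄, h₅⟩ := glue hσ₁ hσ₂ hσ
    have hi : i ≠ Fin.last n := by
      intro hi
      rcases hD₁.2.2 with h | h
      · exact h rfl
      · exact h ((hD₁.1.1 hi).trans (hD₁.2.1.1 hi).symm)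
    have := hl₂'' rfl
    refine ⟨σ, hσR, h₃, ?_, ?_⟩
    · rw [if_neg fun h => hi h.1]
      omega
    · rw [h₅]
      change (if i = Fin.last n then μ else 2) * _ ≤ _
      rw [if_neg hi]
      omega
  | pair i i' j j' k k' hne =>
    obtain ⟨c, hc, h₁⟩ := h₁
    obtain ⟨c', hc', h₂⟩ := h₂
    obtain ⟨hle, hle', hadd⟩ := hcc hc hc'
    refine ⟨2 * c * c', by omega, fun μ hμ x m hx hm => ?_⟩
    obtain ⟨σ₁, hσ₁, rfl, hn₁, hl₁, hl₁', hl₁''⟩ := h₁ μ (by omega) x m hx hm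
    obtain ⟨σ₂, hσ₂, hσ, hn₂, hl₂, hl₂', hl₂''⟩ := h₂ μ (by omega) σ₁.final m
      (hR σ₁ hσ₁ μ (by omega) hx) hm
    obtain ⟨σ, hσR, h₃, h₄, h₅⟩ := glue hσ₁ hσ₂ hσ
    refine ⟨σ, hσR, h₃, by omega, ?_⟩
    rw [h₅]
    refine ⟨by omega, by omega, fun hk => ?_⟩
    have := hl₂'' hk
    omega

theorem KeepsLarge.concat {R₁ R₂ : Set (Trace n)} (h₁ : KeepsLarge R₁) (h₂ : KeepsLarge R₂) :
    KeepsLarge (Trace.concat R₁ R₂) := by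
  rintro _ ⟨σ₁, hσ₁, σ₂, hσ₂, hσ, rfl⟩ μ hμ hx
  rw [Trace.final_append hσ]
  exact h₂ σ₂ hσ₂ μ hμ (hσ ▸ h₁ σ₁ hσ₁ μ hμ hx)

theorem KeepsLarge.power {R : Set (Trace n)} (h : KeepsLarge R) (m : ℕ) :
    KeepsLarge (Trace.power R m) := by
  induction m with
  | zero =>
    intro σ hσ μ _ hx
    have h : σ.items = [] := hσ
    simpa [Trace.final, h, Trace.lastState] using hx
  | succ m ih => exact ih.concat h

theorem Lare.keepsLarge (E : Lare n) : KeepsLarge E.traces := by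
  induction E with
  | instr a =>
    intro σ hσ μ hμ hx v
    have h : σ.items = [some (a.exec σ.head)] := hσ
    have hf : σ.final = a.exec σ.head := by simp [Trace.final, h, Trace.lastState]
    rw [hf]
    cases a with
    | skip => exact hx v
    | copy i j =>
      simp only [Instr.exec, Function.update_apply]
      split_ifs
      · exact hx j
      · exact hx v
    | add i j k =>
      simp only [Instr.exec, Function.update_apply]
      split_ifs
      · exact (hx j).trans (Nat.le_add_right _ _)
      · exact hx v
    | mul i j k =>
      simp only [Instr.exec, Function.update_apply]
      split_ifs
      · exact (hx j).trans (Nat.le_mul_of_pos_right _ (hμ.trans (hx k)))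
      · exact hx v
  | mark =>
    intro σ hσ μ _ hx
    have h : σ.items = [none] := hσ
    simpa [Trace.final, h, Trace.lastState] using hx
  | seq E₁ E₂ ih₁ ih₂ => exact ih₁.concat ih₂
  | alt E₁ E₂ ih₁ ih₂ => exact fun σ hσ => hσ.elim (ih₁ σ) (ih₂ σ)
  | star E ih =>
    intro σ hσ
    obtain ⟨m, hm⟩ := Set.mem_iUnion.1 hσ
    exact ih.power m σ hm
  | bracket l E ih =>
    rintro _ ⟨σ, hσ, -, rfl⟩ μ hμ hx
    rw [Trace.final_erase]
    exact ih σ hσ μ hμ hx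

theorem Instr.lowerRel (a : Instr n) {i j : Fin (n + 1)} {δ : DepType} (h : a.matrix i j = δ)
    {μ : ℕ} (hμ : 2 ≤ μ) {x : LState n} (m : ℕ) (hx : ∀ v, μ ≤ x v) :
    LowerRel δ i 2 μ (extend x m i) (extend (a.exec x) m j) := by
  induction j using Fin.lastCases with
  | last =>
    rw [a.matrix_last_right] at h
    split_ifs at h with hi
    · obtain rfl := WithBot.coe_injective h
      simp [LowerRel, hi]
    · cases h
  | cast c =>
    have hc : c.castSucc ≠ Fin.last n := (Fin.castSucc_lt_last c).ne
    induction i using Fin.lastCases with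
    | last =>
      rw [a.matrix_last_left hc] at h
      cases h
    | cast r =>
      have hr : r.castSucc ≠ Fin.last n := (Fin.castSucc_lt_last r).ne
      simp only [extend_castSucc]
      have hid : ∀ {y : ℕ}, idMatrix n r.castSucc c.castSucc = δ → x c = y →
          LowerRel δ r.castSucc 2 μ (x r) y := by
        rintro y h rfl
        simp only [idMatrix, Fin.castSucc_inj] at h
        split_ifs at h with hrc
        · obtain rfl := WithBot.coe_injective h
          simp [LowerRel, hrc]
        · cases h
      cases a with
      | skip => exact hid h rfl
      | copy i j =>
        by_cases hci : c = i
        · subst hci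
          simp only [Instr.matrix, if_true, Fin.castSucc_inj] at h
          split_ifs at h with hrj
          · obtain rfl := WithBot.coe_injective h
            simp [LowerRel, hrj, Instr.exec]
          · cases h
        · exact hid (by simpa [Instr.matrix, hci] using h) (by simp [Instr.exec, hci])
      | add i j k =>
        by_cases hci : c = i
        · subst hci
          simp only [Instr.matrix, if_true, Fin.castSucc_inj] at h
          have := hx j
          have := hx k
          split_ifs at h with hrj hjk
          · obtain rfl := WithBot.coe_injective h
            obtain rfl : r = j := hrj.elim id fun h => h.trans hjk.symm
            simp only [LowerRel, if_neg hr, Instr.exec, Function.update_self, ← hjk]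
            omega
          · obtain rfl := WithBot.coe_injective h
            simp only [LowerRel, Instr.exec, Function.update_self]
            rcases hrj with rfl | rfl <;> omega
          · cases h
        · exact hid (by simpa [Instr.matrix, hci] using h) (by simp [Instr.exec, hci])
      | mul i j k =>
        by_cases hci : c = i
        · subst hci
          simp only [Instr.matrix, if_true, Fin.castSucc_inj] at h
          have := hx j
          have := hx k
          split_ifs at h with hrj
          · obtain rfl := WithBot.coe_injective h
            simp only [LowerRel, if_neg hr, Instr.exec, Function.update_self]
            rcases hrj with rfl | rfl <;> nlinarith
          · cases h
        · exact hid (by simpa [Instr.matrix, hci] using h) (by simp [Instr.exec, hci])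

theorem Instr.le_of_isOne (a : Instr n) {i j : Fin (n + 1)} (h : entryIsOne (a.matrix i j))
    {μ : ℕ} (hμ : 2 ≤ μ) {x : LState n} (m : ℕ) (hx : ∀ v, μ ≤ x v) :
    extend x m i ≤ extend (a.exec x) m j := by
  rcases entryIsOne_iff.1 h with h | h
  · exact (a.lowerRel h hμ m hx).le (by decide) hμ
  · exact (a.lowerRel h hμ m hx).le (by decide) hμ

/-- Two different linear entries in a column come from an addition. -/
theorem Instr.add_le_of_isOne (a : Instr n) {i i' j : Fin (n + 1)} (hne : i ≠ i')
    (h : entryIsOne (a.matrix i j)) (h' : entryIsOne (a.matrix i' j)) (x : LState n) (m : ℕ) :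
    extend x m i + extend x m i' ≤ extend (a.exec x) m j := by
  have hid : ¬ (entryIsOne (idMatrix n i j) = true ∧ entryIsOne (idMatrix n i' j) = true) := by
    rintro ⟨h, h'⟩
    unfold idMatrix at h h'
    split_ifs at h h' with h₁ h₂
    · exact hne (h₁.trans h₂.symm)
    all_goals cases h <;> cases h'
  cases a with
  | skip => exact absurd ⟨h, h'⟩ hid
  | copy r s =>
    by_cases hj : j = r.castSucc
    · simp only [Instr.matrix, hj, if_true] at h h'
      split_ifs at h h' with h₁ h₂
      · exact absurd (h₁.trans h₂.symm) hne
      all_goals cases h <;> cases h'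
    · exact absurd ⟨by simpa [Instr.matrix, hj] using h, by simpa [Instr.matrix, hj] using h'⟩ hid
  | add r s t =>
    by_cases hj : j = r.castSucc
    · subst hj
      have hsum : extend ((Instr.add r s t).exec x) m r.castSucc = x s + x t := by
        simp [Instr.exec]
      rw [hsum]
      simp only [Instr.matrix, if_true] at h h'
      have key : ∀ {i}, entryIsOne (if i = s.castSucc ∨ i = t.castSucc then
          (if s = t then (DepType.two : WithBot DepType) else (DepType.onePlus : WithBot DepType))
          else ⊥) = true → i = s.castSucc ∨ i = t.castSucc := by
        intro i h
        by_contra hcon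
        rw [if_neg hcon] at h
        cases h
      rcases key h with rfl | rfl <;> rcases key h' with rfl | rfl
      · exact absurd rfl hne
      · simp
      · simp [add_comm]
      · exact absurd rfl hne
    · exact absurd ⟨by simpa [Instr.matrix, hj] using h, by simpa [Instr.matrix, hj] using h'⟩ hid
  | mul r s t =>
    by_cases hj : j = r.castSucc
    · simp only [Instr.matrix, hj, if_true] at h
      split_ifs at h <;> cases h
    · exact absurd ⟨by simpa [Instr.matrix, hj] using h, by simpa [Instr.matrix, hj] using h'⟩ hid

theorem realized_of_instr (a : Instr n) {R : Set (Trace n)}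
    (hR : ∀ x, ∃ σ ∈ R, σ.head = x ∧ σ.count ≤ 1 ∧ σ.final = a.exec x) :
    ∀ D ∈ depsOfMatrix a.matrix, Realized R D := by
  rintro (⟨i, δ, j⟩ | ⟨i, i', k, k'⟩) hD
  · rw [unary_mem_depsOfMatrix] at hD
    refine ⟨2, le_rfl, fun μ hμ x m hx hm => ?_⟩
    obtain ⟨σ, hσ, h₁, h₂, h₃⟩ := hR x
    refine ⟨σ, hσ, h₁, ?_, ?_⟩
    · split_ifs <;> omega
    · rw [h₃]
      exact a.lowerRel hD hμ m hx
  · obtain ⟨h, h', hne⟩ := binary_mem_depsOfMatrix.1 hD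
    refine ⟨2, le_rfl, fun μ hμ x m hx hm => ?_⟩
    obtain ⟨σ, hσ, h₁, h₂, h₃⟩ := hR x
    refine ⟨σ, hσ, h₁, by omega, ?_⟩
    rw [h₃]
    refine ⟨a.le_of_isOne h hμ m hx, a.le_of_isOne h' hμ m hx, fun hk => ?_⟩
    subst hk
    exact a.add_le_of_isOne (hne.resolve_right fun h => h rfl) h h' x m

theorem Trace.append_mem_power {R : Set (Trace n)} {a b : ℕ} {σ τ : Trace n}
    (hσ : σ ∈ Trace.power R a) (hτ : τ ∈ Trace.power R b) (h : σ.final = τ.head) :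
    (⟨σ.head, σ.items ++ τ.items⟩ : Trace n) ∈ Trace.power R (a + b) := by
  induction b generalizing τ with
  | zero =>
    have h0 : τ.items = [] := hτ
    simpa [h0] using hσ
  | succ b ih =>
    obtain ⟨τ₁, h₁, τ₂, h₂, h₃, rfl⟩ := hτ
    exact ⟨_, ih h₁ h, τ₂, h₂, (Trace.final_append (σ₂ := τ₁) h).trans h₃, by simp⟩

theorem concat_star_subset (E : Lare n) :
    Trace.concat (Lare.star E).traces (Lare.star E).traces ⊆ (Lare.star E).traces := by
  rintro _ ⟨σ, hσ, τ, hτ, h, rfl⟩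
  obtain ⟨a, ha⟩ := Set.mem_iUnion.1 hσ
  obtain ⟨b, hb⟩ := Set.mem_iUnion.1 hτ
  exact Set.mem_iUnion.2 ⟨a + b, Trace.append_mem_power ha hb h⟩

theorem nil_mem_star (E : Lare n) (x : LState n) : (⟨x, []⟩ : Trace n) ∈ (Lare.star E).traces :=
  Set.mem_iUnion.2 ⟨0, rfl⟩

theorem subset_star (E : Lare n) : E.traces ⊆ (Lare.star E).traces := fun σ hσ =>
  Set.mem_iUnion.2 ⟨1, ⟨σ.head, []⟩, rfl, σ, hσ, rfl, rfl⟩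

/-- Repeating a pass that raises `X_a` at least by `q`. -/
theorem exists_iterate_le {R : Set (Trace n)} (hR : KeepsLarge R) (hcat : Trace.concat R R ⊆ R)
    (hnil : ∀ x, (⟨x, []⟩ : Trace n) ∈ R) {μ c : ℕ} (hμ : 1 ≤ μ) (a : Fin n) {q : ℕ → ℕ}
    (hq : Monotone q) (h : ∀ x : LState n, (∀ v, μ ≤ x v) → ∃ σ ∈ R, σ.head = x ∧ σ.count ≤ c ∧
      q (x a) ≤ σ.final a) (x : LState n) (hx : ∀ v, μ ≤ x v) (m : ℕ) :
    ∃ σ ∈ R, σ.head = x ∧ σ.count ≤ c * m ∧ q^[m] (x a) ≤ σ.final a := by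
  induction m with
  | zero => exact ⟨⟨x, []⟩, hnil x, rfl, by simp [Trace.count], le_rfl⟩
  | succ m ih =>
    obtain ⟨σ, hσ, rfl, hc, hl⟩ := ih
    obtain ⟨τ, hτ, hh, hc', hl'⟩ := h σ.final (hR σ hσ μ hμ hx)
    refine ⟨_, hcat ⟨σ, hσ, τ, hτ, hh.symm, rfl⟩, rfl, ?_, ?_⟩
    · rw [Trace.count_append]
      nlinarith
    · rw [Trace.final_append hh.symm, Function.iterate_succ_apply']
      exact (hq hl).trans hl'

theorem realized_loopCorrect {R : Set (Trace n)} (hR : KeepsLarge R) (hcat : Trace.concat R R ⊆ R)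
    (hnil : ∀ x, (⟨x, []⟩ : Trace n) ∈ R) {F : Finset (Dep n)} (hF : ∀ D ∈ F, D.Proper)
    (hFR : ∀ D ∈ F, Realized R D) : ∀ D ∈ F.biUnion Dep.loopCorrect, Realized R D := by
  intro D hD
  obtain ⟨i, ⟨h, rfl⟩ | ⟨h, rfl⟩⟩ := exists_of_mem_loopCorrect hD
  · obtain ⟨a, rfl⟩ : ∃ a : Fin n, a.castSucc = i := Fin.exists_castSucc_eq.2 fun hi =>
      absurd ((hF _ h).1 hi).2 (by decide)
    have ha : a.castSucc ≠ Fin.last n := (Fin.castSucc_lt_last a).ne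
    obtain ⟨c, hc, hreal⟩ := hFR _ h
    refine ⟨c, hc, fun μ hμ x m hx hm => ?_⟩
    obtain ⟨σ, hσ, h₁, h₂, h₃⟩ := exists_iterate_le hR hcat hnil (μ := μ) (c := c) (by omega) a
      (q := (· + μ)) (fun _ _ hab => Nat.add_le_add_right hab μ) (fun x hx => by
        obtain ⟨σ, hσ, h₁, h₂, h₃⟩ := hreal μ hμ x m hx hm
        exact ⟨σ, hσ, h₁, by simpa [ha] using h₂, by simpa [LowerRel] using h₃⟩) x hx m
    refine ⟨σ, hσ, h₁, by simpa [ha] using h₂, ?_⟩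
    rw [add_right_iterate] at h₃
    simp only [LowerRel, if_true, extend_last, extend_castSucc]
    rw [mul_comm]
    simp only [smul_eq_mul] at h₃
    omega
  · obtain ⟨a, rfl⟩ : ∃ a : Fin n, a.castSucc = i := Fin.exists_castSucc_eq.2 fun hi =>
      absurd ((hF _ h).1 hi).2 (by decide)
    have ha : a.castSucc ≠ Fin.last n := (Fin.castSucc_lt_last a).ne
    obtain ⟨c, hc, hreal⟩ := hFR _ h
    refine ⟨c, hc, fun μ hμ x m hx hm => ?_⟩
    obtain ⟨σ, hσ, h₁, h₂, h₃⟩ := exists_iterate_le hR hcat hnil (μ := μ) (c := c) (by omega) a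
      (q := (2 * ·)) (fun _ _ hab => Nat.mul_le_mul_left 2 hab) (fun x hx => by
        obtain ⟨σ, hσ, h₁, h₂, h₃⟩ := hreal μ hμ x m hx hm
        exact ⟨σ, hσ, h₁, by simpa [ha] using h₂, by simpa [LowerRel, ha] using h₃⟩) x hx m
    refine ⟨σ, hσ, h₁, by simpa [ha] using h₂, ?_⟩
    rw [mul_left_iterate] at h₃
    simp only [LowerRel, extend_last, extend_castSucc]
    calc 2 ^ (m / c) ≤ 2 ^ m := Nat.pow_le_pow_right (by omega) (Nat.div_le_self m c)
      _ ≤ 2 ^ m * x a := Nat.le_mul_of_pos_right _ (by have := hx a; omega)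
      _ ≤ _ := h₃

/-- The iteration count is replaced by `X_l / c`; the factor `μ / c`, with which type `2` was
guaranteed for the count, makes up for the division by `c`. -/
theorem realized_bracket {E : Lare n} (l : Fin n) {D : Dep n} (hD : D.Proper)
    (h : Realized E.traces D) : Realized (Lare.bracket l E).traces (D.substSource l) := by
  cases D with
  | binary i i' k k' =>
    obtain ⟨c, hc, h⟩ := h
    refine ⟨c, hc, fun μ hμ x m hx hm => ?_⟩
    obtain ⟨σ, hσ, rfl, h₂, h₃⟩ := h μ hμ x m hx hm
    have hl := hx l
    refine ⟨σ.erase, ⟨σ, hσ, by omega, rfl⟩, rfl, by simp [Trace.count_erase], ?_⟩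
    rw [Trace.final_erase]
    exact h₃
  | unary i δ j =>
    obtain ⟨c, hc, h⟩ := h
    by_cases hij : i = Fin.last n ∧ j ≠ Fin.last n
    · simp only [Dep.substSource, if_pos hij]
      obtain ⟨rfl, hj⟩ := hij
      have hlne : l.castSucc ≠ Fin.last n := (Fin.castSucc_lt_last l).ne
      -- with `4 * c ≤ μ / c`, the bound `(μ / c) * (x l / c)` is at least `2 * x l`
      refine ⟨4 * c * c, by nlinarith, fun μ hμ x m hx hm => ?_⟩
      have hμc : 4 * c ≤ μ / c := (Nat.le_div_iff_mul_le (by omega)).2 hμ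
      have hl := hx l
      have hq : μ / c ≤ x l / c := Nat.div_le_div_right hl
      obtain ⟨σ, hσ, rfl, h₂, h₃⟩ := h (μ / c) (by omega) x (x l / c)
        (fun v => (Nat.div_le_self μ c).trans (hx v)) hq
      rw [if_pos ⟨rfl, hj⟩] at h₂
      refine ⟨σ.erase, ⟨σ, hσ, h₂.trans (Nat.mul_div_le _ _), rfl⟩, rfl,
        by simp [Trace.count_erase], ?_⟩
      rw [Trace.final_erase]
      obtain ⟨b, rfl⟩ := Fin.exists_castSucc_eq.2 hj
      simp only [extend_castSucc, extend_last] at h₃ ⊢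
      rcases hD.2 rfl hj with rfl | rfl
      · simp only [LowerRel, if_true, if_neg hlne] at h₃ ⊢
        have h₄ : σ.head l < c * (σ.head l / c + 1) := Nat.lt_mul_div_succ _ (by omega)
        have h₅ := Nat.mul_le_mul_right (σ.head l / c) hμc
        nlinarith
      · refine le_trans (Nat.pow_le_pow_right (by omega) ?_) h₃
        rw [Nat.div_div_eq_div_mul]
        exact Nat.div_le_div_left (by nlinarith) (by positivity)
    · simp only [Dep.substSource, if_neg hij]
      refine ⟨c, hc, fun μ hμ x m hx hm => ?_⟩
      obtain ⟨σ, hσ, rfl, h₂, h₃⟩ := h μ hμ x m hx hm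
      rw [if_neg hij] at h₂
      have hl := hx l
      refine ⟨σ.erase, ⟨σ, hσ, by omega, rfl⟩, rfl, by simp [Trace.count_erase], ?_⟩
      rw [Trace.final_erase]
      exact h₃

theorem realized_depMul {R₁ R₂ : Set (Trace n)} {S₁ S₂ : Finset (Dep n)} (hR : KeepsLarge R₁)
    (h₁ : ∀ D ∈ S₁, Realized R₁ D) (h₂ : ∀ D ∈ S₂, Realized R₂ D) (hS₁ : ∀ D ∈ S₁, D.Proper)
    (hS₂ : ∀ D ∈ S₂, D.Proper) : ∀ D ∈ depMul S₁ S₂, Realized (Trace.concat R₁ R₂) D := by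
  intro D hD
  obtain ⟨D₁, hD₁, D₂, hD₂, h⟩ := mem_depMul.1 hD
  exact (h₁ _ hD₁).prod hR (h₂ _ hD₂) (hS₁ _ hD₁) (hS₂ _ hD₂) (Dep.isProd_of_mem h)

theorem Lare.realized (E : Lare n) : ∀ D ∈ E.deps, Realized E.traces D := by
  induction E with
  | instr a =>
    exact realized_of_instr a fun x => ⟨⟨x, [some (a.exec x)]⟩, rfl, rfl, by simp [Trace.count],
      rfl⟩
  | mark =>
    exact realized_of_instr .skip fun x => ⟨⟨x, [none]⟩, rfl, rfl, by simp [Trace.count], rfl⟩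
  | seq E₁ E₂ ih₁ ih₂ =>
    exact realized_depMul E₁.keepsLarge ih₁ ih₂ E₁.deps_proper E₂.deps_proper
  | alt E₁ E₂ ih₁ ih₂ =>
    intro D hD
    rcases Finset.mem_union.1 hD with h | h
    · exact (ih₁ D h).mono Set.subset_union_left
    · exact (ih₂ D h).mono Set.subset_union_right
  | star E ih =>
    have hR := (Lare.star E).keepsLarge
    have hP := fun D hD => (Lare.star E).deps_proper D (Finset.mem_union_left _ hD)
    have hF : ∀ D ∈ depLfp E.deps, Realized (Lare.star E).traces D :=
      depLfp_induction
        (realized_of_instr .skip fun x => ⟨⟨x, []⟩, nil_mem_star E x, rfl,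
          by simp [Trace.count], rfl⟩)
        (fun D hD => (ih D hD).mono (subset_star E))
        fun D D' D'' hD hD' h h' hprod => (h.prod hR h' (hP _ hD) (hP _ hD') hprod).mono
          (concat_star_subset E)
    intro D hD
    rcases Finset.mem_union.1 hD with h | h
    · exact hF D h
    · exact (realized_depMul hR
        (realized_loopCorrect hR (concat_star_subset E) (nil_mem_star E) hP hF) hF
        (loopCorrect_proper hP) hP D h).mono (concat_star_subset E)
  | bracket l E ih =>
    intro D hD
    obtain ⟨D', hD', rfl⟩ := Finset.mem_image.1 hD
    exact realized_bracket l (E.deps_proper _ hD') (ih _ hD')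

end Lower

/-! ### Polynomials, and exponential growth -/

section Final

variable {n : ℕ}

theorem exists_eval_le {ι : Type*} (p : MvPolynomial ι ℕ) :
    ∃ K, ∀ (x : ι → ℕ) (B : ℕ), (∀ i, x i ≤ B) → MvPolynomial.eval x p ≤ K * (B + 1) ^ K := by
  induction p using MvPolynomial.induction_on with
  | C a => exact ⟨a, fun x B _ => by
      simpa using Nat.le_mul_of_pos_right a (Nat.pow_pos (Nat.succ_pos B))⟩
  | add p q hp hq =>
    obtain ⟨K, hK⟩ := hp
    obtain ⟨K', hK'⟩ := hq
    refine ⟨K + K', fun x B hx => ?_⟩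
    rw [map_add, add_mul]
    exact Nat.add_le_add
      ((hK x B hx).trans (Nat.mul_le_mul_left _ (Nat.pow_le_pow_right (by omega) (by omega))))
      ((hK' x B hx).trans (Nat.mul_le_mul_left _ (Nat.pow_le_pow_right (by omega) (by omega))))
  | mul_X p i hp =>
    obtain ⟨K, hK⟩ := hp
    refine ⟨K + 1, fun x B hx => ?_⟩
    rw [map_mul, MvPolynomial.eval_X]
    calc _ ≤ K * (B + 1) ^ K * (B + 1) := Nat.mul_le_mul (hK x B hx) ((hx i).trans (by omega))
      _ = K * (B + 1) ^ (K + 1) := by ring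
      _ ≤ _ := Nat.mul_le_mul_right _ (by omega)

/-- Exponential functions are not polynomially bounded. -/
theorem exists_mul_pow_lt_two_pow (C K : ℕ) : ∃ s, 1 ≤ s ∧ C * s ^ K < 2 ^ s := by
  have h := (tendsto_pow_const_div_const_pow_of_one_lt K (one_lt_two (α := ℝ))).const_mul (C : ℝ)
  rw [mul_zero] at h
  obtain ⟨s, hs, h1⟩ := ((h.eventually (gt_mem_nhds one_pos)).and
    (Filter.eventually_ge_atTop 1)).exists
  refine ⟨s, h1, ?_⟩
  rw [← mul_div_assoc, div_lt_one (by positivity)] at hs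
  exact_mod_cast hs

/-- A dependency of type `3` is witnessed by traces along which the target grows exponentially. -/
theorem Lare.noThree_of_bound (E : Lare n) (j : Fin n) (p : MvPolynomial (Fin (n + 1)) ℕ)
    (hp : ∀ σ ∈ E.traces, σ.final j ≤ MvPolynomial.eval (extend σ.head σ.count) p) :
    NoThree E.deps j.castSucc := by
  intro i hi
  obtain ⟨c, hc, h⟩ := E.realized _ hi
  obtain ⟨K, hK⟩ := exists_eval_le p
  -- from the constant state `c * s` the target reaches `2 ^ s` with at most `c * c * s` marks
  obtain ⟨s, hs, hlt⟩ := exists_mul_pow_lt_two_pow (K * (c * c + 1) ^ K) K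
  have hcs : c ≤ c * s := Nat.le_mul_of_pos_right _ hs
  obtain ⟨σ, hσ, hhead, hcount, hl⟩ := h c le_rfl (fun _ => c * s) (c * s) (fun _ => hcs) hcs
  have hx : extend (fun _ => c * s) (c * s) i = c * s := by
    induction i using Fin.lastCases <;> simp
  rw [hx, extend_castSucc] at hl
  simp only [LowerRel, Nat.mul_div_cancel_left s (show 0 < c by omega)] at hl
  have hcount' : σ.count ≤ c * c * s := hcount.trans (by split_ifs <;> nlinarith)
  have hb := hK (extend σ.head σ.count) (c * c * s) (fun v => by
    induction v using Fin.lastCases with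
    | last => simpa using hcount'
    | cast v =>
      rw [extend_castSucc, hhead]
      nlinarith)
  have hpow : (c * c * s + 1) ^ K ≤ ((c * c + 1) * s) ^ K :=
    Nat.pow_le_pow_left (by nlinarith) K
  rw [mul_pow] at hpow
  have := Nat.mul_le_mul_left K hpow
  rw [← mul_assoc] at this
  exact absurd (hl.trans ((hp σ hσ).trans (hb.trans this))) (not_le.2 hlt)

theorem Lare.noThree_iff (E : Lare n) (j : Fin (n + 1)) :
    E.noThree j = true ↔ NoThree E.deps j := by
  simp [Lare.noThree, NoThree]

/-- The polynomial in normal form that the column `v` stands for. -/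
noncomputable def colPoly (K : ℕ) (v : Fin (n + 1) → WithBot DepType) :
    MvPolynomial (Fin (n + 1)) ℕ :=
  (∑ i ∈ Finset.univ.filter (fun i => entryIsOne (v i)),
      MvPolynomial.C 1 * MvPolynomial.X i) +
    MvPolynomial.C K * (∑ i, if v i = DepType.two then MvPolynomial.X i else 0) ^ K

theorem eval_colPoly (K : ℕ) (v : Fin (n + 1) → WithBot DepType) (x : Fin (n + 1) → ℕ) :
    MvPolynomial.eval x (colPoly K v) = colBound K v x := by
  simp only [colPoly, colBound, linPart, polyArg, map_add, map_sum, map_mul, map_pow,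
    MvPolynomial.eval_C, MvPolynomial.eval_X, one_mul, Finset.sum_filter,
    apply_ite (MvPolynomial.eval x), map_zero]

theorem colPoly_mem_Gam {K : ℕ} (hK : 1 ≤ K) {v : Fin (n + 1) → WithBot DepType}
    (hv : ∀ i, v i ≠ DepType.three) : colPoly K v ∈ Gam v := by
  refine ⟨hv, fun _ => 1, MvPolynomial.C K *
    (∑ i, if v i = DepType.two then MvPolynomial.X i else 0) ^ K, fun _ => Or.inr rfl, ?_, ?_, rfl⟩
  · intro i hi
    have h₁ := MvPolynomial.vars_mul _ _ hi
    rw [MvPolynomial.vars_C, Finset.empty_union] at h₁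
    have h₂ := MvPolynomial.vars_pow _ _ h₁
    have h₃ := MvPolynomial.vars_sum_subset _ _ h₂
    obtain ⟨j, -, hj⟩ := Finset.mem_biUnion.1 h₃
    split_ifs at hj with h
    · rw [MvPolynomial.vars_X, Finset.mem_singleton] at hj
      rwa [hj]
    · simp at hj
  · rw [map_mul, map_pow, map_sum]
    have : ∑ i, MvPolynomial.constantCoeff (if v i = DepType.two then
        (MvPolynomial.X i : MvPolynomial (Fin (n + 1)) ℕ) else 0) = 0 :=
      Finset.sum_eq_zero fun i _ => by split_ifs <;> simp
    rw [this, zero_pow (by omega), mul_zero]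

theorem X_last_mem_Gam {A : DepMatrix n} (hA : Admissible A) :
    MvPolynomial.X (Fin.last n) ∈ Gam (fun i => A i (Fin.last n)) := by
  have h0 := hA.2 _ _ hA.1
  have key : ∀ i, A i (Fin.last n) ≠ DepType.three ∧
      (entryIsOne (A i (Fin.last n)) = true ↔ i = Fin.last n) := by
    intro i
    by_cases hi : i = Fin.last n
    · rw [hi, hA.1]
      exact ⟨by decide, by simp [entryIsOne, DepType.isOne]⟩
    · rw [h0 i hi]
      exact ⟨by simp, by simp [entryIsOne, hi]⟩
  refine ⟨fun i => (key i).1, fun _ => 1, 0, fun _ => Or.inr rfl, by simp, by simp, ?_⟩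
  have : Finset.univ.filter (fun i => entryIsOne (A i (Fin.last n)) = true) = {Fin.last n} := by
    ext i
    simp [(key i).2]
  simp [this]

/-! ### Maximal matrices, and closed programs -/

theorem exists_le_som {S : Set (Dep n)} {A : DepMatrix n} (hA : A ∈ somHat S) :
    ∃ B ∈ som S, A ≤ B := by
  have : Finite (DepMatrix n) := by
    have : Finite (WithBot DepType) := inferInstanceAs (Finite (Option DepType))
    exact Pi.finite
  obtain ⟨B, hB, hmax⟩ := (Set.toFinite (somHat S)).exists_le_maximal hA
  exact ⟨B, hmax, hB⟩

theorem Lare.exists_describesVar (E : Lare n) (hE : E.WellFormed) :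
    ∃ ρ : DepMatrix n → Set (Trace n), E.traces ⊆ ⋃ A ∈ som (E.deps : Set (Dep n)), ρ A ∧
      ∀ A ∈ som (E.deps : Set (Dep n)), ∀ j, NoThree E.deps j → DescribesVar (ρ A) A j := by
  obtain ⟨K, hK, h⟩ := E.exists_covered hE
  refine ⟨fun B => {σ | ∀ M, σ.count ≤ M → ∀ j, NoThree E.deps j →
    extend σ.final M j ≤ colBound (K + 1) (fun i => B i j) (extend σ.head M)}, ?_, ?_⟩
  · intro σ hσ
    obtain ⟨A, hA, hb⟩ := h σ hσ
    obtain ⟨B, hB, hAB⟩ := exists_le_som hA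
    refine Set.mem_iUnion₂.2 ⟨B, hB, fun M hM j hj => (hb M hM j hj).trans ?_⟩
    exact colBound_le_of_le (fun i => hAB i j) (hj.entry_ne hB.prop) K _
  · intro A hA j hj
    by_cases hjl : j = Fin.last n
    · subst hjl
      exact ⟨_, X_last_mem_Gam hA.prop.1,
        fun k hk => absurd hk (Fin.castSucc_lt_last k).ne', fun _ => rfl⟩
    · refine ⟨colPoly (K + 1) fun i => A i j, colPoly_mem_Gam (by omega) (hj.entry_ne hA.prop),
        ?_, fun h => absurd h hjl⟩
      rintro k rfl σ hσ M hM
      rw [eval_colPoly]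
      simpa using hσ M hM _ hj

theorem Lare.exists_poly_bound (E : Lare n) (hE : E.WellFormed) {j : Fin n}
    (hj : NoThree E.deps j.castSucc) : ∃ p : MvPolynomial (Fin (n + 1)) ℕ, ∀ σ ∈ E.traces,
      ∀ M, σ.count ≤ M → σ.final j ≤ MvPolynomial.eval (extend σ.head M) p := by
  obtain ⟨K, -, h⟩ := E.exists_covered hE
  refine ⟨∑ i, MvPolynomial.X i + MvPolynomial.C K * (∑ i, MvPolynomial.X i) ^ K,
    fun σ hσ M hM => ?_⟩
  obtain ⟨A, -, hb⟩ := h σ hσ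
  have h₁ := hb M hM _ hj
  rw [extend_castSucc] at h₁
  refine h₁.trans ?_
  simp only [map_add, map_sum, map_mul, map_pow, MvPolynomial.eval_C, MvPolynomial.eval_X]
  refine Nat.add_le_add (Finset.sum_le_sum fun i _ => ?_)
    (Nat.mul_le_mul_left _ (Nat.pow_le_pow_left (Finset.sum_le_sum fun i _ => ?_) _)) <;>
  split_ifs <;> simp

/-- In closed programs all marks but boundedly many are erased. -/
theorem Lare.Closed.exists_count_le {E : Lare n} (hE : E.Closed) :
    ∃ c, ∀ σ ∈ E.traces, σ.count ≤ c := by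
  induction E with
  | instr a =>
    refine ⟨0, fun σ hσ => ?_⟩
    have h : σ.items = [some (a.exec σ.head)] := hσ
    simp [Trace.count, h]
  | mark =>
    refine ⟨1, fun σ hσ => ?_⟩
    have h : σ.items = [none] := hσ
    simp [Trace.count, h]
  | seq E₁ E₂ ih₁ ih₂ =>
    obtain ⟨c₁, h₁⟩ := ih₁ hE.1
    obtain ⟨c₂, h₂⟩ := ih₂ hE.2
    refine ⟨c₁ + c₂, ?_⟩
    rintro _ ⟨σ₁, hσ₁, σ₂, hσ₂, -, rfl⟩
    rw [Trace.count_append]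
    exact Nat.add_le_add (h₁ σ₁ hσ₁) (h₂ σ₂ hσ₂)
  | alt E₁ E₂ ih₁ ih₂ =>
    obtain ⟨c₁, h₁⟩ := ih₁ hE.1
    obtain ⟨c₂, h₂⟩ := ih₂ hE.2
    exact ⟨max c₁ c₂, fun σ hσ => hσ.elim (fun h => (h₁ σ h).trans (le_max_left _ _))
      fun h => (h₂ σ h).trans (le_max_right _ _)⟩
  | star E ih => exact hE.elim
  | bracket l E ih =>
    refine ⟨0, ?_⟩
    rintro _ ⟨σ, -, -, rfl⟩
    exact (Trace.count_erase σ).le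

end Final

theorem mainTheorem2 {n : ℕ} (E : Lare n) (hE : E.WellFormed) :
    -- if no dependency of type 3 is derived, the matrix abstraction describes the traces
    ((∀ j, E.noThree j = true) → SetDescribes E.traces (som (E.deps : Set (Dep n)))) ∧
    -- in general, it describes the variables that are not the target of a type-3 dependency
    (∃ ρ : DepMatrix n → Set (Trace n), E.traces ⊆ ⋃ A ∈ som (E.deps : Set (Dep n)), ρ A ∧
      ∀ A ∈ som (E.deps : Set (Dep n)), ∀ j, E.noThree j = true → DescribesVar (ρ A) A j) ∧
    -- the analysis is sound and complete for polynomial growth in the initial values and the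
    -- number of iteration marks
    (∀ j : Fin n, E.noThree j.castSucc = true ↔
      ∃ p : MvPolynomial (Fin (n + 1)) ℕ, ∀ σ ∈ E.traces,
        σ.final j ≤ MvPolynomial.eval (extend σ.head σ.count) p) ∧
    -- and in the initial values alone, if all iterations are inside loop brackets
    (E.Closed → ∀ j : Fin n, E.noThree j.castSucc = true ↔
      ∃ p : MvPolynomial (Fin n) ℕ, ∀ σ ∈ E.traces,
        σ.final j ≤ MvPolynomial.eval σ.head p) := by
  simp only [Lare.noThree_iff]
  obtain ⟨ρ, hρ, hdesc⟩ := E.exists_describesVar hE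
  refine ⟨fun hj => ⟨ρ, hρ, fun A hA => ?_⟩, ⟨ρ, hρ, hdesc⟩, fun j => ⟨fun hj => ?_, ?_⟩,
    fun hcl j => ⟨fun hj => ?_, ?_⟩⟩
  · choose p hp hb using fun j => hdesc A hA j (hj j)
    exact ⟨p, hA.prop.1, fun j => ⟨hp j, hb j⟩⟩
  · obtain ⟨p, hp⟩ := E.exists_poly_bound hE hj
    exact ⟨p, fun σ hσ => hp σ hσ _ le_rfl⟩
  · rintro ⟨p, hp⟩
    exact E.noThree_of_bound j p hp
  · obtain ⟨p, hp⟩ := E.exists_poly_bound hE hj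
    obtain ⟨c, hc⟩ := hcl.exists_count_le
    -- the number of marks is replaced by the constant `c`
    refine ⟨MvPolynomial.bind₁ (Fin.snoc (α := fun _ => MvPolynomial (Fin n) ℕ) MvPolynomial.X
      (MvPolynomial.C c)) p, fun σ hσ => (hp σ hσ c (hc σ hσ)).trans (le_of_eq ?_)⟩
    change MvPolynomial.eval _ p = MvPolynomial.eval₂Hom (RingHom.id ℕ) σ.head _
    rw [MvPolynomial.eval₂Hom_bind₁]
    change MvPolynomial.eval _ p = MvPolynomial.eval _ p
    congr 2
    funext i
    induction i using Fin.lastCases <;> simp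
  · rintro ⟨p, hp⟩
    refine E.noThree_of_bound j (MvPolynomial.rename Fin.castSucc p) fun σ hσ => ?_
    rw [MvPolynomial.eval_rename]
    convert hp σ hσ using 3
    funext i
    simp
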